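/- Let $(a_n)_{n\ge 0}$, $(b_n)_{n\ge 0}$ be sequences of positive numbers with $b_0=1$, $b_{n+1}<a_n<b_n$ for all $n\ge 0$, and $a_n,b_n\to 0$. Suppose that there is a constant $c\in(0,1)$ with $\max(b_{n+1}/a_n,\;a_n/b_n)<c$ for all $n\ge 0$, and that $\max(\sqrt[n]{a_n},\sqrt[n]{b_n})\to 0$ as $n\to\infty$. Let $$W=\{z\in\mathbb C:\operatorname{Re} z>0,\ \operatorname{Im} z<0\}\cup\bigcup_{n\ge 0}(a_n,b_n)\times[0,\infty),$$ and let $\phi$ be a conformal map of the unit disk $\mathbb D$ onto $W$, normalized so that, for $z\in W$, $\phi^{-1}(z)\to -1$ as $z\to 0$, $\phi^{-1}(z)\to 1$ as $z\to 1$, and $\phi^{-1}(z)\to -i$ as $\operatorname{Im} z\to-\infty$. Let $I_0=\{|z|=1,\ \operatorname{Im} z>0\}$, and let $\phi(I_0)$ be the corresponding part of $\partial W$, that is, the set of $w\in\partial W$ at which the limit of $\phi^{-1}(z)$ as $z\to w$, $z\in W$, exists and lies in $I_0$. For sets $E,F$ and an open set $\Omega$ in $\mathbb C$ let $\Gamma(E,F;\Omega)$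 be the family of curves $\gamma:[0,1]\to\mathbb C$ with $\gamma(0)\in E$, $\gamma(1)\in F$ and $\gamma(t)\in\Omega$ for $0<t<1$. Let $\operatorname{mod}$ denote the conformal modulus, that is, $\operatorname{mod}\Gamma=\inf_\rho\iint_\Omega\rho^2\,dx\,dy$ over the Borel functions $\rho\ge 0$ with $\int_\gamma\rho\,|dz|\ge 1$ for every rectifiable $\gamma\in\Gamma$. For $0<\varepsilon<1$ put $$\mathbb M(\varepsilon)=\frac{\operatorname{mod}\Gamma(\phi(I_0),\{0\}\times(-\infty,-\varepsilon);W)}{\frac1\pi\log\frac1\varepsilon}.$$ With $A_{n-1}=\prod_{k=0}^{n-1}a_k$ and $B_n=\prod_{k=0}^{n}b_k$, put for $n\ge 1$ $$m_n=1+\frac{\log(A_{n-1}/B_n)}{\log(1/a_n)},\qquad M_n=1+\frac{\log(A_{n-1}/B_n)}{\log(1/b_n)},$$ $$m=1+\liminf_{n\to\infty}\frac{\log(A_{n-1}/B_n)}{\log(1/a_n)},\qquad M=1+\limsup_{n\to\infty}\frac{\log(A_{n-1}/B_n)}{\log(1/b_n)}.$$ Then $$\liminf_{\varepsilon\to 0^+}\mathbb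 M(\varepsilon)=\liminf_{n\to\infty}m_n=m,\qquad \limsup_{\varepsilon\to 0^+}\mathbb M(\varepsilon)=\limsup_{n\to\infty}M_n=M.$$ -/

import Mathlib

open Filter Topology MeasureTheory Set

noncomputable section

/-! Curves and modulus.  A curve is a function `γ : ℝ → ℂ`, considered on the parameter interval
`[0, 1]` only. -/

/-- `γ` is continuous and of finite length on `[0, 1]`. -/
def IsRectifiableCurve (γ : ℝ → ℂ) : Prop :=
  ContinuousOn γ (Icc 0 1) ∧ eVariationOn γ (Icc 0 1) ≠ ⊤

/-- The family `Γ(E, F; Ω)` of the curves that connect `E` to `F` in `Ω`: one endpoint lies in `E`,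
the other one in `F`, and the open curve lies in `Ω`. -/
def curveFamily (E F Ω : Set ℂ) : Set (ℝ → ℂ) :=
  {γ | ContinuousOn γ (Icc 0 1) ∧ γ 0 ∈ E ∧ γ 1 ∈ F ∧ ∀ t ∈ Ioo (0 : ℝ) 1, γ t ∈ Ω}

/-- The `ρ`-length `∫_γ ρ |dz|` of a rectifiable curve: the integral of `ρ` along the
parametrization of `γ` by arc length, over `[0, length γ]`. -/
def rhoLength (ρ : ℂ → ENNReal) (γ : ℝ → ℂ) : ENNReal :=
  ∫⁻ s in Icc (0 : ℝ) (eVariationOn γ (Icc 0 1)).toReal, ρ (naturalParameterization γ (Icc 0 1) 0 s)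

/-- `ρ` is a Borel function with `∫_γ ρ |dz| ≥ 1` for every rectifiable `γ` in the family. -/
def IsAdmissible (ρ : ℂ → ENNReal) (Γ : Set (ℝ → ℂ)) : Prop :=
  Measurable ρ ∧ ∀ γ ∈ Γ, IsRectifiableCurve γ → 1 ≤ rhoLength ρ γ

/-- The conformal modulus of a family of curves in `Ω`. -/
def modulus (Ω : Set ℂ) (Γ : Set (ℝ → ℂ)) : ENNReal :=
  ⨅ (ρ : ℂ → ENNReal) (_ : IsAdmissible ρ Γ), ∫⁻ z in Ω, ρ z ^ 2

/-! The domain with chimneys. -/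

/-- The sequences of the left and right ends of the bases of the chimneys. -/
structure ChimneySequences (a b : ℕ → ℝ) : Prop where
  a_pos : ∀ n, 0 < a n
  b_pos : ∀ n, 0 < b n
  b_zero : b 0 = 1
  a_lt_b : ∀ n, a n < b n
  b_succ_lt_a : ∀ n, b (n + 1) < a n
  tendsto_a : Tendsto a atTop (𝓝 0)
  tendsto_b : Tendsto b atTop (𝓝 0)

/-- The chimney `(a n, b n) × [0, ∞)`. -/
def chimney (a b : ℕ → ℝ) (n : ℕ) : Set ℂ :=
  {z | a n < z.re ∧ z.re < b n ∧ 0 ≤ z.im}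

/-- The domain `W`: the open fourth quadrant together with all the chimneys. -/
def chimneyDomain (a b : ℕ → ℝ) : Set ℂ :=
  {z | 0 < z.re ∧ z.im < 0} ∪ ⋃ n, chimney a b n

/-- `φ` maps the open unit disk conformally onto `W` with inverse `ψ = φ⁻¹ : W → 𝔻`, so that
`0` corresponds to `-1`, `1` to `1`, and the point at infinity of the fourth quadrant to `-i`. -/
structure IsNormalizedConformalMap (W : Set ℂ) (φ ψ : ℂ → ℂ) : Prop where
  holomorphic : DifferentiableOn ℂ φ (Metric.ball 0 1)
  mapsTo : MapsTo φ (Metric.ball 0 1) W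
  mapsTo_inv : MapsTo ψ W (Metric.ball 0 1)
  left_inv : ∀ z ∈ Metric.ball (0 : ℂ) 1, ψ (φ z) = z
  right_inv : ∀ w ∈ W, φ (ψ w) = w
  at_zero : Tendsto ψ (𝓝[W] 0) (𝓝 (-1))
  at_one : Tendsto ψ (𝓝[W] 1) (𝓝 1)
  at_infinity : Tendsto ψ (comap Complex.im atBot ⊓ 𝓟 W) (𝓝 (-Complex.I))

/-- The part `φ(I)` of `∂W` that corresponds to a set `I` on the unit circle: the finite boundary
points at which `ψ = φ⁻¹ : W → 𝔻` has a limit and this limit lies in `I`. -/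
def boundaryImage (W : Set ℂ) (ψ : ℂ → ℂ) (I : Set ℂ) : Set ℂ :=
  {w ∈ frontier W | ∃ ζ ∈ I, Tendsto ψ (𝓝[W] w) (𝓝 ζ)}

/-- The open upper half `I₀` of the unit circle. -/
def upperArc : Set ℂ := {z | ‖z‖ = 1 ∧ 0 < z.im}

/-- The half-line `{0} × (-∞, -ε)`. -/
def lowerHalfLine (ε : ℝ) : Set ℂ := {z | z.re = 0 ∧ z.im < -ε}

/-- The normalized modulus of `Γ(φ(I₀), {0} × (-∞, -ε); W)`, for `0 < ε < 1`. -/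
def normalizedModulus (a b : ℕ → ℝ) (ψ : ℂ → ℂ) (ε : ℝ) : ENNReal :=
  modulus (chimneyDomain a b)
      (curveFamily (boundaryImage (chimneyDomain a b) ψ upperArc) (lowerHalfLine ε)
        (chimneyDomain a b)) /
    ENNReal.ofReal (1 / Real.pi * Real.log (1 / ε))

/-- `log (A (n-1) / B n)`, where `A (n-1) = a 0 ⋯ a (n-1)` (an empty product for `n = 0`)
and `B n = b 0 ⋯ b n`. -/
def logRatio (a b : ℕ → ℝ) (n : ℕ) : ℝ :=
  Real.log ((∏ k ∈ Finset.range n, a k) / ∏ k ∈ Finset.range (n + 1), b k)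

/-- The sequence `m n`. -/
def lowerSeq (a b : ℕ → ℝ) (n : ℕ) : ℝ := 1 + logRatio a b n / Real.log (1 / a n)

/-- The sequence `M n` (of interest for `n ≥ 1`, where `b n < 1`). -/
def upperSeq (a b : ℕ → ℝ) (n : ℕ) : ℝ := 1 + logRatio a b n / Real.log (1 / b n)

/-- The number `m`. -/
def lowerExponent (a b : ℕ → ℝ) : EReal :=
  1 + liminf (fun n => ((logRatio a b n / Real.log (1 / a n) : ℝ) : EReal)) atTop

/-- The number `M`. -/
def upperExponent (a b : ℕ → ℝ) : EReal :=
  1 + limsup (fun n => ((logRatio a b n / Real.log (1 / b n) : ℝ) : EReal)) atTop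

end

/-! The modulus is governed by the logarithmic scale. A circular arc about `0` that starts on the
negative imaginary axis reaches `φ(I₀)` after the angle `π/2` if its radius lies in a segment `(b
(k+1), a k)`. If its radius lies in `(a k, b k)`, it ends on the left wall of a chimney after an
angle of at most `π`. The length-area method applied to these arcs gives the lower bound `(1/π) *
scaleSize`, where `scaleSize` is the logarithmic length of the scales from `ε` to `1` with the
segments counted twice (`scaleSize_le_modulus`).

The upper bound `modulus_le_scaleSize` comes from an explicit weight: `(2/π)/|z|` in the lower
half-plane at the scale of a segment, `(1/π)/|z - a k|` at the scale of a chimney, and collars of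
weight `1/|z|` around the transition radii `a k`, `b k`, `ε`. A curve of the family makes a quarter
turn about `0`, or a half turn about a left corner, or is caught by a collar. Each collar has
bounded area, so the two bounds differ by `O(n)`. This is `o(log (1 / b n))` because the `n`-th
roots of `b n` tend to `0`.

Telescoping turns `scaleSize / log (1/ε)` into `1 + (logRatio n + log (max (a n) ε / ε)) / log
(1/ε)` for `b (n+1) ≤ ε ≤ b n`. As `ε` decreases, this does not increase on `[a n, b n]` and does
not decrease on `[b (n+1), a n]`, because `logRatio n ≤ log (1 / a n)`. The extreme values are
therefore taken at `a n` and `b n`, where they are `m n` and `M n`.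

Both bounds need information on `φ(I₀)`. The lower one needs that the open segments and the left
walls belong to it. The upper one needs that its points lie in the closed upper half-plane, and
those on the real axis in `(0, 1)`. This is proved directly: `ψ` has unimodular limits at flat
boundary points (a barrier and Schwarz–Pick), it is not constant on a flat piece, and a cut of `W`
separates boundary values according to the limits of `ψ` at its ends (`false_of_cut`). -/

/-! ### Maximum principle and Schwarz–Pick estimate -/

/-- Maximum principle with a boundary condition in terms of upper limits. -/
lemma norm_le_of_eventually_norm_le {U : Set ℂ} (hU : IsOpen U) (hb : Bornology.IsBounded U)
    {g : ℂ → ℂ} (hg : DifferentiableOn ℂ g U) {C : ℝ}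
    (h : ∀ p ∈ frontier U, ∀ η > 0, ∀ᶠ z in 𝓝[U] p, ‖g z‖ ≤ C + η) {z : ℂ} (hz : z ∈ U) :
    ‖g z‖ ≤ C := by
  by_contra! hlt
  obtain ⟨η, hη, hη'⟩ : ∃ η > 0, C + η < ‖g z‖ := ⟨(‖g z‖ - C) / 2, by linarith, by linarith⟩
  have key : ∀ t : ℝ, C + η < t → IsCompact {w | w ∈ U ∧ t ≤ ‖g w‖} := by
    intro t ht
    refine Metric.isCompact_of_isClosed_isBounded ?_ (hb.subset fun w hw => hw.1)
    refine isClosed_of_closure_subset fun w hw => ?_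
    have hwU : w ∈ closure U := closure_mono (fun _ h => h.1) hw
    by_cases hw' : w ∈ U
    · refine ⟨hw', ?_⟩
      by_contra! hlt
      have h1 : ∀ᶠ y in 𝓝 w, ‖g y‖ < t :=
        ((hg.continuousOn.continuousAt (hU.mem_nhds hw')).norm).eventually_lt_const hlt
      rw [mem_closure_iff_frequently] at hw
      obtain ⟨y, hy, hy'⟩ := (hw.and_eventually h1).exists
      linarith [hy.2]
    · have hf : w ∈ frontier U := ⟨hwU, by rwa [hU.interior_eq]⟩
      have h1 := h w hf η hη
      rw [eventually_nhdsWithin_iff] at h1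
      rw [mem_closure_iff_frequently] at hw
      obtain ⟨y, hy, hy'⟩ := (hw.and_eventually h1).exists
      linarith [hy.2, hy' hy.1]
  obtain ⟨z₁, hz₁, hmax⟩ := (key ‖g z‖ hη').exists_isMaxOn ⟨z, hz, le_rfl⟩
    ((hg.continuousOn.mono fun w hw => hw.1).norm)
  have hmaxU : ∀ w ∈ U, ‖g w‖ ≤ ‖g z₁‖ := by
    intro w hw
    by_cases h1 : ‖g z‖ ≤ ‖g w‖
    · exact hmax ⟨hw, h1⟩
    · exact (not_le.1 h1).le.trans hz₁.2
  have hK := key ‖g z₁‖ (hη'.trans_le hz₁.2)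
  -- The set where the maximum is attained is compact, and it is open by the local maximum
  -- principle. It is thus clopen in the whole plane, which is impossible; connectedness of `U`
  -- plays no role.
  have hopen : IsOpen {w | w ∈ U ∧ ‖g z₁‖ ≤ ‖g w‖} := by
    rw [isOpen_iff_mem_nhds]
    rintro w ⟨hw, hw'⟩
    have h1 : ∀ᶠ y in 𝓝 w, ‖g y‖ = ‖g w‖ := by
      refine Complex.norm_eventually_eq_of_isLocalMax ?_ ?_
      · filter_upwards [hU.mem_nhds hw] with y hy using hg.differentiableAt (hU.mem_nhds hy)
      · filter_upwards [hU.mem_nhds hw] with y hy using (hmaxU y hy).trans hw'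
    filter_upwards [h1, hU.mem_nhds hw] with y hy hyU
    exact ⟨hyU, hw'.trans hy.ge⟩
  rcases isClopen_iff.1 ⟨hK.isClosed, hopen⟩ with h0 | h0
  · exact (h0.subset ⟨hz₁.1, le_rfl⟩ : z₁ ∈ (∅ : Set ℂ))
  · exact noncompact_univ ℂ (h0 ▸ hK)

/-- Schwarz–Pick: composing with the disk automorphism that moves `f z` to `0` reduces the estimate
to Schwarz's lemma. The factor `1 - ‖f z‖ ^ 2` is small near the boundary, which later bounds the
derivative up to the base of a box. -/
lemma norm_deriv_mul_le_of_mapsTo_ball {f : ℂ → ℂ} {z : ℂ} {R : ℝ} (hR : 0 < R)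
    (hd : DifferentiableOn ℂ f (Metric.ball z R))
    (hm : ∀ w ∈ Metric.ball z R, ‖f w‖ < 1) : ‖deriv f z‖ * R ≤ 1 - ‖f z‖ ^ 2 := by
  have hz : z ∈ Metric.ball z R := Metric.mem_ball_self hR
  set c := f z with hc
  have hc1 : ‖c‖ < 1 := hm z hz
  have hne : ∀ w ∈ Metric.ball z R, 1 - (starRingEnd ℂ) c * f w ≠ 0 := by
    intro w hw h0
    have h1 : ‖(starRingEnd ℂ) c * f w‖ = 1 := by
      rw [← sub_eq_zero.1 h0]; simp
    rw [norm_mul, RCLike.norm_conj] at h1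
    nlinarith [hm w hw, norm_nonneg c, norm_nonneg (f w)]
  let g : ℂ → ℂ := fun w => (f w - c) / (1 - (starRingEnd ℂ) c * f w)
  have hgd : DifferentiableOn ℂ g (Metric.ball z R) :=
    (hd.sub_const _).div ((differentiableOn_const _).sub (hd.const_mul _)) hne
  have hg1 : ∀ w ∈ Metric.ball z R, ‖g w‖ ≤ 1 := by
    intro w hw
    have h1 : 0 < ‖1 - (starRingEnd ℂ) c * f w‖ := norm_pos_iff.2 (hne w hw)
    rw [norm_div, div_le_one h1, ← abs_of_nonneg (norm_nonneg (f w - c)), ← abs_of_pos h1,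
      ← sq_le_sq, ← Complex.normSq_eq_norm_sq, ← Complex.normSq_eq_norm_sq]
    have h2 := hm w hw
    have h3 : Complex.normSq c < 1 := by
      rw [Complex.normSq_eq_norm_sq]; nlinarith [norm_nonneg c]
    have h4 : Complex.normSq (f w) < 1 := by
      rw [Complex.normSq_eq_norm_sq]; nlinarith [norm_nonneg (f w)]
    simp only [Complex.normSq_apply, Complex.sub_re, Complex.sub_im, Complex.mul_re, Complex.mul_im,
      Complex.conj_re, Complex.conj_im, Complex.one_re, Complex.one_im] at h3 h4 ⊢
    -- The difference of the two squares is `(1 - |c|²)(1 - |f w|²)`.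
    nlinarith [mul_pos (sub_pos.2 h3) (sub_pos.2 h4)]
  have hgz : g z = 0 := by simp [g, hc]
  have hfd : DifferentiableAt ℂ f z := hd.differentiableAt (Metric.isOpen_ball.mem_nhds hz)
  have hder : HasDerivAt g (deriv f z / (1 - (starRingEnd ℂ) c * c)) z := by
    have h1 := (hfd.hasDerivAt.sub_const c).fun_div
      ((hasDerivAt_const z (1 : ℂ)).fun_sub (hfd.hasDerivAt.const_mul ((starRingEnd ℂ) c))) (hne z hz)
    refine h1.congr_deriv ?_
    rw [← hc, sub_self, zero_mul, sub_zero, sq, mul_div_mul_right _ _ (hne z hz)]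
  have h5 := Complex.norm_deriv_le_div_of_mapsTo_ball (R₂ := 1) hgd
    (fun w hw => by rw [hgz, mem_closedBall_zero_iff]; exact hg1 w hw) hR
  have h6 : (1 - (starRingEnd ℂ) c * c) = ((1 - ‖c‖ ^ 2 : ℝ) : ℂ) := by
    rw [← Complex.normSq_eq_conj_mul_self, Complex.normSq_eq_norm_sq]; push_cast; ring
  have h7 : 0 < 1 - ‖c‖ ^ 2 := by nlinarith [norm_nonneg c]
  rw [hder.deriv, h6, norm_div, Complex.norm_real, Real.norm_of_nonneg h7.le,
    div_le_div_iff₀ h7 hR, one_mul] at h5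
  exact h5

/-! ### Regularity of the inverse map and its modulus at the boundary -/

namespace IsNormalizedConformalMap

variable {W : Set ℂ} {φ ψ : ℂ → ℂ}

lemma injOn_inv (h : IsNormalizedConformalMap W φ ψ) : InjOn ψ W := fun x hx y hy hxy => by
  rw [← h.right_inv x hx, hxy, h.right_inv y hy]

/-- Open mapping: the alternative, that `φ` is locally constant, contradicts `ψ ∘ φ = id`. -/
lemma image_mem_nhds (h : IsNormalizedConformalMap W φ ψ) {w : ℂ} (hw : w ∈ W) {N : Set ℂ}
    (hN : N ∈ 𝓝 (ψ w)) : φ '' (N ∩ Metric.ball 0 1) ∈ 𝓝 w := by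
  have hb : Metric.ball (0 : ℂ) 1 ∈ 𝓝 (ψ w) := Metric.isOpen_ball.mem_nhds (h.mapsTo_inv hw)
  have ha : AnalyticAt ℂ φ (ψ w) := h.holomorphic.analyticAt hb
  rcases ha.eventually_constant_or_nhds_le_map_nhds_aux with h1 | h1
  · exfalso
    obtain ⟨z, ⟨hz, hzb⟩, hne⟩ := ((h1.and hb).filter_mono
      (nhdsWithin_le_nhds (s := {ψ w}ᶜ))).and self_mem_nhdsWithin |>.exists
    apply hne
    rw [mem_singleton_iff, ← h.left_inv z hzb, hz, h.left_inv _ (h.mapsTo_inv hw)]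
  · rw [h.right_inv w hw] at h1
    exact h1 (image_mem_map (inter_mem hN hb))

lemma continuousAt_inv (h : IsNormalizedConformalMap W φ ψ) {w : ℂ} (hw : w ∈ W) :
    ContinuousAt ψ w := by
  intro N hN
  refine mem_map.2 (mem_of_superset (h.image_mem_nhds hw hN) ?_)
  rintro _ ⟨z, ⟨hz, hzb⟩, rfl⟩
  rwa [mem_preimage, h.left_inv z hzb]

/-- Where `φ'` does not vanish this is the inverse function theorem. Zeros of `φ'` are isolated,
since `φ` would otherwise be constant on a ball, and at an isolated zero the continuous `ψ` has a
removable singularity. So it is not necessary to know that an injective map has no critical points.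
-/
lemma differentiableOn_inv (h : IsNormalizedConformalMap W φ ψ) (hW : IsOpen W) :
    DifferentiableOn ℂ ψ W := by
  have key : ∀ w ∈ W, deriv φ (ψ w) ≠ 0 → DifferentiableAt ℂ ψ w := by
    intro w hw hne
    have hb : Metric.ball (0 : ℂ) 1 ∈ 𝓝 (ψ w) := Metric.isOpen_ball.mem_nhds (h.mapsTo_inv hw)
    refine (HasDerivAt.of_local_left_inverse (h.continuousAt_inv hw)
      (h.holomorphic.differentiableAt hb).hasDerivAt hne ?_).differentiableAt
    filter_upwards [hW.mem_nhds hw] with y hy using h.right_inv y hy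
  intro w hw
  have hb : Metric.ball (0 : ℂ) 1 ∈ 𝓝 (ψ w) := Metric.isOpen_ball.mem_nhds (h.mapsTo_inv hw)
  have ha : AnalyticAt ℂ (deriv φ) (ψ w) := (h.holomorphic.analyticAt hb).deriv
  have hz := ha.eventually_eq_zero_or_eventually_ne_zero.resolve_left (fun h0 => by
    obtain ⟨r, hr, hr'⟩ := Metric.eventually_nhds_iff_ball.1 (h0.and hb)
    have h1 : (ψ w + (r / 2 : ℝ) : ℂ) ∈ Metric.ball (ψ w) r := by
      rw [Metric.mem_ball, dist_eq_norm, add_sub_cancel_left, Complex.norm_real,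
        Real.norm_of_nonneg (by positivity)]; linarith
    have h2 := Metric.isOpen_ball.is_const_of_deriv_eq_zero
      (convex_ball (ψ w) r).isPreconnected
      (h.holomorphic.mono fun x hx => (hr' x hx).2) (fun x hx => (hr' x hx).1)
      h1 (Metric.mem_ball_self hr)
    have h3 := congrArg ψ h2
    rw [h.left_inv _ (hr' _ h1).2, h.left_inv _ (h.mapsTo_inv hw)] at h3
    have h4 : ((r / 2 : ℝ) : ℂ) = 0 := by linear_combination h3
    rw [Complex.ofReal_eq_zero] at h4
    linarith)
  refine (Complex.analyticAt_of_differentiable_on_punctured_nhds_of_continuousAt ?_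
    (h.continuousAt_inv hw)).differentiableAt.differentiableWithinAt
  rw [eventually_nhdsWithin_iff] at hz ⊢
  filter_upwards [(h.continuousAt_inv hw).eventually hz, hW.mem_nhds hw] with y hy hyW hne
  exact key y hyW (hy fun h0 => hne (h.injOn_inv hyW hw h0))

/-- The modulus of the inverse map tends to `1` at the boundary. -/
lemma tendsto_norm_inv (h : IsNormalizedConformalMap W φ ψ) {w : ℂ} (hw : w ∉ W) :
    Tendsto (fun z => ‖ψ z‖) (𝓝[W] w) (𝓝 1) := by
  rw [tendsto_order]
  refine ⟨fun r hr => ?_, fun r hr => ?_⟩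
  · by_contra hf
    rw [not_eventually] at hf
    -- Otherwise the values of `ψ` cluster at some `ζ` inside the disk. Continuity of `φ` at `ζ`
    -- then gives `φ ζ = w`, so that `w` would lie in `W`.
    have hK : IsCompact (Metric.closedBall (0 : ℂ) r) := isCompact_closedBall 0 r
    obtain ⟨ζ, hζ, hcl⟩ := hK.exists_mapClusterPt_of_frequently (l := 𝓝[W] w) (f := ψ)
      (hf.mono fun z hz => by simpa using hz)
    have hζb : ζ ∈ Metric.ball (0 : ℂ) 1 := by
      rw [mem_closedBall_zero_iff] at hζ; rw [mem_ball_zero_iff]; linarith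
    have hc : ContinuousAt φ ζ :=
      h.holomorphic.continuousOn.continuousAt (Metric.isOpen_ball.mem_nhds hζb)
    have h1 : MapClusterPt (φ ζ) (𝓝[W] w) (φ ∘ ψ) := hcl.continuousAt_comp hc
    have h2 : Tendsto (φ ∘ ψ) (𝓝[W] w) (𝓝 w) :=
      (tendsto_nhdsWithin_of_tendsto_nhds tendsto_id).congr' (by
        filter_upwards [self_mem_nhdsWithin] with z hz using (h.right_inv z hz).symm)
    have h3 : φ ζ = w := eq_of_nhds_neBot (h1.clusterPt.mono h2).neBot
    exact hw (h3 ▸ h.mapsTo hζb)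
  · filter_upwards [self_mem_nhdsWithin] with z hz
    have := h.mapsTo_inv hz
    rw [mem_ball_zero_iff] at this
    linarith

end IsNormalizedConformalMap

/-! ### Holomorphic functions on boxes: behaviour at the base -/

/-- The open rectangle of half-width `r` and height `t` that stands on the real axis at `c`. -/
def halfBox (c r t : ℝ) : Set ℂ := {z | |z.re - c| < r ∧ 0 < z.im ∧ z.im < t}

lemma isOpen_halfBox (c r t : ℝ) : IsOpen (halfBox c r t) :=
  (isOpen_lt (f := fun z : ℂ => |z.re - c|) (by fun_prop) continuous_const).and
    ((isOpen_lt continuous_const Complex.continuous_im).and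
      (isOpen_lt Complex.continuous_im continuous_const))

lemma convex_halfBox (c r t : ℝ) : Convex ℝ (halfBox c r t) := by
  rintro x ⟨hx1, hx2, hx3⟩ y ⟨hy1, hy2, hy3⟩ s u hs hu hsu
  rw [abs_lt] at hx1 hy1
  obtain ⟨⟨hx1, hx4⟩, hy1, hy4⟩ := hx1, hy1
  have h0 : 0 < s ∨ 0 < u := by
    by_contra! h0; linarith [h0.1, h0.2]
  simp only [halfBox, mem_ofPred_eq, Complex.add_re, Complex.add_im, Complex.real_smul,
    Complex.re_ofReal_mul, Complex.im_ofReal_mul, abs_lt]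
  have e : u = 1 - s := by linarith
  subst e
  refine ⟨⟨?_, ?_⟩, ?_, ?_⟩ <;> rcases h0 with h0 | h0
  · nlinarith [mul_pos h0 (sub_pos.2 hx1), mul_nonneg hu (sub_nonneg.2 hy1.le)]
  · nlinarith [mul_nonneg hs (sub_nonneg.2 hx1.le), mul_pos h0 (sub_pos.2 hy1)]
  · nlinarith [mul_pos h0 (sub_pos.2 hx4), mul_nonneg hu (sub_nonneg.2 hy4.le)]
  · nlinarith [mul_nonneg hs (sub_nonneg.2 hx4.le), mul_pos h0 (sub_pos.2 hy4)]
  · nlinarith [mul_pos h0 hx2, mul_nonneg hu hy2.le]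
  · nlinarith [mul_nonneg hs hx2.le, mul_pos h0 hy2]
  · nlinarith [mul_pos h0 (sub_pos.2 hx3), mul_nonneg hu (sub_nonneg.2 hy3.le)]
  · nlinarith [mul_nonneg hs (sub_nonneg.2 hx3.le), mul_pos h0 (sub_pos.2 hy3)]

lemma halfBox_mono {c r t c' r' t' : ℝ} (h : |c - c'| + r ≤ r') (ht : t ≤ t') :
    halfBox c r t ⊆ halfBox c' r' t' := fun z hz => by
  refine ⟨?_, hz.2.1, hz.2.2.trans_le ht⟩
  calc |z.re - c'| = |(z.re - c) + (c - c')| := by ring_nf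
    _ ≤ |z.re - c| + |c - c'| := abs_add_le _ _
    _ < r' := by linarith [hz.1]

lemma isBounded_halfBox (c r t : ℝ) : Bornology.IsBounded (halfBox c r t) := by
  refine (Metric.isBounded_closedBall (x := (0 : ℂ)) (r := |c| + r + t)).subset fun z hz => ?_
  rw [mem_closedBall_zero_iff]
  have h1 := Complex.norm_le_abs_re_add_abs_im z
  have h2 : |z.im| = z.im := abs_of_pos hz.2.1
  have h3 : |z.re| ≤ |z.re - c| + |c| := by
    calc |z.re| = |(z.re - c) + c| := by ring_nf
      _ ≤ _ := abs_add_le _ _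
  linarith [hz.1, hz.2.2]

lemma mem_frontier_halfBox {c r t : ℝ} {p : ℂ} (hp : p ∈ frontier (halfBox c r t)) :
    |p.re - c| ≤ r ∧ 0 ≤ p.im ∧ p.im ≤ t ∧ (p.im = 0 ∨ |p.re - c| = r ∨ p.im = t) := by
  have hcl : closure (halfBox c r t) ⊆ {z | |z.re - c| ≤ r ∧ 0 ≤ z.im ∧ z.im ≤ t} := by
    refine closure_minimal (fun z hz => ⟨hz.1.le, hz.2.1.le, hz.2.2.le⟩) ?_
    exact (isClosed_le (f := fun z : ℂ => |z.re - c|) (by fun_prop) continuous_const).inter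
      ((isClosed_le continuous_const Complex.continuous_im).inter
        (isClosed_le Complex.continuous_im continuous_const))
  obtain ⟨h1, h2, h3⟩ := hcl hp.1
  refine ⟨h1, h2, h3, ?_⟩
  have h4 := hp.2
  rw [(isOpen_halfBox c r t).interior_eq] at h4
  by_contra! h5
  exact h4 ⟨lt_of_le_of_ne h1 h5.2.1, lt_of_le_of_ne h2 h5.1.symm, lt_of_le_of_ne h3 h5.2.2⟩

/-- Hopf-type estimate: a holomorphic function with values in `1 / 2 < |w| < 1` whose modulus tends
to `1` at the base of a box has modulus close to `1` near the base, linearly in the height. -/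
lemma one_sub_norm_le_of_tendsto_one {f : ℂ → ℂ} {c r : ℝ} (hr : 0 < r)
    (hf : DifferentiableOn ℂ f (halfBox c r r)) (h2 : ∀ z ∈ halfBox c r r, 1 / 2 < ‖f z‖)
    (h1 : ∀ x : ℝ, |x - c| ≤ r → Tendsto (fun z => ‖f z‖) (𝓝[halfBox c r r] (x : ℂ)) (𝓝 1))
    {y : ℝ} (hy : 0 < y) (hyr : y < r) : 1 - ‖f (c + y * Complex.I)‖ ≤ 2 * y / r := by
  -- The barrier: with `X = (re z - c)/r` and `Y = im z / r`, the real part of `P` is `X² - Y² +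
  -- 2Y`. It is nonnegative on the base and at least `1` on the other three sides, where `exp (-1) <
  -- 1/2 < |f|`. Hence `|exp (-P) / f| ≤ 1`, and on the axis `X = 0` the barrier is at most `2y/r`.
  let P : ℂ → ℂ := fun z => ((z - c) / r) ^ 2 - 2 * Complex.I * ((z - c) / r)
  have hPre : ∀ z, (P z).re = ((z.re - c) / r) ^ 2 - (z.im / r) ^ 2 + 2 * (z.im / r) := by
    intro z
    have e : (z - c) / r = (((z.re - c) / r : ℝ) : ℂ) + ((z.im / r : ℝ) : ℂ) * Complex.I := by
      apply Complex.ext <;> simp [Complex.div_ofReal_re, Complex.div_ofReal_im]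
    simp only [P, e, sq]
    simp
  have hPc : Continuous P := by fun_prop
  have hne : ∀ z ∈ halfBox c r r, f z ≠ 0 := fun z hz h0 => by
    have := h2 z hz; rw [h0, norm_zero] at this; linarith
  let g : ℂ → ℂ := fun z => Complex.exp (-P z) / f z
  have hPd : Differentiable ℂ P := by fun_prop
  have hg : DifferentiableOn ℂ g (halfBox c r r) :=
    (hPd.neg.cexp.differentiableOn).div hf hne
  have hgn : ∀ z, ‖g z‖ = Real.exp (-(P z).re) / ‖f z‖ := fun z => by
    simp [g, Complex.norm_exp]
  have hPt : ∀ p : ℂ, Tendsto (fun z => Real.exp (-(P z).re)) (𝓝[halfBox c r r] p)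
      (𝓝 (Real.exp (-(P p).re))) := fun p =>
    ((Real.continuous_exp.comp (Complex.continuous_re.comp hPc).neg).tendsto p).mono_left
      nhdsWithin_le_nhds
  have key : ∀ z ∈ halfBox c r r, ‖g z‖ ≤ 1 := by
    intro z hz
    refine norm_le_of_eventually_norm_le (isOpen_halfBox c r r) (isBounded_halfBox c r r) hg ?_ hz
    intro p hp η hη
    obtain ⟨hp1, hp2, hp3, hp4⟩ := mem_frontier_halfBox hp
    have hi0 : 0 ≤ p.im / r := by positivity
    have hi1 : p.im / r ≤ 1 := (div_le_one hr).2 hp3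
    have hq : (1 : ℝ) ≤ (P p).re ∨ p.im = 0 := by
      rw [hPre]
      rcases hp4 with h | h | h
      · exact Or.inr h
      · left
        have : ((p.re - c) / r) ^ 2 = 1 := by
          rw [div_pow, ← sq_abs (p.re - c), h, div_self (by positivity)]
        nlinarith
      · left
        have : p.im / r = 1 := by rw [h, div_self hr.ne']
        rw [this]; nlinarith [sq_nonneg ((p.re - c) / r)]
    rcases hq with hq | hq
    · have hlt : Real.exp (-(P p).re) < 1 / 2 := by
        calc Real.exp (-(P p).re) ≤ Real.exp (-1) := Real.exp_le_exp.2 (by linarith)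
          _ < 1 / 2 := by
            rw [Real.exp_neg, inv_lt_comm₀ (Real.exp_pos 1) (by norm_num)]
            have := Real.exp_one_gt_d9; norm_num; linarith
      filter_upwards [(hPt p).eventually_lt_const hlt, self_mem_nhdsWithin] with w hw hwU
      rw [hgn, div_le_iff₀ (by linarith [h2 w hwU])]
      nlinarith [h2 w hwU]
    · have hpx : p = ((p.re : ℝ) : ℂ) := Complex.ext (by simp) (by simp [hq])
      have h1p := h1 p.re hp1
      rw [← hpx] at h1p
      have h3 := (hPt p).div h1p one_ne_zero
      have h4 : Real.exp (-(P p).re) / 1 < 1 + η := by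
        have : Real.exp (-(P p).re) ≤ 1 := by
          rw [Real.exp_le_one_iff, hPre, hq]; simp; positivity
        linarith
      filter_upwards [h3.eventually_lt_const h4] with w hw
      rw [hgn]; exact hw.le
  have hz : (c + y * Complex.I : ℂ) ∈ halfBox c r r := by
    refine ⟨?_, ?_, ?_⟩ <;> simp [hy, hyr, hr]
  have h3 := key _ hz
  have hpos : 0 < ‖f (c + y * Complex.I)‖ := by linarith [h2 _ hz]
  rw [hgn, div_le_one hpos, hPre] at h3
  have h4 := Real.add_one_le_exp (-(((c + y * Complex.I : ℂ).re - c) / r) ^ 2 - (-((c + y * Complex.I : ℂ).im / r) ^ 2 + 2 * ((c + y * Complex.I : ℂ).im / r)))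
  have h5 : (c + y * Complex.I : ℂ).re = c := by simp
  have h6 : (c + y * Complex.I : ℂ).im = y := by simp
  simp only [h5, h6, sub_self, zero_div] at h3 h4
  have e : -((0 : ℝ) ^ 2 - (y / r) ^ 2 + 2 * (y / r)) = -(0 : ℝ) ^ 2 - (-(y / r) ^ 2 + 2 * (y / r)) := by
    ring
  rw [e] at h3
  have h7 : 2 * y / r = 2 * (y / r) := by ring
  rw [h7]
  nlinarith [sq_nonneg (y / r)]

/-- A holomorphic map of a box into the unit disk whose modulus tends to `1` at the base of the box
has a limit at the midpoint of the base. -/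
lemma exists_tendsto_of_tendsto_norm_one {f : ℂ → ℂ} {δ : ℝ} (hδ : 0 < δ)
    (hf : DifferentiableOn ℂ f (halfBox 0 δ δ)) (hb : ∀ z ∈ halfBox 0 δ δ, ‖f z‖ < 1)
    (h1 : ∀ x : ℝ, |x| < δ → Tendsto (fun z => ‖f z‖) (𝓝[halfBox 0 δ δ] (x : ℂ)) (𝓝 1)) :
    ∃ ζ, Tendsto f (𝓝[halfBox 0 δ δ] 0) (𝓝 ζ) := by
  have h0 : ∀ᶠ z in 𝓝[halfBox 0 δ δ] (0 : ℂ), 1 / 2 < ‖f z‖ := by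
    have := h1 0 (by simpa using hδ)
    rw [Complex.ofReal_zero] at this
    exact this.eventually_const_lt (by norm_num)
  rw [eventually_nhdsWithin_iff, Metric.eventually_nhds_iff] at h0
  obtain ⟨r₀, hr₀, h0⟩ := h0
  obtain ⟨r, hr, hr1, hr2⟩ : ∃ r > 0, 4 * r ≤ r₀ ∧ 4 * r ≤ δ :=
    ⟨min r₀ δ / 4, by positivity, by linarith [min_le_left r₀ δ], by linarith [min_le_right r₀ δ]⟩
  have hhalf : ∀ z ∈ halfBox 0 (2 * r) (2 * r), 1 / 2 < ‖f z‖ := by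
    intro z hz
    refine h0 ?_ (halfBox_mono (by simp; linarith) (by linarith) hz)
    rw [dist_zero_right]
    have h3 := Complex.norm_le_abs_re_add_abs_im z
    have h4 := hz.1
    rw [sub_zero] at h4
    rw [abs_of_pos hz.2.1] at h3
    linarith [hz.2.2]
  have hbox : ∀ c : ℝ, |c| < r → halfBox c r r ⊆ halfBox 0 (2 * r) (2 * r) := fun c hc =>
    halfBox_mono (by rw [sub_zero]; linarith) (by linarith)
  have hbox' : halfBox 0 (2 * r) (2 * r) ⊆ halfBox 0 δ δ :=
    halfBox_mono (by simp; linarith) (by linarith)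
  -- The height cancels: Schwarz–Pick on the disk of radius `im z` gives `|f'| im z ≤ 1 - |f|² ≤ 2
  -- (1 - |f|)`, and the barrier gives `1 - |f| ≤ 2 im z / r`. So `f` is Lipschitz on the convex box
  -- and extends to its closure.
  have hder : ∀ z ∈ halfBox 0 r r, ‖deriv f z‖ ≤ 4 / r := by
    intro z hz
    have hzr : |z.re| < r := by simpa using hz.1
    have hy := hz.2.1
    have h3 := one_sub_norm_le_of_tendsto_one hr (hf.mono ((hbox _ hzr).trans hbox'))
      (fun w hw => hhalf w (hbox _ hzr hw)) (fun x hx => by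
        refine (h1 x ?_).mono_left (nhdsWithin_mono _ ((hbox _ hzr).trans hbox'))
        calc |x| = |(x - z.re) + z.re| := by ring_nf
          _ ≤ |x - z.re| + |z.re| := abs_add_le _ _
          _ < δ := by linarith) hy hz.2.2
    rw [Complex.re_add_im] at h3
    have hball : Metric.ball z z.im ⊆ halfBox 0 (2 * r) (2 * r) := by
      intro w hw
      rw [Metric.mem_ball, dist_eq_norm] at hw
      have h4 := (Complex.abs_re_le_norm (w - z)).trans_lt hw
      have h5 := (Complex.abs_im_le_norm (w - z)).trans_lt hw
      rw [Complex.sub_re, abs_lt] at h4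
      rw [Complex.sub_im, abs_lt] at h5
      rw [abs_lt] at hzr
      have := hz.2.2
      refine ⟨?_, by linarith, by linarith⟩
      rw [sub_zero, abs_lt]
      exact ⟨by linarith, by linarith⟩
    have h4 := norm_deriv_mul_le_of_mapsTo_ball hy (hf.mono (hball.trans hbox'))
      (fun w hw => hb w (hbox' (hball hw)))
    have h5 := hb z (hbox' (hbox 0 (by simpa using hr) hz))
    have h6 : ‖deriv f z‖ * z.im ≤ 4 / r * z.im := by
      have : 2 * z.im / r * 2 = 4 / r * z.im := by ring
      nlinarith [norm_nonneg (f z)]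
    exact le_of_mul_le_mul_right h6 hy
  have hlip : LipschitzOnWith (Real.toNNReal (4 / r)) f (halfBox 0 r r) := by
    refine Convex.lipschitzOnWith_of_nnnorm_deriv_le (fun z hz => ?_) (fun z hz => ?_)
      (convex_halfBox 0 r r)
    · exact hf.differentiableAt ((isOpen_halfBox 0 δ δ).mem_nhds
        (halfBox_mono (by simp; linarith) (by linarith) hz))
    · rw [← NNReal.coe_le_coe, coe_nnnorm, Real.coe_toNNReal _ (by positivity)]
      exact hder z hz
  obtain ⟨g, hg, hgf⟩ := hlip.extend_finite_dimension
  refine ⟨g 0, ?_⟩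
  have h6 : Tendsto g (𝓝[halfBox 0 r r] 0) (𝓝 (g 0)) :=
    (hg.continuous.tendsto 0).mono_left nhdsWithin_le_nhds
  have h7 : Tendsto f (𝓝[halfBox 0 r r] 0) (𝓝 (g 0)) := h6.congr' (by
    filter_upwards [self_mem_nhdsWithin] with z hz using (hgf hz).symm)
  have h8 : 𝓝[halfBox 0 δ δ] (0 : ℂ) ≤ 𝓝[halfBox 0 r r] 0 := by
    refine le_inf nhdsWithin_le_nhds ?_
    rw [le_principal_iff]
    filter_upwards [self_mem_nhdsWithin, mem_nhdsWithin_of_mem_nhds (Metric.ball_mem_nhds 0 hr)]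
      with z hz hz'
    rw [mem_ball_zero_iff] at hz'
    exact ⟨by simpa using (Complex.abs_re_le_norm z).trans_lt hz', hz.2.1,
      (le_abs_self _).trans_lt ((Complex.abs_im_le_norm z).trans_lt hz')⟩
  exact h7.mono_left h8

/-- A bounded holomorphic function on a square that tends to `0` at one side vanishes at the
center. -/
lemma eq_zero_of_tendsto_zero_side {f : ℂ → ℂ} {s M : ℝ} (hs : 0 < s)
    (hf : DifferentiableOn ℂ f (halfBox 0 s (2 * s))) (hb : ∀ z ∈ halfBox 0 s (2 * s), ‖f z‖ ≤ M)
    (h0 : ∀ x : ℝ, |x| ≤ s → Tendsto f (𝓝[halfBox 0 s (2 * s)] (x : ℂ)) (𝓝 0)) :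
    f (s * Complex.I) = 0 := by
  set Q := halfBox 0 s (2 * s) with hQ
  have hM : 0 ≤ M := by
    refine (norm_nonneg _).trans (hb (s * Complex.I) ⟨?_, ?_, ?_⟩) <;> simp [hs]
  -- The quarter turn of the square about its center `s * I`.
  let R : ℂ → ℂ := fun z => s * Complex.I + Complex.I * (z - s * Complex.I)
  have hRre : ∀ z, (R z).re = s - z.im := fun z => by simp [R]
  have hRim : ∀ z, (R z).im = s + z.re := fun z => by simp [R]
  have hRQ : MapsTo R Q Q := by
    rintro z ⟨h1, h2, h3⟩
    rw [sub_zero, abs_lt] at h1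
    refine ⟨?_, ?_, ?_⟩
    · rw [hRre, abs_lt]; constructor <;> linarith
    · rw [hRim]; linarith
    · rw [hRim]; linarith
  have hRd : Differentiable ℂ R := by fun_prop
  have hRn : ∀ n : ℕ, MapsTo (R^[n]) Q Q := fun n => hRQ.iterate n
  have hRnd : ∀ n : ℕ, Differentiable ℂ (R^[n]) := fun n => hRd.iterate n
  have hfn : ∀ n : ℕ, DifferentiableOn ℂ (fun z => f (R^[n] z)) Q := fun n =>
    hf.comp (hRnd n).differentiableOn (hRn n)
  have hR4 : ∀ z, R (R (R (R z))) = z := by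
    intro z
    apply Complex.ext
    · simp only [hRre, hRim]; ring
    · simp only [hRre, hRim]; ring
  -- The product of the four rotated copies of `f` tends to `0` at every side, since one factor does
  -- and the others are bounded. It vanishes by the maximum principle, and at the center it equals
  -- `f ^ 4`.
  let g : ℂ → ℂ := fun z => ∏ n ∈ Finset.range 4, f (R^[n] z)
  have hg : DifferentiableOn ℂ g Q := by
    have := DifferentiableOn.finsetProd (u := Finset.range 4) (fun n _ => hfn n)
    refine this.congr fun z hz => by simp [g]
  have hgz : ‖g (s * Complex.I)‖ ≤ 0 := by
    refine norm_le_of_eventually_norm_le (isOpen_halfBox _ _ _) (isBounded_halfBox _ _ _) hg ?_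
      (z := s * Complex.I) (by refine ⟨?_, ?_, ?_⟩ <;> simp [hs])
    intro p hp η hη
    obtain ⟨hp1, hp2, hp3, hp4⟩ := mem_frontier_halfBox hp
    rw [sub_zero] at hp1 hp4
    have hside : ∃ n ∈ Finset.range 4, (R^[n] p).im = 0 ∧ |(R^[n] p).re| ≤ s := by
      rw [abs_le] at hp1
      rcases hp4 with h | h | h
      · exact ⟨0, by simp, by simpa using h, by simpa [abs_le] using hp1⟩
      · rcases (abs_eq hs.le).1 h with h | h
        · refine ⟨3, by simp, ?_, ?_⟩ <;>
            simp only [Function.iterate_succ, Function.comp, Function.iterate_zero, id, hRre, hRim]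
          · rw [h]; ring
          · rw [abs_le]; constructor <;> linarith
        · refine ⟨1, by simp, ?_, ?_⟩ <;>
            simp only [Function.iterate_succ, Function.comp, Function.iterate_zero, id, hRre, hRim]
          · rw [h]; ring
          · rw [abs_le]; constructor <;> linarith
      · refine ⟨2, by simp, ?_, ?_⟩ <;>
            simp only [Function.iterate_succ, Function.comp, Function.iterate_zero, id, hRre, hRim]
        · rw [h]; ring
        · rw [abs_le]; constructor <;> linarith
    obtain ⟨n, hn, him, hre⟩ := hside
    have hpn : R^[n] p = (((R^[n] p).re : ℝ) : ℂ) := Complex.ext (by simp) (by simp [him])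
    have ht : Tendsto (fun z => f (R^[n] z)) (𝓝[Q] p) (𝓝 0) := by
      refine (h0 _ hre).comp ?_
      rw [← hpn]
      exact tendsto_nhdsWithin_of_tendsto_nhds_of_eventually_within _
        (((hRnd n).continuous.tendsto p).mono_left nhdsWithin_le_nhds)
        (by filter_upwards [self_mem_nhdsWithin] with z hz using hRn n hz)
    have hη' : 0 < η / (M ^ 3 + 1) := by positivity
    have ht' := (tendsto_zero_iff_norm_tendsto_zero.1 ht).eventually_lt_const hη'
    filter_upwards [ht', self_mem_nhdsWithin] with z hz hzQ
    rw [zero_add]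
    simp only [g, norm_prod]
    rw [← Finset.mul_prod_erase _ _ hn]
    have h3 : ∏ k ∈ (Finset.range 4).erase n, ‖f (R^[k] z)‖ ≤ M ^ 3 := by
      have : ((Finset.range 4).erase n).card = 3 := by
        rw [Finset.card_erase_of_mem hn]; simp
      rw [← this, ← Finset.prod_const]
      exact Finset.prod_le_prod (fun k _ => norm_nonneg _) (fun k _ => hb _ (hRn k hzQ))
    calc ‖f (R^[n] z)‖ * ∏ k ∈ (Finset.range 4).erase n, ‖f (R^[k] z)‖
        ≤ η / (M ^ 3 + 1) * M ^ 3 := mul_le_mul hz.le h3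
          (Finset.prod_nonneg fun _ _ => norm_nonneg _) hη'.le
      _ ≤ η / (M ^ 3 + 1) * (M ^ 3 + 1) := by gcongr; linarith
      _ = η := by field_simp
  have hfix : ∀ n : ℕ, R^[n] (s * Complex.I) = s * Complex.I := fun n => by
    induction n with
    | zero => rfl
    | succ n ih => rw [Function.iterate_succ, Function.comp]; simp [R] at ih ⊢; exact ih
  have h5 : g (s * Complex.I) = 0 := norm_le_zero_iff.1 hgz
  simp only [g, hfix, Finset.prod_const, Finset.card_range] at h5
  exact pow_eq_zero_iff (by norm_num) |>.1 h5

/-! ### Boundary limits at flat boundary points -/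

/-- In the coordinate `ζ ↦ w + u ζ` the set `W` is the upper half-plane near `ζ = 0`. -/
structure IsFlatAt (W : Set ℂ) (w u : ℂ) (δ : ℝ) : Prop where
  norm_dir : ‖u‖ = 1
  pos : 0 < δ
  mem_iff : ∀ ζ : ℂ, |ζ.re| < δ → |ζ.im| < δ → (w + u * ζ ∈ W ↔ 0 < ζ.im)

instance neBot_nhdsWithin_halfBox {δ : ℝ} [hδ : Fact (0 < δ)] :
    (𝓝[halfBox 0 δ δ] (0 : ℂ)).NeBot := by
  have h : Tendsto (fun t : ℝ => (t : ℂ) * Complex.I) (𝓝[>] 0) (𝓝[halfBox 0 δ δ] 0) := by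
    refine tendsto_nhdsWithin_of_tendsto_nhds_of_eventually_within _ ?_ ?_
    · have : Continuous (fun t : ℝ => (t : ℂ) * Complex.I) := by fun_prop
      simpa using (this.tendsto 0).mono_left nhdsWithin_le_nhds
    · filter_upwards [Ioo_mem_nhdsGT hδ.out] with t ht
      refine ⟨?_, ?_, ?_⟩ <;> simp [ht.1, ht.2, hδ.out]
  exact h.neBot

namespace IsFlatAt

variable {W : Set ℂ} {w u : ℂ} {δ : ℝ}

lemma dir_ne_zero (hf : IsFlatAt W w u δ) : u ≠ 0 := by
  intro h; have := hf.norm_dir; rw [h, norm_zero] at this; exact zero_ne_one this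

lemma mem_of_halfBox (hf : IsFlatAt W w u δ) {ζ : ℂ} (hζ : ζ ∈ halfBox 0 δ δ) : w + u * ζ ∈ W :=
  (hf.mem_iff ζ (by simpa using hζ.1) (by rw [abs_of_pos hζ.2.1]; exact hζ.2.2)).2 hζ.2.1

lemma notMem (hf : IsFlatAt W w u δ) {x : ℝ} (hx : |x| < δ) : w + u * x ∉ W := fun h =>
  lt_irrefl (0 : ℝ) (by simpa using (hf.mem_iff x (by simpa using hx) (by simpa using hf.pos)).1 h)

lemma tendsto_coord (hf : IsFlatAt W w u δ) (x : ℝ) :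
    Tendsto (fun ζ => w + u * ζ) (𝓝[halfBox 0 δ δ] (x : ℂ)) (𝓝[W] (w + u * x)) := by
  refine tendsto_nhdsWithin_of_tendsto_nhds_of_eventually_within _ ?_ ?_
  · have : Continuous (fun ζ : ℂ => w + u * ζ) := by fun_prop
    exact (this.tendsto _).mono_left nhdsWithin_le_nhds
  · filter_upwards [self_mem_nhdsWithin] with ζ hζ using hf.mem_of_halfBox hζ

lemma neBot (hf : IsFlatAt W w u δ) : (𝓝[W] w).NeBot := by
  have : Fact (0 < δ) := ⟨hf.pos⟩
  have h := hf.tendsto_coord 0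
  simp only [Complex.ofReal_zero, mul_zero, add_zero] at h
  exact h.neBot

lemma mem_frontier (hf : IsFlatAt W w u δ) : w ∈ frontier W := by
  have h := hf.notMem (x := 0) (by simpa using hf.pos)
  rw [Complex.ofReal_zero, mul_zero, add_zero] at h
  exact ⟨mem_closure_iff_nhdsWithin_neBot.2 hf.neBot, fun h' => h (interior_subset h')⟩

lemma shift (hf : IsFlatAt W w u δ) {x : ℝ} (hx : |x| < δ) :
    IsFlatAt W (w + u * x) u (δ - |x|) := by
  refine ⟨hf.norm_dir, by linarith, fun ζ h1 h2 => ?_⟩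
  have h3 := hf.mem_iff (x + ζ) (by
    rw [Complex.add_re, Complex.ofReal_re]
    linarith [abs_add_le x ζ.re]) (by
    rw [Complex.add_im, Complex.ofReal_im, zero_add]; linarith [abs_nonneg x])
  rw [Complex.add_im, Complex.ofReal_im, zero_add] at h3
  rw [← h3]
  ring_nf

lemma tendsto_inv_coord (hf : IsFlatAt W w u δ) :
    Tendsto (fun z => u⁻¹ * (z - w)) (𝓝[W] w) (𝓝[halfBox 0 δ δ] 0) := by
  have hu := hf.dir_ne_zero
  have hc : Tendsto (fun z => u⁻¹ * (z - w)) (𝓝[W] w) (𝓝 0) := by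
    have : Continuous (fun z : ℂ => u⁻¹ * (z - w)) := by fun_prop
    simpa using (this.tendsto w).mono_left nhdsWithin_le_nhds
  refine tendsto_nhdsWithin_of_tendsto_nhds_of_eventually_within _ hc ?_
  filter_upwards [hc (Metric.ball_mem_nhds 0 hf.pos), self_mem_nhdsWithin] with z hz hzW
  rw [mem_preimage, mem_ball_zero_iff] at hz
  have h1 := (Complex.abs_re_le_norm _).trans_lt hz
  have h2 := (Complex.abs_im_le_norm _).trans_lt hz
  have h3 := (hf.mem_iff _ h1 h2).1 (by rwa [mul_inv_cancel_left₀ hu, add_sub_cancel])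
  exact ⟨by simpa using h1, h3, (le_abs_self _).trans_lt h2⟩

variable {φ ψ : ℂ → ℂ}

/-- The inverse conformal map has a unimodular limit at a flat boundary point. -/
lemma exists_tendsto (hf : IsFlatAt W w u δ) (hW : IsOpen W)
    (h : IsNormalizedConformalMap W φ ψ) : ∃ ζ, ‖ζ‖ = 1 ∧ Tendsto ψ (𝓝[W] w) (𝓝 ζ) := by
  have hu := hf.dir_ne_zero
  obtain ⟨ζ, hζ⟩ := exists_tendsto_of_tendsto_norm_one (f := fun ζ => ψ (w + u * ζ)) hf.pos
    ((h.differentiableOn_inv hW).comp (by fun_prop) fun ζ hζ => hf.mem_of_halfBox hζ)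
    (fun ζ hζ => mem_ball_zero_iff.1 (h.mapsTo_inv (hf.mem_of_halfBox hζ)))
    (fun x hx => (h.tendsto_norm_inv (hf.notMem hx)).comp (hf.tendsto_coord x))
  have h1 : Tendsto ψ (𝓝[W] w) (𝓝 ζ) := by
    refine (hζ.comp hf.tendsto_inv_coord).congr fun z => ?_
    simp only [Function.comp, mul_inv_cancel_left₀ hu, add_sub_cancel]
  have := hf.neBot
  refine ⟨ζ, tendsto_nhds_unique h1.norm (h.tendsto_norm_inv ?_), h1⟩
  have h := hf.notMem (x := 0) (by simpa using hf.pos)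
  rwa [Complex.ofReal_zero, mul_zero, add_zero] at h

/-- The inverse conformal map is not constant on a flat piece of the boundary. -/
lemma not_forall_tendsto (hf : IsFlatAt W w u δ) (hW : IsOpen W)
    (h : IsNormalizedConformalMap W φ ψ) (c : ℂ)
    (hc : ∀ x : ℝ, |x| < δ → Tendsto ψ (𝓝[W] (w + u * x)) (𝓝 c)) : False := by
  have hu := hf.dir_ne_zero
  -- Every small square resting on the flat piece gives the value `c` at its center; two squares of
  -- different size contradict injectivity of `ψ`.
  have key : ∀ s : ℝ, 0 < s → 2 * s < δ → ψ (w + u * (s * Complex.I)) = c := by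
    intro s hs hsδ
    have hsub : halfBox 0 s (2 * s) ⊆ halfBox 0 δ δ := halfBox_mono (by simp; linarith) hsδ.le
    refine sub_eq_zero.1 (eq_zero_of_tendsto_zero_side (f := fun ζ => ψ (w + u * ζ) - c)
      (M := 1 + ‖c‖) hs (((h.differentiableOn_inv hW).comp (by fun_prop)
        fun ζ hζ => hf.mem_of_halfBox (hsub hζ)).sub_const c) (fun ζ hζ => ?_) fun x hx => ?_)
    · have h1 := mem_ball_zero_iff.1 (h.mapsTo_inv (hf.mem_of_halfBox (hsub hζ)))
      exact (norm_sub_le _ _).trans (by linarith)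
    · have h1 := ((hc x (by linarith)).comp (hf.tendsto_coord x)).mono_left
        (nhdsWithin_mono _ hsub)
      simpa using h1.sub_const c
  have hδ := hf.pos
  have hmem : ∀ s : ℝ, 0 < s → s < δ → w + u * (s * Complex.I) ∈ W := fun s h1 h2 =>
    hf.mem_of_halfBox ⟨by simpa using hδ, by simpa using h1, by simpa using h2⟩
  have h1 := h.injOn_inv (hmem (δ / 3) (by linarith) (by linarith))
    (hmem (δ / 4) (by linarith) (by linarith))
    ((key _ (by linarith) (by linarith)).trans (key _ (by linarith) (by linarith)).symm)
  have h2 : ((δ / 3 : ℝ) : ℂ) = ((δ / 4 : ℝ) : ℂ) :=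
    mul_right_cancel₀ Complex.I_ne_zero (mul_left_cancel₀ hu (add_left_cancel h1))
  have h3 := Complex.ofReal_injective h2
  linarith

end IsFlatAt

/-! ### Arcs of the circle and separation by cuts -/

lemma isPreconnected_upperArc : IsPreconnected upperArc := by
  have : upperArc = (fun x : ℝ => (x : ℂ) + Real.sqrt (1 - x ^ 2) * Complex.I) '' Ioo (-1) 1 := by
    ext z
    simp only [upperArc, mem_ofPred_eq, mem_image]
    constructor
    · rintro ⟨h1, h2⟩
      have h3 : z.re ^ 2 + z.im ^ 2 = 1 := by
        have := Complex.normSq_eq_norm_sq z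
        rw [h1, Complex.normSq_apply] at this; nlinarith
      refine ⟨z.re, ⟨by nlinarith, by nlinarith⟩, ?_⟩
      have h4 : 1 - z.re ^ 2 = z.im ^ 2 := by linarith
      rw [h4, Real.sqrt_sq h2.le, Complex.re_add_im]
    · rintro ⟨x, ⟨h1, h2⟩, rfl⟩
      have h3 : 0 < 1 - x ^ 2 := by nlinarith
      refine ⟨?_, by simpa using Real.sqrt_pos.2 h3⟩
      rw [Complex.norm_add_mul_I, Real.sq_sqrt h3.le]
      simp
  rw [this]
  refine isPreconnected_Ioo.image _ (Continuous.continuousOn ?_)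
  fun_prop

/-- The open lower half of the unit circle. -/
def lowerArc : Set ℂ := {z | ‖z‖ = 1 ∧ z.im < 0}

lemma isPreconnected_lowerArc : IsPreconnected lowerArc := by
  have : lowerArc = (starRingEnd ℂ) '' upperArc := by
    ext z
    simp only [lowerArc, upperArc, mem_ofPred_eq, mem_image]
    constructor
    · rintro ⟨h1, h2⟩
      exact ⟨(starRingEnd ℂ) z, ⟨by simpa using h1, by simpa using h2⟩, by simp⟩
    · rintro ⟨w, ⟨h1, h2⟩, rfl⟩
      exact ⟨by simpa using h1, by simpa using h2⟩
  rw [this]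
  exact isPreconnected_upperArc.image _ Complex.continuous_conj.continuousOn

lemma isPreconnected_circle_diff_singleton {c : ℂ} (hc : ‖c‖ = 1) :
    IsPreconnected {z : ℂ | ‖z‖ = 1 ∧ z ≠ c} := by
  have hc0 : c ≠ 0 := by rintro rfl; simp at hc
  have : {z : ℂ | ‖z‖ = 1 ∧ z ≠ c} =
      (fun θ : ℝ => -c * Complex.exp (θ * Complex.I)) '' Ioo (-Real.pi) Real.pi := by
    ext z
    simp only [mem_ofPred_eq, mem_image]
    constructor
    · rintro ⟨h1, h2⟩
      have h3 : ‖z / (-c)‖ = 1 := by rw [norm_div, norm_neg, h1, hc, div_one]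
      have h4 : Complex.exp ((z / (-c)).arg * Complex.I) = z / (-c) := by
        have := Complex.norm_mul_exp_arg_mul_I (z / (-c))
        rwa [h3, Complex.ofReal_one, one_mul] at this
      refine ⟨(z / (-c)).arg, ⟨Complex.neg_pi_lt_arg _, lt_of_le_of_ne (Complex.arg_le_pi _) ?_⟩, ?_⟩
      · intro h5
        rw [h5, Complex.exp_pi_mul_I, eq_div_iff (neg_ne_zero.2 hc0)] at h4
        exact h2 (by linear_combination -h4)
      · rw [h4, mul_div_cancel₀ _ (neg_ne_zero.2 hc0)]
    · rintro ⟨θ, ⟨h1, h2⟩, rfl⟩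
      refine ⟨by rw [norm_mul, norm_neg, hc, Complex.norm_exp_ofReal_mul_I, one_mul], fun h3 => ?_⟩
      have h4 : Complex.exp (θ * Complex.I) = -1 :=
        mul_left_cancel₀ hc0 (by linear_combination -h3)
      have h5 := Complex.arg_exp_mul_I θ
      rw [h4, Complex.arg_neg_one, (toIocMod_eq_self _).2 ⟨h1, by linarith⟩] at h5
      exact h2.ne h5.symm
  rw [this]
  refine isPreconnected_Ioo.image _ (Continuous.continuousOn ?_)
  fun_prop

/-- A continuous `q` whose zero set in `W` is closed up by boundary points at which `ψ` has limits
in `Z` separates the boundary values of `ψ` on the two sides of the zero set: they do not lie in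
one connected subset of the circle that avoids `Z`. -/
lemma IsNormalizedConformalMap.false_of_cut {W : Set ℂ} {φ ψ : ℂ → ℂ}
    (h : IsNormalizedConformalMap W φ ψ) {q : ℂ → ℝ} (hq : Continuous q) {K Z A : Set ℂ}
    (hK : IsCompact K) (hqK : ∀ z ∈ W, q z = 0 → z ∈ K)
    (hKZ : ∀ z ∈ K, z ∉ W → ∃ ζ ∈ Z, Tendsto ψ (𝓝[W] z) (𝓝 ζ))
    (hA : IsPreconnected A) (hA1 : ∀ ζ ∈ A, ‖ζ‖ = 1) (hAZ : ∀ ζ ∈ A, ζ ∉ Z)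
    {F G : Filter ℂ} [F.NeBot] [G.NeBot] (hF : ∀ᶠ z in F, z ∈ W ∧ 0 < q z)
    (hG : ∀ᶠ z in G, z ∈ W ∧ q z < 0) {ζ ξ : ℂ} (hζ : ζ ∈ A) (hξ : ξ ∈ A)
    (hFψ : Tendsto ψ F (𝓝 ζ)) (hGψ : Tendsto ψ G (𝓝 ξ)) : False := by
  have hcont : ContinuousOn (fun y => q (φ y)) (Metric.ball 0 1) :=
    hq.comp_continuousOn h.holomorphic.continuousOn
  -- If zeros of `q ∘ φ` accumulated at `ζ`, their images would cluster at some `k ∈ K`. If `k ∈ W`,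
  -- then `ζ = ψ k` lies inside the disk; otherwise `ζ` is the limit of `ψ` at `k` and lies in `Z`.
  -- Passing to an ultrafilter makes the cluster point a limit.
  have hne : ∀ ζ ∈ A, ∀ᶠ y in 𝓝[Metric.ball 0 1] ζ, q (φ y) ≠ 0 := by
    intro ζ hζ
    by_contra hcon
    rw [not_eventually] at hcon
    simp only [not_not] at hcon
    have hfr : ∃ᶠ y in 𝓝[Metric.ball 0 1] ζ, φ y ∈ K :=
      (hcon.and_eventually self_mem_nhdsWithin).mono fun y hy => hqK _ (h.mapsTo hy.2) hy.1
    obtain ⟨k, hk, hcl⟩ := hK.exists_mapClusterPt_of_frequently hfr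
    obtain ⟨U, hU, hUk⟩ := mapClusterPt_iff_ultrafilter.1 hcl
    have hUW : Tendsto φ U (𝓝[W] k) :=
      tendsto_nhdsWithin_of_tendsto_nhds_of_eventually_within _ hUk (by
        filter_upwards [hU self_mem_nhdsWithin] with y hy using h.mapsTo hy)
    have hid : Tendsto (fun y => ψ (φ y)) U (𝓝 ζ) := by
      have : Tendsto id (U : Filter ℂ) (𝓝 ζ) := hU.trans nhdsWithin_le_nhds
      refine this.congr' ?_
      filter_upwards [hU self_mem_nhdsWithin] with y hy using (h.left_inv y hy).symm
    by_cases hkW : k ∈ W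
    · have h1 := tendsto_nhds_unique hid ((h.continuousAt_inv hkW).tendsto.comp hUk)
      have h2 := mem_ball_zero_iff.1 (h.mapsTo_inv hkW)
      rw [← h1, hA1 ζ hζ] at h2
      exact lt_irrefl _ h2
    · obtain ⟨ζ', hζ', ht⟩ := hKZ k hk hkW
      exact hAZ ζ hζ (tendsto_nhds_unique hid (ht.comp hUW) ▸ hζ')
  -- A small ball about a point of `A` meets the disk in a convex set, on which `q ∘ φ` has constant
  -- sign. So the open sets `S` and `T` cover `A`; both meet `A`, and connectedness gives a point
  -- where both signs hold.
  let S : Set ℂ := {ζ | ∀ᶠ y in 𝓝 ζ, y ∈ Metric.ball (0 : ℂ) 1 → 0 < q (φ y)}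
  let T : Set ℂ := {ζ | ∀ᶠ y in 𝓝 ζ, y ∈ Metric.ball (0 : ℂ) 1 → q (φ y) < 0}
  have hST : A ⊆ S ∪ T := by
    intro ζ hζ
    have h1 := hne ζ hζ
    rw [eventually_nhdsWithin_iff, Metric.eventually_nhds_iff_ball] at h1
    obtain ⟨r, hr, h1⟩ := h1
    have hpc : IsPreconnected ((fun y => q (φ y)) '' (Metric.ball ζ r ∩ Metric.ball 0 1)) :=
      ((convex_ball ζ r).inter (convex_ball 0 1)).isPreconnected.image _
        (hcont.mono inter_subset_right)
    have h2 := hpc.subset_or_subset (u := Ioi 0) (v := Iio 0) isOpen_Ioi isOpen_Iio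
      (Set.disjoint_left.2 fun x hx hx' => lt_asymm (mem_Ioi.1 hx) (mem_Iio.1 hx')) (by
        rintro _ ⟨y, ⟨hy, hy'⟩, rfl⟩
        rcases lt_or_gt_of_ne (h1 y hy hy') with h | h
        · exact Or.inr h
        · exact Or.inl h)
    refine h2.imp (fun h2 => ?_) fun h2 => ?_ <;>
    · filter_upwards [Metric.ball_mem_nhds ζ hr] with y hy hy'
      exact h2 ⟨y, ⟨hy, hy'⟩, rfl⟩
  have hζS : ζ ∈ S := by
    refine (hST hζ).resolve_right fun h1 => ?_
    obtain ⟨z, ⟨hz, hz'⟩, h2⟩ := (hF.and (hFψ.eventually h1)).exists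
    have := h2 (h.mapsTo_inv hz)
    rw [h.right_inv z hz] at this
    linarith
  have hξT : ξ ∈ T := by
    refine (hST hξ).resolve_left fun h1 => ?_
    obtain ⟨z, ⟨hz, hz'⟩, h2⟩ := (hG.and (hGψ.eventually h1)).exists
    have := h2 (h.mapsTo_inv hz)
    rw [h.right_inv z hz] at this
    linarith
  obtain ⟨η, hη, h1, h2⟩ := hA S T isOpen_setOfPred_eventually_nhds isOpen_setOfPred_eventually_nhds hST
    ⟨ζ, hζ, hζS⟩ ⟨ξ, hξ, hξT⟩
  have : (𝓝[Metric.ball (0 : ℂ) 1] η).NeBot := by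
    rw [← mem_closure_iff_nhdsWithin_neBot, closure_ball (0 : ℂ) one_ne_zero,
      mem_closedBall_zero_iff]
    exact (hA1 η hη).le
  obtain ⟨y, ⟨h3, h4⟩, h5⟩ := ((eventually_nhdsWithin_iff.2 h1).and
    (eventually_nhdsWithin_iff.2 h2)).and self_mem_nhdsWithin |>.exists
  linarith

/-- A cut whose end points all correspond to one point `c` of the circle cannot cut off a flat
piece of the boundary. -/
lemma IsFlatAt.false_of_cut {W : Set ℂ} {φ ψ : ℂ → ℂ} (h : IsNormalizedConformalMap W φ ψ)
    (hW : IsOpen W) {q : ℂ → ℝ} (hq : Continuous q) {K : Set ℂ} {c : ℂ} (hc : ‖c‖ = 1)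
    (hK : IsCompact K) (hqK : ∀ z ∈ W, q z = 0 → z ∈ K)
    (hKZ : ∀ z ∈ K, z ∉ W → Tendsto ψ (𝓝[W] z) (𝓝 c)) {w u : ℂ} {δ : ℝ}
    (hf : IsFlatAt W w u δ) (hF : ∀ x : ℝ, |x| < δ → ∀ᶠ z in 𝓝[W] (w + u * x), 0 < q z)
    {G : Filter ℂ} [G.NeBot] (hG : ∀ᶠ z in G, z ∈ W ∧ q z < 0) {ξ : ℂ} (hξ : ‖ξ‖ = 1)
    (hξc : ξ ≠ c) (hGψ : Tendsto ψ G (𝓝 ξ)) : False := by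
  refine hf.not_forall_tendsto hW h c fun x hx => ?_
  have hfx := hf.shift hx
  have := hfx.neBot
  obtain ⟨ζ, hζ, hζt⟩ := hfx.exists_tendsto hW h
  -- The circle without `c` is connected, so a limit other than `c` on the flat piece could not be
  -- separated from `ξ`. All limits there equal `c`, which `not_forall_tendsto` forbids.
  rcases eq_or_ne ζ c with rfl | hne
  · exact hζt
  · exact (h.false_of_cut hq hK hqK (Z := {c}) (fun z hz hz' => ⟨c, rfl, hKZ z hz hz'⟩)
      (isPreconnected_circle_diff_singleton hc) (fun ζ hζ => hζ.1) (fun ζ hζ => hζ.2)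
      (F := 𝓝[W] (w + u * x)) (by filter_upwards [hF x hx, self_mem_nhdsWithin] with z h1 h2
                                    using ⟨h2, h1⟩)
      hG ⟨hζ, hne⟩ ⟨hξ, hξc⟩ hζt hGψ).elim

/-! ### Geometry of the chimney domain -/

namespace ChimneySequences

variable {a b : ℕ → ℝ}

lemma b_lt_b (h : ChimneySequences a b) {m n : ℕ} (hmn : m < n) : b n < b m :=
  strictAnti_nat_of_succ_lt (fun n => (h.b_succ_lt_a n).trans (h.a_lt_b n)) hmn

lemma b_le_b (h : ChimneySequences a b) {m n : ℕ} (hmn : m ≤ n) : b n ≤ b m :=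
  (strictAnti_nat_of_succ_lt (fun n => (h.b_succ_lt_a n).trans (h.a_lt_b n))).antitone hmn

lemma b_lt_a (h : ChimneySequences a b) {m n : ℕ} (hmn : m < n) : b n < a m :=
  (h.b_le_b hmn).trans_lt (h.b_succ_lt_a m)

lemma a_le_a (h : ChimneySequences a b) {m n : ℕ} (hmn : m ≤ n) : a n ≤ a m := by
  rcases hmn.eq_or_lt with rfl | hmn
  · exact le_rfl
  · exact ((h.a_lt_b n).trans (h.b_lt_a hmn)).le

lemma b_le_one (h : ChimneySequences a b) (n : ℕ) : b n ≤ 1 := h.b_zero ▸ h.b_le_b n.zero_le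

lemma a_lt_one (h : ChimneySequences a b) (n : ℕ) : a n < 1 := (h.a_lt_b n).trans_le (h.b_le_one n)

lemma notMem_base (h : ChimneySequences a b) {k : ℕ} {x : ℝ} (h1 : b (k + 1) ≤ x) (h2 : x ≤ a k) :
    ¬ ∃ n, a n < x ∧ x < b n := by
  rintro ⟨n, h3, h4⟩
  rcases le_or_gt n k with hn | hn
  · linarith [h.a_le_a hn]
  · linarith [h.b_le_b (Nat.succ_le_of_lt hn)]

lemma notMem_base_of_one_le (h : ChimneySequences a b) {x : ℝ} (h1 : 1 ≤ x) :
    ¬ ∃ n, a n < x ∧ x < b n := by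
  rintro ⟨n, h3, h4⟩
  linarith [h.b_le_one n]

lemma notMem_base_of_nonpos (h : ChimneySequences a b) {x : ℝ} (h1 : x ≤ 0) :
    ¬ ∃ n, a n < x ∧ x < b n := by
  rintro ⟨n, h3, h4⟩
  linarith [h.a_pos n]

lemma notMem_base_a (h : ChimneySequences a b) (k : ℕ) : ¬ ∃ n, a n < a k ∧ a k < b n :=
  h.notMem_base (h.b_succ_lt_a k).le le_rfl

/-- Below the axis a vertical strip over a base lies in the quadrant anyway, so the half-strips may
be replaced by full strips. Openness of the domain is then immediate. -/
lemma mem_iff (h : ChimneySequences a b) {z : ℂ} :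
    z ∈ chimneyDomain a b ↔ (0 < z.re ∧ z.im < 0) ∨ ∃ n, a n < z.re ∧ z.re < b n := by
  simp only [chimneyDomain, chimney, mem_union, mem_iUnion, mem_ofPred_eq]
  constructor
  · rintro (h1 | ⟨n, h1, h2, -⟩)
    · exact Or.inl h1
    · exact Or.inr ⟨n, h1, h2⟩
  · rintro (h1 | ⟨n, h1, h2⟩)
    · exact Or.inl h1
    · rcases lt_or_ge z.im 0 with h3 | h3
      · exact Or.inl ⟨(h.a_pos n).trans h1, h3⟩
      · exact Or.inr ⟨n, h1, h2, h3⟩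

lemma isOpen_domain (h : ChimneySequences a b) : IsOpen (chimneyDomain a b) := by
  have : chimneyDomain a b = {z : ℂ | 0 < z.re ∧ z.im < 0} ∪ ⋃ n, {z : ℂ | a n < z.re ∧ z.re < b n} := by
    ext z; rw [h.mem_iff]; simp
  rw [this]
  refine IsOpen.union ?_ (isOpen_iUnion fun n => ?_)
  · exact (isOpen_lt continuous_const Complex.continuous_re).and
      (isOpen_lt Complex.continuous_im continuous_const)
  · exact (isOpen_lt continuous_const Complex.continuous_re).and
      (isOpen_lt Complex.continuous_re continuous_const)

lemma re_pos (h : ChimneySequences a b) {z : ℂ} (hz : z ∈ chimneyDomain a b) : 0 < z.re := by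
  rcases h.mem_iff.1 hz with h1 | ⟨n, h1, -⟩
  · exact h1.1
  · exact (h.a_pos n).trans h1

lemma re_lt_one (h : ChimneySequences a b) {z : ℂ} (hz : z ∈ chimneyDomain a b) (hi : 0 ≤ z.im) :
    z.re < 1 := by
  rcases h.mem_iff.1 hz with h1 | ⟨n, h1, h2⟩
  · linarith [h1.2]
  · exact h2.trans_le (h.b_le_one n)

lemma re_nonneg_of_mem_closure (h : ChimneySequences a b) {z : ℂ}
    (hz : z ∈ closure (chimneyDomain a b)) : 0 ≤ z.re :=
  closure_minimal (fun _ hw => (h.re_pos hw).le)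
    (isClosed_le continuous_const Complex.continuous_re) hz

/-- The domain lies below the segment, so the direction is `-1`; consequently positive shifts along
the flat piece move to the left. -/
lemma isFlatAt_segment (h : ChimneySequences a b) {k : ℕ} {x : ℝ} (h1 : b (k + 1) < x)
    (h2 : x < a k) :
    IsFlatAt (chimneyDomain a b) x (-1) (min (x - b (k + 1)) (a k - x)) := by
  refine ⟨by simp, lt_min (by linarith) (by linarith), fun ζ h3 h4 => ?_⟩
  rw [lt_min_iff, abs_lt, abs_lt] at h3
  have hre : ((x : ℂ) + -1 * ζ).re = x - ζ.re := by simp; ring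
  have him : ((x : ℂ) + -1 * ζ).im = -ζ.im := by simp
  rw [h.mem_iff, hre, him, or_iff_left (h.notMem_base (k := k) (by linarith) (by linarith))]
  have := h.b_pos (k + 1)
  constructor
  · rintro ⟨-, h5⟩; linarith
  · intro h5; exact ⟨by linarith, by linarith⟩

/-- The chimney lies to the right of its left wall, so the direction is `-I`, and positive shifts
move down. The radius keeps the coordinate square above the axis, left of `b k` and right of `b (k +
1)`. -/
lemma isFlatAt_wall (h : ChimneySequences a b) {k : ℕ} {t : ℝ} (ht : 0 < t) :
    IsFlatAt (chimneyDomain a b) (a k + t * Complex.I) (-Complex.I)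
      (min t (min (b k - a k) (a k - b (k + 1)))) := by
  have h1 := h.a_lt_b k
  have h2 := h.b_succ_lt_a k
  refine ⟨by simp, lt_min ht (lt_min (by linarith) (by linarith)), fun ζ h3 h4 => ?_⟩
  rw [lt_min_iff, lt_min_iff, abs_lt, abs_lt, abs_lt] at h3 h4
  have hre : ((a k : ℂ) + t * Complex.I + -Complex.I * ζ).re = a k + ζ.im := by simp
  have him : ((a k : ℂ) + t * Complex.I + -Complex.I * ζ).im = t - ζ.re := by simp; ring
  rw [h.mem_iff, hre, him]
  constructor
  · rintro (h5 | h5)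
    · linarith [h5.2]
    · by_contra! h6
      exact h.notMem_base (k := k) (by linarith) (by linarith) h5
  · intro h5; exact Or.inr ⟨k, by linarith, by linarith⟩

lemma neBot_nhdsWithin (h : ChimneySequences a b) {w : ℂ} (h1 : 0 ≤ w.re) (h2 : w.im ≤ 0) :
    (𝓝[chimneyDomain a b] w).NeBot := by
  have ht : Tendsto (fun t : ℝ => w + t * (1 - Complex.I)) (𝓝[>] 0) (𝓝[chimneyDomain a b] w) := by
    refine tendsto_nhdsWithin_of_tendsto_nhds_of_eventually_within _ ?_ ?_
    · have : Continuous (fun t : ℝ => w + t * (1 - Complex.I)) := by fun_prop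
      simpa using (this.tendsto 0).mono_left nhdsWithin_le_nhds
    · filter_upwards [self_mem_nhdsWithin] with t ht
      rw [mem_Ioi] at ht
      exact h.mem_iff.2 (Or.inl ⟨by simp; linarith, by simp; linarith⟩)
  exact ht.neBot

lemma neBot_infinity (h : ChimneySequences a b) :
    (comap Complex.im atBot ⊓ 𝓟 (chimneyDomain a b)).NeBot := by
  have ht : Tendsto (fun t : ℝ => 1 - t * Complex.I) atTop
      (comap Complex.im atBot ⊓ 𝓟 (chimneyDomain a b)) := by
    refine tendsto_inf.2 ⟨tendsto_comap_iff.2 ?_, tendsto_principal.2 ?_⟩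
    · have : Complex.im ∘ (fun t : ℝ => 1 - t * Complex.I) = fun t => -t := by ext t; simp
      rw [this]; exact tendsto_neg_atTop_atBot
    · filter_upwards [eventually_gt_atTop 0] with t ht
      exact h.mem_iff.2 (Or.inl ⟨by simp, by simpa using ht⟩)
  exact ht.neBot

end ChimneySequences

/-! ### Boundary values on the segments and the position of `φ(I₀)` -/

/-- The parabolic arc from `p` to `w` below the real axis. -/
def parabolicArc (p w : ℝ) : Set ℂ :=
  {z | p ≤ z.re ∧ z.re ≤ w ∧ z.im = -((z.re - p) * (w - z.re))}

lemma isCompact_parabolicArc (p w : ℝ) : IsCompact (parabolicArc p w) := by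
  have : parabolicArc p w =
      (fun x : ℝ => (x : ℂ) + (-((x - p) * (w - x)) : ℝ) * Complex.I) '' Icc p w := by
    ext z
    constructor
    · rintro ⟨h1, h2, h3⟩
      refine ⟨z.re, ⟨h1, h2⟩, ?_⟩
      simp only [← h3, Complex.re_add_im]
    · rintro ⟨x, ⟨h1, h2⟩, rfl⟩
      refine ⟨?_, ?_, ?_⟩ <;> simp [h1, h2]
  rw [this]
  exact isCompact_Icc.image (by fun_prop)

/-- Positive above the arc from `p` to `w`, with vertical half-lines at the end points. -/
def arcSide (p w : ℝ) (z : ℂ) : ℝ := min z.im 0 + (z.re - p) * (w - z.re)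

lemma continuous_arcSide (p w : ℝ) : Continuous (arcSide p w) := by
  unfold arcSide; fun_prop

namespace ChimneySequences

variable {a b : ℕ → ℝ} {φ ψ : ℂ → ℂ}

/-- Above the axis `arcSide` vanishes only on the vertical lines through `p` and `w`, and these miss
the domain because neither point lies in the open base of a chimney. -/
lemma mem_parabolicArc (h : ChimneySequences a b) {p w : ℝ} (hpw : p < w)
    (hp : ¬ ∃ n, a n < p ∧ p < b n) (hw : ¬ ∃ n, a n < w ∧ w < b n) {z : ℂ}
    (hz : z ∈ chimneyDomain a b) (hq : arcSide p w z = 0) : z ∈ parabolicArc p w := by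
  unfold arcSide at hq
  rcases lt_or_ge z.im 0 with h1 | h1
  · rw [min_eq_left h1.le] at hq
    exact ⟨by nlinarith, by nlinarith, by linarith⟩
  · exfalso
    rw [min_eq_right h1, zero_add, mul_eq_zero] at hq
    rcases h.mem_iff.1 hz with h2 | h2
    · linarith [h2.2]
    · rcases hq with hq | hq
      · exact hp (sub_eq_zero.1 hq ▸ h2)
      · exact hw (sub_eq_zero.1 hq ▸ h2)

lemma eq_of_mem_parabolicArc (h : ChimneySequences a b) {p w : ℝ} (hp : 0 ≤ p) {z : ℂ}
    (hz : z ∈ parabolicArc p w) (hzW : z ∉ chimneyDomain a b) : z = p ∨ z = w := by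
  obtain ⟨h1, h2, h3⟩ := hz
  rcases h1.eq_or_lt with h1 | h1
  · left; apply Complex.ext <;> simp [h3, ← h1]
  rcases h2.eq_or_lt with h2 | h2
  · right; apply Complex.ext <;> simp [h3, h2]
  · exact (hzW (h.mem_iff.2 (Or.inl ⟨by linarith, by nlinarith⟩))).elim

/-- A limit of `ψ` above the arc from `0` to `1` that differs from `±1` lies on the upper arc. -/
lemma mem_upperArc_of_arcSide_pos (h : ChimneySequences a b)
    (hφ : IsNormalizedConformalMap (chimneyDomain a b) φ ψ) {w ζ : ℂ}
    [(𝓝[chimneyDomain a b] w).NeBot] (hw : 0 < arcSide 0 1 w) (hζ : ‖ζ‖ = 1)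
    (ht : Tendsto ψ (𝓝[chimneyDomain a b] w) (𝓝 ζ)) (h1 : ζ ≠ 1) (h2 : ζ ≠ -1) :
    ζ ∈ upperArc := by
  refine ⟨hζ, ?_⟩
  by_contra! h3
  rcases h3.eq_or_lt with h3 | h3
  · have h4 := Complex.normSq_eq_norm_sq ζ
    rw [hζ, Complex.normSq_apply, h3] at h4
    have h5 : (ζ.re - 1) * (ζ.re + 1) = 0 := by linarith
    rcases mul_eq_zero.1 h5 with h5 | h5
    · exact h1 (Complex.ext (by simp; linarith) (by simp [h3]))
    · exact h2 (Complex.ext (by simp; linarith) (by simp [h3]))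
  -- A limit on the lower arc would share this arc with `-I`, the value at infinity. But the
  -- parabola from `0` to `1` separates `w` from infinity, and its ends correspond to `-1` and `1`.
  -- Since `x (1 - x) ≤ 1/4`, all points with `im < -1` lie below the parabola.
  · have := h.neBot_infinity
    refine hφ.false_of_cut (continuous_arcSide 0 1) (Z := {1, -1}) (isCompact_parabolicArc 0 1)
      (fun z hz hq => h.mem_parabolicArc one_pos (h.notMem_base_of_nonpos le_rfl)
        (h.notMem_base_of_one_le le_rfl) hz hq) (fun z hz hz' => ?_) isPreconnected_lowerArc
      (fun ζ hζ => hζ.1) ?_ (F := 𝓝[chimneyDomain a b] w)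
      (G := comap Complex.im atBot ⊓ 𝓟 (chimneyDomain a b)) ?_ ?_
      (ζ := ζ) (ξ := -Complex.I) ⟨hζ, h3⟩ ⟨by simp, by simp⟩ ht hφ.at_infinity
    · rcases h.eq_of_mem_parabolicArc le_rfl hz hz' with rfl | rfl
      · exact ⟨-1, by simp, by simpa using hφ.at_zero⟩
      · exact ⟨1, by simp, by simpa using hφ.at_one⟩
    · rintro ζ ⟨-, h5⟩ (rfl | rfl) <;> simp at h5
    · filter_upwards [self_mem_nhdsWithin, nhdsWithin_le_nhds
        ((continuous_arcSide 0 1).continuousAt.eventually_const_lt hw)] with z h5 h6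
        using ⟨h5, h6⟩
    · have h6 : ∀ᶠ z in comap Complex.im atBot, z.im < -1 :=
        tendsto_comap.eventually (eventually_lt_atBot (-1))
      filter_upwards [mem_inf_of_left h6, mem_inf_of_right (mem_principal_self _)] with z h7 h8
      refine ⟨h8, ?_⟩
      unfold arcSide
      rw [min_eq_left (by linarith)]
      nlinarith [sq_nonneg (z.re - 1 / 2)]

/-- The limit lies on the closed upper arc, and the values `±1` are excluded by cuts whose two ends
would correspond to one point: from `x` to `1` for the value `1`, from `0` to `x` for the value
`-1`. Each would cut off a flat piece of the segment next to `x`. -/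
lemma exists_limit_segment (h : ChimneySequences a b)
    (hφ : IsNormalizedConformalMap (chimneyDomain a b) φ ψ) {k : ℕ} {x : ℝ} (h1 : b (k + 1) < x)
    (h2 : x < a k) : ∃ ζ ∈ upperArc, Tendsto ψ (𝓝[chimneyDomain a b] (x : ℂ)) (𝓝 ζ) := by
  have hf := h.isFlatAt_segment h1 h2
  have hnb := hf.neBot
  have hW := h.isOpen_domain
  have hx0 : 0 < x := (h.b_pos _).trans h1
  have hx1 : x < 1 := h2.trans (h.a_lt_one k)
  have hxb := h.notMem_base h1.le h2.le
  obtain ⟨ζ, hζ, ht⟩ := hf.exists_tendsto hW hφ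
  set δ := min (x - b (k + 1)) (a k - x) with hδ
  have hδ0 : 0 < δ := hf.pos
  have hδ1 : δ ≤ x - b (k + 1) := min_le_left _ _
  have hδ2 : δ ≤ a k - x := min_le_right _ _
  have hb := h.b_pos (k + 1)
  have ha := h.a_lt_one k
  have hnb0 : (𝓝[chimneyDomain a b] (0 : ℂ)).NeBot := h.neBot_nhdsWithin (by simp) (by simp)
  have hnb1 : (𝓝[chimneyDomain a b] (1 : ℂ)).NeBot := h.neBot_nhdsWithin (by simp) (by simp)
  refine ⟨ζ, h.mem_upperArc_of_arcSide_pos hφ (w := x) ?_ hζ ht ?_ ?_, ht⟩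
  · simp only [arcSide, Complex.ofReal_im, Complex.ofReal_re, min_self]
    nlinarith
  · rintro rfl
    refine IsFlatAt.false_of_cut hφ hW (continuous_arcSide x 1) (c := 1) (by simp)
      (isCompact_parabolicArc x 1) (fun z hz hq => h.mem_parabolicArc hx1 hxb
        (h.notMem_base_of_one_le le_rfl) hz hq) (fun z hz hz' => ?_)
      -- With direction `-1` this is the piece to the right of `x`, above the arc from `x` to `1`;
      -- the origin is on the other side.
      (hf.shift (x := -(δ / 2)) (by rw [abs_neg, abs_of_pos] <;> linarith)) (fun y hy => ?_)
      (G := 𝓝[chimneyDomain a b] 0) ?_ (ξ := -1) (by simp) (by norm_num) hφ.at_zero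
    · rcases h.eq_of_mem_parabolicArc hx0.le hz hz' with rfl | rfl
      · exact ht
      · simpa using hφ.at_one
    · rw [abs_neg, abs_of_pos (show 0 < δ / 2 by linarith), abs_lt] at hy
      refine nhdsWithin_le_nhds ((continuous_arcSide x 1).continuousAt.eventually_const_lt ?_)
      simp [arcSide]
      nlinarith
    · filter_upwards [self_mem_nhdsWithin, nhdsWithin_le_nhds
        ((continuous_arcSide x 1).continuousAt.eventually_lt_const (u := 0)
          (by simp [arcSide]; linarith))] with z h5 h6 using ⟨h5, h6⟩
  · rintro rfl
    refine IsFlatAt.false_of_cut hφ hW (continuous_arcSide 0 x) (c := -1) (by simp)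
      (isCompact_parabolicArc 0 x) (fun z hz hq => h.mem_parabolicArc hx0
        (h.notMem_base_of_nonpos le_rfl) hxb hz hq) (fun z hz hz' => ?_)
      (hf.shift (x := δ / 2) (by rw [abs_of_pos] <;> linarith)) (fun y hy => ?_)
      (G := 𝓝[chimneyDomain a b] 1) ?_ (ξ := 1) (by simp) (by norm_num) hφ.at_one
    · rcases h.eq_of_mem_parabolicArc le_rfl hz hz' with rfl | rfl
      · simpa using hφ.at_zero
      · exact ht
    · rw [abs_of_pos (show 0 < δ / 2 by linarith), abs_lt] at hy
      refine nhdsWithin_le_nhds ((continuous_arcSide 0 x).continuousAt.eventually_const_lt ?_)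
      simp [arcSide]
      nlinarith
    · filter_upwards [self_mem_nhdsWithin, nhdsWithin_le_nhds
        ((continuous_arcSide 0 x).continuousAt.eventually_lt_const (u := 0)
          (by simp [arcSide]; linarith))] with z h5 h6 using ⟨h5, h6⟩

/-- The position of a boundary point that corresponds to a point of the upper arc. -/
lemma position_of_mem_boundaryImage (h : ChimneySequences a b)
    (hφ : IsNormalizedConformalMap (chimneyDomain a b) φ ψ) {w : ℂ}
    (hw : w ∈ boundaryImage (chimneyDomain a b) ψ upperArc) :
    w ∉ chimneyDomain a b ∧ 0 ≤ w.re ∧ 0 ≤ w.im ∧ (w.im = 0 → 0 < w.re ∧ w.re < 1) := by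
  obtain ⟨hwf, ζ, hζ, ht⟩ := hw
  have hwW : w ∉ chimneyDomain a b := by
    have := hwf.2; rwa [h.isOpen_domain.interior_eq] at this
  have hre := h.re_nonneg_of_mem_closure hwf.1
  have hnb : (𝓝[chimneyDomain a b] w).NeBot := mem_closure_iff_nhdsWithin_neBot.1 hwf.1
  -- A boundary point below the parabola from `0` to `1` cannot have its limit on the upper arc: a
  -- segment point above the parabola already has its limit there, and the cut separates the two.
  have hneg : ¬ arcSide 0 1 w < 0 := by
    intro hneg
    obtain ⟨x, hx1, hx2⟩ := exists_between (h.b_succ_lt_a 0)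
    obtain ⟨ξ, hξ, hξt⟩ := h.exists_limit_segment hφ hx1 hx2
    have hx0 : 0 < x := (h.b_pos _).trans hx1
    have hx3 : x < 1 := hx2.trans (h.a_lt_one 0)
    have hnbx : (𝓝[chimneyDomain a b] (x : ℂ)).NeBot :=
      h.neBot_nhdsWithin (by simpa using hx0.le) (by simp)
    refine hφ.false_of_cut (continuous_arcSide 0 1) (Z := {1, -1}) (isCompact_parabolicArc 0 1)
      (fun z hz hq => h.mem_parabolicArc one_pos (h.notMem_base_of_nonpos le_rfl)
        (h.notMem_base_of_one_le le_rfl) hz hq) (fun z hz hz' => ?_) isPreconnected_upperArc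
      (fun ζ hζ => hζ.1) ?_ (F := 𝓝[chimneyDomain a b] (x : ℂ))
      (G := 𝓝[chimneyDomain a b] w) ?_ ?_ hξ hζ hξt ht
    · rcases h.eq_of_mem_parabolicArc le_rfl hz hz' with rfl | rfl
      · exact ⟨-1, by simp, by simpa using hφ.at_zero⟩
      · exact ⟨1, by simp, by simpa using hφ.at_one⟩
    · rintro ζ ⟨-, h5⟩ (rfl | rfl) <;> simp at h5
    · filter_upwards [self_mem_nhdsWithin, nhdsWithin_le_nhds
        ((continuous_arcSide 0 1).continuousAt.eventually_const_lt (u := 0)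
          (by simp [arcSide]; nlinarith))] with z h5 h6 using ⟨h5, h6⟩
    · filter_upwards [self_mem_nhdsWithin, nhdsWithin_le_nhds
        ((continuous_arcSide 0 1).continuousAt.eventually_lt_const hneg)] with z h5 h6
        using ⟨h5, h6⟩
  have him : 0 ≤ w.im := by
    by_contra! hi
    rcases hre.eq_or_lt with h0 | h0
    · exact hneg (by simp only [arcSide, ← h0, min_eq_left hi.le]; linarith)
    · exact hwW (h.mem_iff.2 (Or.inl ⟨h0, hi⟩))
  refine ⟨hwW, hre, him, fun h0 => ⟨lt_of_le_of_ne hre fun h1 => ?_, ?_⟩⟩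
  · have hw0 : w = 0 := Complex.ext h1.symm h0
    subst hw0
    have h2 := hζ.2
    rw [tendsto_nhds_unique ht hφ.at_zero] at h2
    simp at h2
  · by_contra! h1
    rcases h1.eq_or_lt with h1 | h1
    · have hw1 : w = 1 := Complex.ext h1.symm h0
      subst hw1
      have h2 := hζ.2
      rw [tendsto_nhds_unique ht hφ.at_one] at h2
      simp at h2
    · exact hneg (by simp only [arcSide, h0, min_self]; nlinarith)

end ChimneySequences

/-! ### Boundary values on the left walls -/

/-- Positive above the line through `p + t i` and the real point `m`. -/
def lineSide (p m t : ℝ) (z : ℂ) : ℝ := (z.im - t) * (m - p) + t * (z.re - p)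

lemma continuous_lineSide (p m t : ℝ) : Continuous (lineSide p m t) := by
  unfold lineSide; fun_prop

/-- A common container for the two cuts that start on a wall: a line above the axis, and below it a
boundary of a region above a parabola. The bound `-1 ≤ im` is harmless, as the parabolas in use have
width at most `1` and hence depth at most `1/4`. -/
lemma isCompact_bounded_zeroSet {q l : ℂ → ℝ} (hq : Continuous q) (hl : Continuous l)
    (p w t : ℝ) : IsCompact {z : ℂ | (p ≤ z.re ∧ z.re ≤ w) ∧ (-1 ≤ z.im ∧ z.im ≤ t) ∧
      q z = 0 ∧ (z.im ≤ 0 ∨ l z = 0)} := by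
  refine Metric.isCompact_of_isClosed_isBounded ?_ ?_
  · refine ((isClosed_le continuous_const Complex.continuous_re).and
      (isClosed_le Complex.continuous_re continuous_const)).and
      (((isClosed_le continuous_const Complex.continuous_im).and
      (isClosed_le Complex.continuous_im continuous_const)).and ((isClosed_eq hq continuous_const).and ?_))
    have : {z : ℂ | z.im ≤ 0 ∨ l z = 0} = {z : ℂ | z.im ≤ 0} ∪ {z | l z = 0} := by ext; simp
    rw [this]
    exact (isClosed_le Complex.continuous_im continuous_const).union
      (isClosed_eq hl continuous_const)
  · refine (Metric.isBounded_closedBall (x := (0 : ℂ)) (r := |p| + |w| + (1 + |t|))).subset ?_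
    rintro z ⟨⟨h1, h2⟩, ⟨h3, h4⟩, -⟩
    rw [mem_closedBall_zero_iff]
    refine (Complex.norm_le_abs_re_add_abs_im z).trans (add_le_add ?_ ?_) <;> rw [abs_le] <;>
      constructor
    · linarith [neg_abs_le p, abs_nonneg w]
    · linarith [le_abs_self w, abs_nonneg p]
    · linarith [abs_nonneg t]
    · linarith [le_abs_self t]

namespace ChimneySequences

variable {a b : ℕ → ℝ} {φ ψ : ℂ → ℂ}

/-- The cut descends from the wall point along a line that crosses the base of the chimney at `m`,
and then follows the parabola from `a k` to `1`. If both ends corresponded to `1`, it would cut off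
from `0` the piece of wall just above the point. -/
lemma limit_wall_ne_one (h : ChimneySequences a b)
    (hφ : IsNormalizedConformalMap (chimneyDomain a b) φ ψ) {k : ℕ} {t : ℝ} (ht0 : 0 < t)
    (ht : Tendsto ψ (𝓝[chimneyDomain a b] (a k + t * Complex.I)) (𝓝 1)) : False := by
  have hf := h.isFlatAt_wall (k := k) ht0
  have hW := h.isOpen_domain
  set δ := min t (min (b k - a k) (a k - b (k + 1))) with hδ
  have hδ0 : 0 < δ := hf.pos
  have hδ1 : δ ≤ t := min_le_left _ _
  have hδ2 : δ ≤ b k - a k := (min_le_right _ _).trans (min_le_left _ _)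
  have ha0 := h.a_pos k
  have ha := h.a_lt_one k
  have hnb0 : (𝓝[chimneyDomain a b] (0 : ℂ)).NeBot := h.neBot_nhdsWithin (by simp) (by simp)
  obtain ⟨m, hm1, hm2⟩ := exists_between (h.a_lt_b k)
  have hm3 : m < 1 := hm2.trans_le (h.b_le_one k)
  have hma : 0 < m - a k := by linarith
  have hne : ∀ z ∈ chimneyDomain a b, 0 ≤ z.im → z.re ≠ a k := fun z hz hi h0 => by
    rcases h.mem_iff.1 hz with h5 | h5
    · linarith [h5.2]
    · exact h.notMem_base_a k (h0 ▸ h5)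
  have hqc : Continuous (fun z => min (lineSide (a k) m t z) (arcSide (a k) 1 z)) :=
    (continuous_lineSide _ _ _).min (continuous_arcSide _ _)
  refine IsFlatAt.false_of_cut hφ hW hqc (c := 1) (by simp)
    (isCompact_bounded_zeroSet hqc (continuous_lineSide (a k) m t) (a k) 1 t)
    (fun z hz hq => ?_) (fun z hz hz' => ?_)
    (hf.shift (x := -(δ / 2)) (by rw [abs_neg, abs_of_pos] <;> linarith)) (fun y hy => ?_)
    (G := 𝓝[chimneyDomain a b] 0) ?_ (ξ := -1) (by simp) (by norm_num) hφ.at_zero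
  · have h2 : 0 ≤ arcSide (a k) 1 z := hq.symm.trans_le (min_le_right _ _)
    have h1 : 0 ≤ lineSide (a k) m t z := hq.symm.trans_le (min_le_left _ _)
    have h3 : arcSide (a k) 1 z ≤ (z.re - a k) * (1 - z.re) := by
      unfold arcSide; linarith [min_le_right z.im 0]
    have h4 : a k ≤ z.re := by nlinarith
    have h5 : z.re ≤ 1 := by nlinarith
    have h6 : 0 < z.im → lineSide (a k) m t z = 0 := fun h6 => by
      have h7 : 0 < arcSide (a k) 1 z := by
        unfold arcSide
        rw [min_eq_right h6.le, zero_add]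
        exact mul_pos (sub_pos.2 (lt_of_le_of_ne h4 (hne z hz h6.le).symm))
          (sub_pos.2 (h.re_lt_one hz h6.le))
      rcases min_choice (lineSide (a k) m t z) (arcSide (a k) 1 z) with h8 | h8
      · rw [← h8, hq]
      · rw [← h8, hq] at h7; exact (lt_irrefl _ h7).elim
    refine ⟨⟨h4, h5⟩, ⟨?_, ?_⟩, hq, ?_⟩
    · unfold arcSide at h2
      rcases le_total z.im 0 with h7 | h7
      · rw [min_eq_left h7] at h2
        nlinarith
      · linarith
    · rcases le_or_gt z.im 0 with h7 | h7
      · linarith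
      · have := h6 h7
        unfold lineSide at this
        nlinarith
    · rcases le_or_gt z.im 0 with h7 | h7
      · exact Or.inl h7
      · exact Or.inr (h6 h7)
  · obtain ⟨⟨h1, h2⟩, ⟨h3, h4⟩, h5, h6⟩ := hz
    have h7 : 0 ≤ arcSide (a k) 1 z := h5.symm.trans_le (min_le_right _ _)
    have h8 : 0 ≤ lineSide (a k) m t z := h5.symm.trans_le (min_le_left _ _)
    have hi : 0 ≤ z.im := by
      by_contra! hi
      exact hz' (h.mem_iff.2 (Or.inl ⟨by linarith, hi⟩))
    rcases h1.eq_or_lt with h1 | h1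
    · have : z = a k + t * Complex.I := by
        apply Complex.ext
        · simp [← h1]
        · unfold lineSide at h8
          rw [← h1] at h8
          have : z.im = t := by nlinarith
          simp [this]
      rw [this]; exact ht
    rcases h2.eq_or_lt with h2 | h2
    · have h9 : 0 < lineSide (a k) m t z := by
        unfold lineSide; rw [h2]; nlinarith
      have h10 : z.im ≤ 0 := h6.resolve_right h9.ne'
      have : z = 1 := Complex.ext (by simpa using h2) (by simpa using le_antisymm h10 hi)
      rw [this]; exact hφ.at_one
    · exfalso
      have h9 : 0 < arcSide (a k) 1 z := by
        unfold arcSide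
        rw [min_eq_right hi, zero_add]
        exact mul_pos (sub_pos.2 h1) (sub_pos.2 h2)
      have h10 : lineSide (a k) m t z = 0 := by
        rcases min_choice (lineSide (a k) m t z) (arcSide (a k) 1 z) with h8 | h8
        · rw [← h8, h5]
        · rw [← h8, h5] at h9; exact (lt_irrefl _ h9).elim
      unfold lineSide at h10
      exact hz' (h.mem_iff.2 (Or.inr ⟨k, h1, by nlinarith⟩))
  · rw [abs_neg, abs_of_pos (show 0 < δ / 2 by linarith), abs_lt] at hy
    set v : ℂ := a k + t * Complex.I + -Complex.I * ((-(δ / 2) : ℝ) : ℂ) + -Complex.I * (y : ℂ)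
      with hv
    have hvr : v.re = a k := by simp [hv]
    have hvi : v.im = t + δ / 2 - y := by simp [hv]; ring
    have e1 : ∀ᶠ z in 𝓝 v, 0 < lineSide (a k) m t z :=
      (continuous_lineSide (a k) m t).continuousAt.eventually_const_lt (by
        unfold lineSide; rw [hvr, hvi]; nlinarith)
    have e2 : ∀ᶠ z in 𝓝 v, 0 < z.im := Complex.continuous_im.continuousAt.eventually_const_lt (by
      rw [hvi]; linarith)
    have e3 : ∀ᶠ z in 𝓝 v, b (k + 1) < z.re :=
      Complex.continuous_re.continuousAt.eventually_const_lt (by rw [hvr]; exact h.b_succ_lt_a k)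
    filter_upwards [nhdsWithin_le_nhds e1, nhdsWithin_le_nhds e2, nhdsWithin_le_nhds e3,
      self_mem_nhdsWithin] with z h1 h2 h3 h4
    refine lt_min h1 ?_
    -- On the wall itself `arcSide` is `0`; positivity holds because points of the domain near the
    -- wall lie strictly to its right.
    have h5 : a k < z.re := by
      rcases h.mem_iff.1 h4 with h5 | h5
      · linarith [h5.2]
      · by_contra! h6
        exact h.notMem_base h3.le h6 h5
    unfold arcSide
    rw [min_eq_right h2.le, zero_add]
    exact mul_pos (sub_pos.2 h5) (sub_pos.2 (h.re_lt_one h4 h2.le))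
  · filter_upwards [self_mem_nhdsWithin, nhdsWithin_le_nhds
      (hqc.continuousAt.eventually_lt_const (u := 0) (by
        refine min_lt_of_left_lt ?_
        simp [lineSide]
        nlinarith))] with z h5 h6 using ⟨h5, h6⟩

/-- The mirror argument: the cut descends along the line to the real point `m` and returns along the
parabola to `0`. If both ends corresponded to `-1`, it would cut off from `1` the piece of wall just
below the point. -/
lemma limit_wall_ne_neg_one (h : ChimneySequences a b)
    (hφ : IsNormalizedConformalMap (chimneyDomain a b) φ ψ) {k : ℕ} {t : ℝ} (ht0 : 0 < t)
    (ht : Tendsto ψ (𝓝[chimneyDomain a b] (a k + t * Complex.I)) (𝓝 (-1))) : False := by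
  have hf := h.isFlatAt_wall (k := k) ht0
  have hW := h.isOpen_domain
  set δ := min t (min (b k - a k) (a k - b (k + 1))) with hδ
  have hδ0 : 0 < δ := hf.pos
  have hδ1 : δ ≤ t := min_le_left _ _
  have hδ2 : δ ≤ b k - a k := (min_le_right _ _).trans (min_le_left _ _)
  have ha0 := h.a_pos k
  have ha := h.a_lt_one k
  have hnb1 : (𝓝[chimneyDomain a b] (1 : ℂ)).NeBot := h.neBot_nhdsWithin (by simp) (by simp)
  obtain ⟨m, hm1, hm2⟩ := exists_between (h.a_lt_b k)
  have hm3 : m < 1 := hm2.trans_le (h.b_le_one k)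
  have hma : 0 < m - a k := by linarith
  have hne : ∀ z ∈ chimneyDomain a b, 0 ≤ z.im → z.re ≠ a k := fun z hz hi h0 => by
    rcases h.mem_iff.1 hz with h5 | h5
    · linarith [h5.2]
    · exact h.notMem_base_a k (h0 ▸ h5)
  -- The second term puts everything to the left of the wall on the positive side, so that the
  -- continuation of the line does not cut the chimneys further left.
  set Q : ℂ → ℝ := fun z => max (-lineSide (a k) m t z) (a k - z.re) with hQ
  have hQc : Continuous Q := (continuous_lineSide _ _ _).neg.max (by fun_prop)
  have hqc : Continuous (fun z => min (Q z) (arcSide 0 m z)) := hQc.min (continuous_arcSide _ _)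
  refine IsFlatAt.false_of_cut hφ hW hqc (c := -1) (by simp)
    (isCompact_bounded_zeroSet hqc (continuous_lineSide (a k) m t) 0 m t)
    (fun z hz hq => ?_) (fun z hz hz' => ?_)
    (hf.shift (x := δ / 2) (by rw [abs_of_pos] <;> linarith)) (fun y hy => ?_)
    (G := 𝓝[chimneyDomain a b] 1) ?_ (ξ := 1) (by simp) (by norm_num) hφ.at_one
  · have h2 : 0 ≤ arcSide 0 m z := hq.symm.trans_le (min_le_right _ _)
    have h1 : 0 ≤ Q z := hq.symm.trans_le (min_le_left _ _)
    have h3 : arcSide 0 m z ≤ (z.re - 0) * (m - z.re) := by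
      unfold arcSide; linarith [min_le_right z.im 0]
    have h4 := h.re_pos hz
    have h5 : z.re ≤ m := by nlinarith
    have h6 : 0 < z.im → a k < z.re ∧ lineSide (a k) m t z = 0 := fun h6 => by
      rcases h5.eq_or_lt with h5 | h5
      · exfalso
        have h7 : 0 < lineSide (a k) m t z := by
          unfold lineSide; rw [h5]; nlinarith
        have : Q z < 0 := max_lt (by linarith) (by linarith)
        linarith
      have h7 : 0 < arcSide 0 m z := by
        unfold arcSide
        rw [min_eq_right h6.le, zero_add, sub_zero]
        exact mul_pos h4 (sub_pos.2 h5)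
      have h9 : Q z = 0 := by
        rcases min_choice (Q z) (arcSide 0 m z) with h8 | h8
        · rw [← h8, hq]
        · rw [← h8, hq] at h7; exact (lt_irrefl _ h7).elim
      have h10 : a k - z.re ≤ 0 := h9 ▸ le_max_right _ _
      have h11 : a k < z.re := lt_of_le_of_ne (by linarith) (hne z hz h6.le).symm
      refine ⟨h11, ?_⟩
      rcases max_choice (-lineSide (a k) m t z) (a k - z.re) with h8 | h8
      · rw [← neg_eq_zero, ← h8]; exact h9
      · exfalso
        have : a k - z.re = 0 := by rw [← h8]; exact h9
        linarith
    refine ⟨⟨h4.le, h5⟩, ⟨?_, ?_⟩, hq, ?_⟩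
    · unfold arcSide at h2
      rcases le_total z.im 0 with h7 | h7
      · rw [min_eq_left h7] at h2
        nlinarith
      · linarith
    · rcases le_or_gt z.im 0 with h7 | h7
      · linarith
      · obtain ⟨h8, h9⟩ := h6 h7
        unfold lineSide at h9
        nlinarith
    · rcases le_or_gt z.im 0 with h7 | h7
      · exact Or.inl h7
      · exact Or.inr (h6 h7).2
  · obtain ⟨⟨h1, h2⟩, ⟨h3, h4⟩, h5, h6⟩ := hz
    have h7 : 0 ≤ arcSide 0 m z := h5.symm.trans_le (min_le_right _ _)
    have h8 : 0 ≤ Q z := h5.symm.trans_le (min_le_left _ _)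
    rcases h1.eq_or_lt with h1 | h1
    · have hi : 0 ≤ z.im := by
        by_contra! hi
        simp only [arcSide, ← h1, min_eq_left hi.le] at h7
        linarith
      have hi' : z.im ≤ 0 := by
        refine h6.resolve_right fun h9 => ?_
        unfold lineSide at h9
        rw [← h1] at h9
        nlinarith
      have : z = 0 := Complex.ext h1.symm (le_antisymm hi' hi)
      rw [this]; exact hφ.at_zero
    have hi : 0 ≤ z.im := by
      by_contra! hi
      exact hz' (h.mem_iff.2 (Or.inl ⟨h1, hi⟩))
    have h9 : z.re ≤ a k := by
      by_contra! h9
      exact hz' (h.mem_iff.2 (Or.inr ⟨k, h9, by linarith⟩))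
    have h10 : 0 < arcSide 0 m z := by
      unfold arcSide
      rw [min_eq_right hi, zero_add, sub_zero]
      exact mul_pos h1 (by linarith)
    have h11 : Q z = 0 := by
      rcases min_choice (Q z) (arcSide 0 m z) with h8 | h8
      · rw [← h8, h5]
      · rw [← h8, h5] at h10; exact (lt_irrefl _ h10).elim
    have h12 : z.re = a k := le_antisymm h9 (by
      have : a k - z.re ≤ 0 := h11 ▸ le_max_right _ _
      linarith)
    have h13 : -lineSide (a k) m t z ≤ 0 := h11 ▸ le_max_left _ _
    have : z = a k + t * Complex.I := by
      apply Complex.ext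
      · simp [h12]
      · unfold lineSide at h13
        rw [h12] at h13
        have : z.im = t := by nlinarith
        simp [this]
    rw [this]; exact ht
  · rw [abs_of_pos (show 0 < δ / 2 by linarith), abs_lt] at hy
    set v : ℂ := a k + t * Complex.I + -Complex.I * ((δ / 2 : ℝ) : ℂ) + -Complex.I * (y : ℂ)
      with hv
    have hvr : v.re = a k := by simp [hv]
    have hvi : v.im = t - δ / 2 - y := by simp [hv]; ring
    refine nhdsWithin_le_nhds (hqc.continuousAt.eventually_const_lt (lt_min ?_ ?_))
    · refine lt_max_of_lt_left ?_
      unfold lineSide; rw [hvr, hvi]; nlinarith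
    · unfold arcSide
      rw [hvr, min_eq_right (by rw [hvi]; linarith), zero_add, sub_zero]
      exact mul_pos ha0 hma
  · filter_upwards [self_mem_nhdsWithin, nhdsWithin_le_nhds
      (hqc.continuousAt.eventually_lt_const (u := 0) (by
        refine min_lt_of_right_lt ?_
        simp [arcSide]
        linarith))] with z h5 h6 using ⟨h5, h6⟩

lemma segment_mem_boundaryImage (h : ChimneySequences a b)
    (hφ : IsNormalizedConformalMap (chimneyDomain a b) φ ψ) {k : ℕ} {x : ℝ} (h1 : b (k + 1) < x)
    (h2 : x < a k) : (x : ℂ) ∈ boundaryImage (chimneyDomain a b) ψ upperArc :=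
  ⟨(h.isFlatAt_segment h1 h2).mem_frontier, h.exists_limit_segment hφ h1 h2⟩

lemma wall_mem_boundaryImage (h : ChimneySequences a b)
    (hφ : IsNormalizedConformalMap (chimneyDomain a b) φ ψ) (k : ℕ) {t : ℝ} (ht0 : 0 < t) :
    (a k + t * Complex.I : ℂ) ∈ boundaryImage (chimneyDomain a b) ψ upperArc := by
  have hf := h.isFlatAt_wall (k := k) ht0
  have := hf.neBot
  obtain ⟨ζ, hζ, ht⟩ := hf.exists_tendsto h.isOpen_domain hφ
  refine ⟨hf.mem_frontier, ζ, h.mem_upperArc_of_arcSide_pos hφ ?_ hζ ht ?_ ?_, ht⟩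
  · have h1 := h.a_pos k
    have h2 := h.a_lt_one k
    simp [arcSide, ht0.le]
    nlinarith
  · rintro rfl; exact h.limit_wall_ne_one hφ ht0 ht
  · rintro rfl; exact h.limit_wall_ne_neg_one hφ ht0 ht

end ChimneySequences

/-! ### Arc length and lower bounds for the `ρ`-length -/

namespace IsRectifiableCurve

variable {γ : ℝ → ℂ}

lemma locallyBounded (hγ : IsRectifiableCurve γ) : LocallyBoundedVariationOn γ (Icc 0 1) :=
  BoundedVariationOn.locallyBoundedVariationOn hγ.2

/-- The arc length function. -/
lemma monotoneOn_arcLength (hγ : IsRectifiableCurve γ) :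
    MonotoneOn (variationOnFromTo γ (Icc 0 1) 0) (Icc 0 1) :=
  variationOnFromTo.monotoneOn hγ.locallyBounded ⟨le_rfl, zero_le_one⟩

lemma arcLength_zero : variationOnFromTo γ (Icc 0 1) 0 0 = 0 := variationOnFromTo.self _ _ _

lemma arcLength_one :
    variationOnFromTo γ (Icc 0 1) 0 1 = (eVariationOn γ (Icc 0 1)).toReal := by
  rw [variationOnFromTo.eq_of_le _ _ zero_le_one, inter_self]

/-- The jumps of the variation function are the jumps of `γ`, which vanish. Continuity lets the
intermediate value theorem reach every arc length parameter. -/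
lemma continuousOn_arcLength (hγ : IsRectifiableCurve γ) :
    ContinuousOn (variationOnFromTo γ (Icc 0 1) 0) (Icc 0 1) := by
  intro x hx
  have h0 : (0 : ℝ) ∈ Icc (0 : ℝ) 1 := ⟨le_rfl, zero_le_one⟩
  have hl := variationOnFromTo.tendsto_left h0 hx hγ.locallyBounded
    ((hγ.1 x hx).mono inter_subset_left)
  have hr := variationOnFromTo.tendsto_right h0 hx hγ.locallyBounded
    ((hγ.1 x hx).mono inter_subset_left)
  rw [dist_self, sub_zero] at hl
  rw [dist_self, add_zero] at hr
  have hx' : Tendsto (variationOnFromTo γ (Icc 0 1) 0) (𝓝[{x}] x)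
      (𝓝 (variationOnFromTo γ (Icc 0 1) 0 x)) := by
    rw [nhdsWithin_singleton]; exact tendsto_pure_nhds _ _
  have h := (hl.sup hr).sup hx'
  rw [← nhdsWithin_union, ← nhdsWithin_union] at h
  refine h.mono_left (nhdsWithin_mono _ fun y hy => ?_)
  rcases lt_trichotomy y x with h1 | h1 | h1
  · exact Or.inl (Or.inl ⟨hy, h1⟩)
  · exact Or.inr h1
  · exact Or.inl (Or.inr ⟨hy, h1⟩)

lemma exists_arcLength_eq (hγ : IsRectifiableCurve γ) {t₁ t₂ s : ℝ} (h0 : 0 ≤ t₁) (h12 : t₁ ≤ t₂)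
    (h1 : t₂ ≤ 1) (hs : s ∈ Icc (variationOnFromTo γ (Icc 0 1) 0 t₁)
      (variationOnFromTo γ (Icc 0 1) 0 t₂)) :
    ∃ t ∈ Icc t₁ t₂, variationOnFromTo γ (Icc 0 1) 0 t = s :=
  intermediate_value_Icc h12 (hγ.continuousOn_arcLength.mono (Icc_subset_Icc h0 h1)) hs

lemma naturalParameterization_arcLength (hγ : IsRectifiableCurve γ) {t : ℝ} (ht : t ∈ Icc (0 : ℝ) 1) :
    naturalParameterization γ (Icc 0 1) 0 (variationOnFromTo γ (Icc 0 1) 0 t) = γ t :=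
  edist_eq_zero.1 (edist_naturalParameterization_eq_zero hγ.locallyBounded
    ⟨le_rfl, zero_le_one⟩ ht)

lemma dist_le_arcLength_sub (hγ : IsRectifiableCurve γ) {s t : ℝ} (hs : s ∈ Icc (0 : ℝ) 1)
    (ht : t ∈ Icc (0 : ℝ) 1) (hst : s ≤ t) : dist (γ s) (γ t) ≤
      variationOnFromTo γ (Icc 0 1) 0 t - variationOnFromTo γ (Icc 0 1) 0 s := by
  rw [variationOnFromTo.sub_right hγ.locallyBounded ⟨le_rfl, zero_le_one⟩ ht hs,
    variationOnFromTo.eq_of_le _ _ hst, dist_edist]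
  exact ENNReal.toReal_mono (hγ.locallyBounded _ _ hs ht)
    (eVariationOn.edist_le γ ⟨hs, le_rfl, hst⟩ ⟨ht, hst, le_rfl⟩)

lemma lipschitzOnWith_naturalParameterization (hγ : IsRectifiableCurve γ) :
    LipschitzOnWith 1 (naturalParameterization γ (Icc 0 1) 0)
      (Icc 0 (eVariationOn γ (Icc 0 1)).toReal) := by
  have hI : Icc 0 (eVariationOn γ (Icc 0 1)).toReal = Icc (variationOnFromTo γ (Icc 0 1) 0 0)
      (variationOnFromTo γ (Icc 0 1) 0 1) := by rw [arcLength_one, arcLength_zero]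
  rw [hI]
  refine LipschitzOnWith.of_dist_le_mul fun s hs s' hs' => ?_
  obtain ⟨t, ht, rfl⟩ := hγ.exists_arcLength_eq le_rfl zero_le_one le_rfl hs
  obtain ⟨t', ht', rfl⟩ := hγ.exists_arcLength_eq le_rfl zero_le_one le_rfl hs'
  rw [hγ.naturalParameterization_arcLength ht, hγ.naturalParameterization_arcLength ht',
    NNReal.coe_one, one_mul, Real.dist_eq]
  rcases le_total t t' with h | h
  · rw [abs_sub_comm]
    exact (hγ.dist_le_arcLength_sub ht ht' h).trans (le_abs_self _)
  · rw [dist_comm]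
    exact (hγ.dist_le_arcLength_sub ht' ht h).trans (le_abs_self _)

end IsRectifiableCurve

/-- A Lipschitz `G` need not be differentiable, so the comparison uses only right slopes of `log ∘
G`, which are at most `1/|G|` in the limit. The auxiliary slope `e` makes the comparison strict and
contributes at most the arbitrary `η`. -/
lemma norm_log_sub_log_le_integral {G : ℝ → ℂ} (hG : LipschitzWith 1 G) {s₁ s₂ : ℝ}
    (h12 : s₁ ≤ s₂) (hs : ∀ s, G s ∈ Complex.slitPlane) :
    ‖Complex.log (G s₂) - Complex.log (G s₁)‖ ≤ ∫ s in s₁..s₂, 1 / ‖G s‖ := by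
  have hne : ∀ s, ‖G s‖ ≠ 0 := fun s => norm_ne_zero_iff.2 (Complex.slitPlane_ne_zero (hs s))
  have hw : Continuous fun s => 1 / ‖G s‖ := continuous_const.div hG.continuous.norm hne
  have hlog : Continuous fun s => Complex.log (G s) := hG.continuous.clog hs
  refine le_of_forall_pos_le_add fun η hη => ?_
  have hη' : 0 < η / (s₂ - s₁ + 1) := by
    have : 0 < s₂ - s₁ + 1 := by linarith
    positivity
  set e := η / (s₂ - s₁ + 1) with he
  have hB : ∀ x, HasDerivAt (fun s => (∫ y in s₁..s, 1 / ‖G y‖) + e * (s - s₁))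
      (1 / ‖G x‖ + e) x := fun x => by
    have h1 := intervalIntegral.integral_hasDerivAt_right (hw.intervalIntegrable s₁ x)
      (hw.stronglyMeasurableAtFilter _ _) hw.continuousAt
    have h2 := ((hasDerivAt_id x).sub_const s₁).const_mul e
    rw [mul_one] at h2
    exact h1.add h2
  have key := image_norm_le_of_liminf_right_slope_norm_lt_deriv_boundary
    (f := fun s => Complex.log (G s) - Complex.log (G s₁)) (f' := fun s => 1 / ‖G s‖)
    (a := s₁) (b := s₂) (hlog.sub continuous_const).continuousOn ?_
    (B := fun s => (∫ y in s₁..s, 1 / ‖G y‖) + e * (s - s₁)) (B' := fun x => 1 / ‖G x‖ + e)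
    (by simp) (fun x _ => (hB x).continuousAt.continuousWithinAt)
    (fun x _ => (hB x).hasDerivWithinAt) (fun x _ _ => by simpa using hη')
    (right_mem_Icc.2 h12)
  · refine key.trans (add_le_add le_rfl ?_)
    have : 0 < s₂ - s₁ + 1 := by linarith
    calc e * (s₂ - s₁) ≤ e * (s₂ - s₁ + 1) := by gcongr; linarith
      _ = η := by rw [he]; field_simp
  · intro x hx r hr
    have hd := Complex.hasDerivAt_log (hs x)
    obtain ⟨c, hc, hcr⟩ : ∃ c > 0, 1 / ‖G x‖ + c < r :=
      ⟨(r - 1 / ‖G x‖) / 2, by linarith, by linarith⟩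
    have h1 := (hasDerivAt_iff_isLittleO.1 hd).def hc
    have h2 : ∀ᶠ z in 𝓝[>] x, ‖Complex.log (G z) - Complex.log (G x) - (G z - G x) • (G x)⁻¹‖ ≤
        c * ‖G z - G x‖ :=
      ((hG.continuous.tendsto x).mono_left nhdsWithin_le_nhds).eventually h1
    refine Eventually.frequently ?_
    filter_upwards [h2, self_mem_nhdsWithin] with z hz hxz
    rw [mem_Ioi] at hxz
    have hpos : 0 < z - x := sub_pos.2 hxz
    rw [slope_def_field, div_lt_iff₀ hpos]
    have h3 : ‖G z - G x‖ ≤ z - x := by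
      have := hG.dist_le_mul z x
      rwa [dist_eq_norm, Real.dist_eq, NNReal.coe_one, one_mul, abs_of_pos hpos] at this
    have h4 : ‖Complex.log (G z) - Complex.log (G x)‖ ≤ (1 / ‖G x‖ + c) * ‖G z - G x‖ := by
      calc _ = ‖(Complex.log (G z) - Complex.log (G x) - (G z - G x) • (G x)⁻¹) +
              (G z - G x) • (G x)⁻¹‖ := by rw [sub_add_cancel]
        _ ≤ c * ‖G z - G x‖ + ‖(G z - G x) • (G x)⁻¹‖ := (norm_add_le _ _).trans (by gcongr)
        _ = _ := by rw [norm_smul, norm_inv]; ring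
    have h5 : 0 ≤ 1 / ‖G x‖ := by positivity
    calc (norm ∘ fun s => Complex.log (G s) - Complex.log (G s₁)) z -
          (norm ∘ fun s => Complex.log (G s) - Complex.log (G s₁)) x
        ≤ ‖Complex.log (G z) - Complex.log (G x)‖ := by
          refine (norm_sub_norm_le _ _).trans (le_of_eq ?_)
          congr 1; ring
      _ ≤ (1 / ‖G x‖ + c) * ‖G z - G x‖ := h4
      _ ≤ (1 / ‖G x‖ + c) * (z - x) := by gcongr
      _ < r * (z - x) := by gcongr

/-- A lower bound for the `ρ`-length of a curve by the variation of a logarithm along a subarc. -/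
lemma IsRectifiableCurve.le_rhoLength {γ : ℝ → ℂ} (hγ : IsRectifiableCurve γ) {ρ : ℂ → ENNReal}
    {t₁ t₂ κ : ℝ} (h0 : 0 ≤ t₁) (h12 : t₁ ≤ t₂) (h1 : t₂ ≤ 1) (hκ : 0 ≤ κ) {p : ℂ}
    (hp : ∀ t ∈ Icc t₁ t₂, γ t - p ∈ Complex.slitPlane)
    (hρ : ∀ t ∈ Icc t₁ t₂, ENNReal.ofReal (κ / ‖γ t - p‖) ≤ ρ (γ t)) :
    ENNReal.ofReal (κ * ‖Complex.log (γ t₂ - p) - Complex.log (γ t₁ - p)‖) ≤ rhoLength ρ γ := by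
  set v := variationOnFromTo γ (Icc 0 1) 0 with hv
  set g := naturalParameterization γ (Icc 0 1) 0 with hg
  have hm1 : t₁ ∈ Icc (0 : ℝ) 1 := ⟨h0, h12.trans h1⟩
  have hm2 : t₂ ∈ Icc (0 : ℝ) 1 := ⟨h0.trans h12, h1⟩
  have hv12 : v t₁ ≤ v t₂ := hγ.monotoneOn_arcLength hm1 hm2 h12
  have hv0 : 0 ≤ v t₁ := variationOnFromTo.nonneg_of_le _ _ h0
  have hv1 : v t₂ ≤ (eVariationOn γ (Icc 0 1)).toReal := by
    rw [← IsRectifiableCurve.arcLength_one]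
    exact hγ.monotoneOn_arcLength hm2 ⟨zero_le_one, le_rfl⟩ h1
  have hsub : Icc (v t₁) (v t₂) ⊆ Icc 0 (eVariationOn γ (Icc 0 1)).toReal := Icc_subset_Icc hv0 hv1
  have hgv : ∀ s ∈ Icc (v t₁) (v t₂), ∃ t ∈ Icc t₁ t₂, g s = γ t := by
    intro s hs
    obtain ⟨t, ht, rfl⟩ := hγ.exists_arcLength_eq h0 h12 h1 hs
    exact ⟨t, ht, hγ.naturalParameterization_arcLength ⟨h0.trans ht.1, ht.2.trans h1⟩⟩
  -- Clamping the parameter to the interval makes the curve `1`-Lipschitz on the whole line with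
  -- values still in the slit plane.
  let G : ℝ → ℂ := fun s => g (projIcc (v t₁) (v t₂) hv12 s) - p
  have hGlip : LipschitzWith 1 G := by
    have h3 : LipschitzWith 1 ((Icc (v t₁) (v t₂)).domRestrict g) :=
      (hγ.lipschitzOnWith_naturalParameterization.mono hsub).to_restrict
    have h4 := h3.comp (LipschitzWith.projIcc hv12)
    rw [one_mul] at h4
    have h5 := h4.sub (LipschitzWith.const p)
    rw [add_zero] at h5
    exact h5
  have hGs : ∀ s, G s ∈ Complex.slitPlane := fun s => by
    obtain ⟨t, ht, h5⟩ := hgv _ (projIcc (v t₁) (v t₂) hv12 s).2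
    simp only [G, h5]
    exact hp t ht
  have hGeq : ∀ s ∈ Icc (v t₁) (v t₂), G s = g s - p := fun s hs => by
    simp only [G, projIcc_of_mem hv12 hs]
  have hmain := norm_log_sub_log_le_integral hGlip hv12 hGs
  rw [hGeq _ (right_mem_Icc.2 hv12), hGeq _ (left_mem_Icc.2 hv12), hg, hv,
    hγ.naturalParameterization_arcLength hm1, hγ.naturalParameterization_arcLength hm2,
    ← hv] at hmain
  have hw : Continuous fun s => κ * (1 / ‖G s‖) := continuous_const.mul
    (continuous_const.div hGlip.continuous.norm
      fun s => norm_ne_zero_iff.2 (Complex.slitPlane_ne_zero (hGs s)))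
  calc _ ≤ ENNReal.ofReal (κ * ∫ s in v t₁..v t₂, 1 / ‖G s‖) := by gcongr
    _ = ENNReal.ofReal (∫ s in Icc (v t₁) (v t₂), κ * (1 / ‖G s‖)) := by
        rw [← intervalIntegral.integral_const_mul, intervalIntegral.integral_of_le hv12,
          integral_Icc_eq_integral_Ioc]
    _ = ∫⁻ s in Icc (v t₁) (v t₂), ENNReal.ofReal (κ * (1 / ‖G s‖)) := by
        refine ofReal_integral_eq_lintegral_ofReal hw.integrableOn_Icc ?_
        exact Eventually.of_forall fun s => by positivity
    _ ≤ ∫⁻ s in Icc (v t₁) (v t₂), ρ (g s) := by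
        refine setLIntegral_mono' measurableSet_Icc fun s hs => ?_
        obtain ⟨t, ht, h5⟩ := hgv s hs
        rw [hGeq s hs, h5, mul_one_div]
        exact hρ t ht
    _ ≤ rhoLength ρ γ := lintegral_mono_set hsub

/-! ### Circular arcs and the length-area estimate -/

/-- The circular arc about `0` of radius `r` from the angle `θ₁` down to the angle `θ₂`. -/
noncomputable def circArc (r θ₁ θ₂ : ℝ) (t : ℝ) : ℂ := r * Complex.exp (((θ₁ - (θ₁ - θ₂) * t : ℝ) : ℂ) * Complex.I)

lemma norm_circArc {r : ℝ} (hr : 0 ≤ r) (θ₁ θ₂ t : ℝ) : ‖circArc r θ₁ θ₂ t‖ = r := by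
  rw [circArc, norm_mul, Complex.norm_exp_ofReal_mul_I, mul_one, Complex.norm_real,
    Real.norm_of_nonneg hr]

lemma continuous_circArc (r θ₁ θ₂ : ℝ) : Continuous (circArc r θ₁ θ₂) := by
  unfold circArc; fun_prop

lemma lipschitzWith_circArc {r θ₁ θ₂ : ℝ} (hr : 0 ≤ r) (hθ : θ₂ ≤ θ₁) :
    LipschitzWith (Real.toNNReal (r * (θ₁ - θ₂))) (circArc r θ₁ θ₂) := by
  have hL : 0 ≤ r * (θ₁ - θ₂) := mul_nonneg hr (sub_nonneg.2 hθ)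
  have hd : ∀ t, HasDerivAt (circArc r θ₁ θ₂) (r * (Complex.exp (((θ₁ - (θ₁ - θ₂) * t : ℝ) : ℂ) *
      Complex.I) * (((-(θ₁ - θ₂) : ℝ) : ℂ) * Complex.I))) t := by
    intro t
    have h1 : HasDerivAt (fun t : ℝ => θ₁ - (θ₁ - θ₂) * t) (-(θ₁ - θ₂)) t := by
      simpa using ((hasDerivAt_id t).const_mul (θ₁ - θ₂)).const_sub θ₁
    exact ((h1.ofReal_comp.mul_const Complex.I).cexp).const_mul (r : ℂ)
  refine lipschitzWith_of_nnnorm_deriv_le (fun t => (hd t).differentiableAt) fun t => ?_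
  rw [← NNReal.coe_le_coe, coe_nnnorm, Real.coe_toNNReal _ hL, (hd t).deriv, norm_mul, norm_mul,
    Complex.norm_exp_ofReal_mul_I, norm_mul, Complex.norm_I, Complex.norm_real, Complex.norm_real,
    Real.norm_of_nonneg hr, norm_neg, Real.norm_of_nonneg (sub_nonneg.2 hθ), one_mul, mul_one]

lemma isRectifiableCurve_circArc {r θ₁ θ₂ : ℝ} (hr : 0 ≤ r) (hθ : θ₂ ≤ θ₁) :
    IsRectifiableCurve (circArc r θ₁ θ₂) := by
  refine ⟨(continuous_circArc _ _ _).continuousOn, ?_⟩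
  have h := (lipschitzWith_circArc hr hθ).locallyBoundedVariationOn (Icc 0 1) 0 1
    ⟨le_rfl, zero_le_one⟩ ⟨zero_le_one, le_rfl⟩
  rwa [BoundedVariationOn, inter_self] at h

lemma arcLength_circArc_sub_le {r θ₁ θ₂ s t : ℝ} (hr : 0 ≤ r) (hθ : θ₂ ≤ θ₁)
    (hs : s ∈ Icc (0 : ℝ) 1) (ht : t ∈ Icc (0 : ℝ) 1) (hst : s ≤ t) :
    variationOnFromTo (circArc r θ₁ θ₂) (Icc 0 1) 0 t -
      variationOnFromTo (circArc r θ₁ θ₂) (Icc 0 1) 0 s ≤ r * (θ₁ - θ₂) * (t - s) := by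
  have hL : 0 ≤ r * (θ₁ - θ₂) := mul_nonneg hr (sub_nonneg.2 hθ)
  have hγ := isRectifiableCurve_circArc hr hθ
  rw [variationOnFromTo.sub_right hγ.locallyBounded ⟨le_rfl, zero_le_one⟩ ht hs,
    variationOnFromTo.eq_of_le _ _ hst]
  have h1 := (lipschitzWith_circArc hr hθ).lipschitzOnWith (s := univ)
    |>.comp_eVariationOn_le (f := circArc r θ₁ θ₂) (g := id) (s := Icc 0 1 ∩ Icc s t)
      (mapsTo_univ _ _)
  rw [Function.comp_id] at h1
  have h2 : eVariationOn (id : ℝ → ℝ) (Icc 0 1 ∩ Icc s t) ≤ ENNReal.ofReal (t - s) :=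
    (eVariationOn.mono _ inter_subset_right).trans (eVariationOn_id_Icc s t).le
  refine ENNReal.toReal_le_of_le_ofReal (mul_nonneg hL (sub_nonneg.2 hst)) ?_
  rw [ENNReal.ofReal_mul hL]
  exact h1.trans (mul_le_mul_right h2 _)

lemma log_ofReal_mul_exp {r θ : ℝ} (hr : 0 < r) (h1 : -Real.pi < θ) (h2 : θ ≤ Real.pi) :
    Complex.log (r * Complex.exp (θ * Complex.I)) = Real.log r + θ * Complex.I := by
  rw [Complex.log_ofReal_mul hr (Complex.exp_ne_zero _), Complex.log_exp (by simpa using h1)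
    (by simpa using h2)]

lemma ofReal_mul_exp_mem_slitPlane {r θ : ℝ} (hr : 0 < r) (h1 : -Real.pi < θ) (h2 : θ < Real.pi) :
    (r * Complex.exp (θ * Complex.I) : ℂ) ∈ Complex.slitPlane := by
  rw [Complex.mem_slitPlane_iff_arg]
  refine ⟨?_, mul_ne_zero (Complex.ofReal_ne_zero.2 hr.ne') (Complex.exp_ne_zero _)⟩
  rw [← Complex.log_im, log_ofReal_mul_exp hr h1 h2.le]
  simpa using h2.ne

/-- The Lipschitz constant bounds the length from above on `[0, t]` and on `[t, 1]`. The total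
length is at least `r (θ₁ - θ₂)` by the logarithm estimate with the constant weight `1/r`, so both
bounds are equalities. -/
lemma arcLength_circArc {r θ₁ θ₂ : ℝ} (hr : 0 < r) (hθ : θ₂ ≤ θ₁) (h1 : θ₁ < Real.pi)
    (h2 : -Real.pi < θ₂) {t : ℝ} (ht : t ∈ Icc (0 : ℝ) 1) :
    variationOnFromTo (circArc r θ₁ θ₂) (Icc 0 1) 0 t = r * (θ₁ - θ₂) * t := by
  have hγ := isRectifiableCurve_circArc hr.le hθ
  have hang : ∀ t ∈ Icc (0 : ℝ) 1, θ₂ ≤ θ₁ - (θ₁ - θ₂) * t ∧ θ₁ - (θ₁ - θ₂) * t ≤ θ₁ := by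
    intro t ht
    constructor <;> nlinarith [ht.1, ht.2, sub_nonneg.2 hθ]
  have hlow := hγ.le_rhoLength (ρ := fun _ => ENNReal.ofReal (1 / r)) le_rfl zero_le_one le_rfl
    (zero_le_one) (p := 0) (fun t ht => by
      rw [sub_zero]
      exact ofReal_mul_exp_mem_slitPlane hr (h2.trans_le (hang t ht).1) ((hang t ht).2.trans_lt h1))
    (fun t _ => by rw [sub_zero, norm_circArc hr.le])
  rw [rhoLength, lintegral_const, Measure.restrict_apply_univ, Real.volume_Icc, sub_zero,
    ← ENNReal.ofReal_mul (by positivity), ← IsRectifiableCurve.arcLength_one, sub_zero, sub_zero,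
    one_mul, circArc, circArc, mul_one, mul_zero, sub_zero, sub_sub_cancel,
    log_ofReal_mul_exp hr h2 (hθ.trans h1.le), log_ofReal_mul_exp hr (h2.trans_le hθ) h1.le,
    add_sub_add_left_eq_sub, ← sub_mul, norm_mul, Complex.norm_I, mul_one, ← Complex.ofReal_sub,
    Complex.norm_real, norm_sub_rev, Real.norm_of_nonneg (sub_nonneg.2 hθ)] at hlow
  have hv1 : 0 ≤ variationOnFromTo (circArc r θ₁ θ₂) (Icc 0 1) 0 1 :=
    variationOnFromTo.nonneg_of_le _ _ zero_le_one
  rw [ENNReal.ofReal_le_ofReal_iff (by positivity), one_div, inv_mul_eq_div, le_div_iff₀ hr] at hlow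
  have h3 := arcLength_circArc_sub_le hr.le hθ ⟨le_rfl, zero_le_one⟩ ht ht.1
  have h4 := arcLength_circArc_sub_le hr.le hθ ht ⟨zero_le_one, le_rfl⟩ ht.2
  rw [IsRectifiableCurve.arcLength_zero] at h3
  linarith

/-- The `ρ`-length of a circular arc in terms of the angle. -/
lemma rhoLength_circArc_le {r θ₁ θ₂ : ℝ} (hr : 0 < r) (hθ : θ₂ < θ₁) (h1 : θ₁ < Real.pi)
    (h2 : -Real.pi < θ₂) (ρ : ℂ → ENNReal) : rhoLength ρ (circArc r θ₁ θ₂) ≤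
      ENNReal.ofReal r * ∫⁻ θ in Icc θ₂ θ₁, ρ (r * Complex.exp (θ * Complex.I)) := by
  have hγ := isRectifiableCurve_circArc hr.le hθ.le
  have hL : 0 < r * (θ₁ - θ₂) := mul_pos hr (sub_pos.2 hθ)
  have hlen : (eVariationOn (circArc r θ₁ θ₂) (Icc 0 1)).toReal = r * (θ₁ - θ₂) := by
    rw [← IsRectifiableCurve.arcLength_one, arcLength_circArc hr hθ.le h1 h2 ⟨zero_le_one, le_rfl⟩,
      mul_one]
  let F : ℝ → ENNReal := (Icc 0 (r * (θ₁ - θ₂))).indicator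
    fun s => ρ (r * Complex.exp (((θ₁ - s / r : ℝ) : ℂ) * Complex.I))
  have e1 : rhoLength ρ (circArc r θ₁ θ₂) = ∫⁻ s, F s := by
    rw [rhoLength, hlen, lintegral_indicator measurableSet_Icc]
    refine setLIntegral_congr_fun measurableSet_Icc fun s hs => ?_
    have ht : s / (r * (θ₁ - θ₂)) ∈ Icc (0 : ℝ) 1 :=
      ⟨div_nonneg hs.1 hL.le, (div_le_one hL).2 hs.2⟩
    have h5 := hγ.naturalParameterization_arcLength ht
    rw [arcLength_circArc hr hθ.le h1 h2 ht, mul_div_cancel₀ _ hL.ne'] at h5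
    simp only [h5, circArc]
    have : θ₁ - (θ₁ - θ₂) * (s / (r * (θ₁ - θ₂))) = θ₁ - s / r := by
      have : θ₁ - θ₂ ≠ 0 := (sub_pos.2 hθ).ne'
      field_simp
    rw [this]
  have e2 : ∫⁻ s, F s = ENNReal.ofReal r * ∫⁻ u, F (r * u) := by
    have h3 := Real.smul_map_volume_mul_left hr.ne'
    conv_lhs => rw [← h3]
    rw [lintegral_smul_measure, abs_of_pos hr, smul_eq_mul,
      (measurableEmbedding_mulLeft₀ hr.ne').lintegral_map]
  have e3 : ∫⁻ u, F (r * u) = ∫⁻ u, F (r * (θ₁ - u)) :=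
    (lintegral_sub_left_eq_self (fun u => F (r * u)) θ₁).symm
  rw [e1, e2, e3]
  refine mul_le_mul_right (le_of_eq ?_) _
  rw [← lintegral_indicator measurableSet_Icc]
  refine lintegral_congr fun u => ?_
  have hiff : r * (θ₁ - u) ∈ Icc 0 (r * (θ₁ - θ₂)) ↔ u ∈ Icc θ₂ θ₁ := by
    rw [mem_Icc, mem_Icc, mul_le_mul_iff_right₀ hr, mul_nonneg_iff_of_pos_left hr]
    constructor <;> rintro ⟨h3, h4⟩ <;> constructor <;> linarith
  by_cases hu : u ∈ Icc θ₂ θ₁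
  · rw [indicator_of_mem hu]
    simp only [F]
    rw [indicator_of_mem (hiff.2 hu), mul_div_cancel_left₀ _ hr.ne', sub_sub_cancel]
  · rw [indicator_of_notMem hu]
    simp only [F]
    rw [indicator_of_notMem (mt hiff.1 hu)]

/-- Cauchy–Schwarz on an interval. -/
lemma sq_lintegral_le (f : ℝ → ENNReal) (hf : Measurable f) (s : Set ℝ) :
    (∫⁻ x in s, f x) ^ 2 ≤ volume s * ∫⁻ x in s, f x ^ 2 := by
  have h := ENNReal.lintegral_mul_le_Lp_mul_Lq (volume.restrict s)
    Real.HolderConjugate.two_two hf.aemeasurable (g := fun _ => 1) aemeasurable_const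
  simp only [Pi.mul_apply, mul_one, ENNReal.one_rpow, lintegral_const,
    Measure.restrict_apply_univ, one_mul] at h
  calc (∫⁻ x in s, f x) ^ 2 ≤ ((∫⁻ x in s, f x ^ (2 : ℝ)) ^ (1 / 2 : ℝ) * volume s ^ (1 / 2 : ℝ)) ^ 2 := by
        gcongr
    _ = volume s * ∫⁻ x in s, f x ^ 2 := by
        rw [mul_pow, ← ENNReal.rpow_natCast, ← ENNReal.rpow_natCast, ← ENNReal.rpow_mul,
          ← ENNReal.rpow_mul]
        norm_num
        rw [mul_comm]

lemma lintegral_inv_Ioo {r₁ r₂ : ℝ} (h1 : 0 < r₁) (h12 : r₁ ≤ r₂) (c : ℝ) (hc : 0 ≤ c) :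
    ∫⁻ r in Ioo r₁ r₂, ENNReal.ofReal (c / r) = ENNReal.ofReal (c * Real.log (r₂ / r₁)) := by
  have hcont : ContinuousOn (fun r : ℝ => c / r) (Icc r₁ r₂) :=
    continuousOn_const.div continuousOn_id fun r hr => (h1.trans_le hr.1).ne'
  have h3 : ∫ r in r₁..r₂, c / r = c * Real.log (r₂ / r₁) := by
    simp_rw [div_eq_mul_inv c]
    rw [intervalIntegral.integral_const_mul, integral_inv_of_pos h1 (h1.trans_le h12)]
  rw [← h3, intervalIntegral.integral_of_le h12, integral_Ioc_eq_integral_Ioo,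
    ofReal_integral_eq_lintegral_ofReal]
  · exact hcont.integrableOn_Icc.mono_set Ioo_subset_Icc_self
  · filter_upwards [self_mem_ae_restrict measurableSet_Ioo] with r hr
    have := h1.trans hr.1
    positivity

lemma lintegral_eq_polar (f : ℂ → ENNReal) (hf : Measurable f) :
    ∫⁻ z, f z = ∫⁻ r in Ioi (0 : ℝ), ∫⁻ θ in Ioo (-Real.pi) Real.pi,
      ENNReal.ofReal r * f (r * Complex.exp (θ * Complex.I)) := by
  rw [← Complex.lintegral_comp_polarCoord_symm, polarCoord_target, Measure.volume_eq_prod,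
    ← Measure.prod_restrict, lintegral_prod]
  · simp only [Complex.polarCoord_symm_apply, smul_eq_mul, Complex.exp_mul_I, Complex.ofReal_cos,
      Complex.ofReal_sin]
  · refine (Measurable.mul (by fun_prop) (hf.comp ?_)).aemeasurable
    have : Measurable fun p : ℝ × ℝ => (p.1 * (Real.cos p.2 + Real.sin p.2 * Complex.I) : ℂ) := by
      fun_prop
    have e : (fun p : ℝ × ℝ => Complex.polarCoord.symm p) =
        fun p => (p.1 * (Real.cos p.2 + Real.sin p.2 * Complex.I) : ℂ) :=
      funext fun p => Complex.polarCoord_symm_apply p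
    rw [show ⇑Complex.polarCoord.symm = _ from e]
    exact this

/-- The length-area estimate for circular arcs about `0` that end on the negative imaginary axis. -/
lemma le_lintegral_annulus {W : Set ℂ} (hW : IsOpen W) {Γ : Set (ℝ → ℂ)} {ρ : ℂ → ENNReal}
    (hρ : IsAdmissible ρ Γ) {Θ r₁ r₂ : ℝ} (hΘ : 0 < Θ) (h1 : 0 < r₁) (h12 : r₁ ≤ r₂)
    (harc : ∀ r ∈ Ioo r₁ r₂, ∃ θ, -(Real.pi / 2) < θ ∧ θ ≤ Real.pi / 2 ∧ θ + Real.pi / 2 ≤ Θ ∧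
      circArc r θ (-(Real.pi / 2)) ∈ Γ ∧
      ∀ τ ∈ Ioo (-(Real.pi / 2)) θ, (r * Complex.exp (τ * Complex.I) : ℂ) ∈ W) :
    ENNReal.ofReal (1 / Θ * Real.log (r₂ / r₁)) ≤ ∫⁻ z in W ∩ {z | r₁ < ‖z‖ ∧ ‖z‖ < r₂}, ρ z ^ 2 := by
  have hann : MeasurableSet (W ∩ {z : ℂ | r₁ < ‖z‖ ∧ ‖z‖ < r₂}) :=
    (hW.inter ((isOpen_lt continuous_const continuous_norm).and
      (isOpen_lt continuous_norm continuous_const))).measurableSet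
  have hρm : Measurable ρ := hρ.1
  rw [← lintegral_indicator hann, lintegral_eq_polar _ ((hρm.pow_const 2).indicator hann),
    ← lintegral_inv_Ioo h1 h12 _ (by positivity)]
  have hpi := Real.pi_pos
  calc ∫⁻ r in Ioo r₁ r₂, ENNReal.ofReal (1 / Θ / r)
      ≤ ∫⁻ r in Ioo r₁ r₂, ∫⁻ θ in Ioo (-Real.pi) Real.pi, ENNReal.ofReal r *
        (W ∩ {z | r₁ < ‖z‖ ∧ ‖z‖ < r₂}).indicator (fun z => ρ z ^ 2)
          (r * Complex.exp (θ * Complex.I)) := by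
        refine setLIntegral_mono' measurableSet_Ioo fun r hr => ?_
        obtain ⟨θ, hθ1, hθ2, hθ3, hΓ, hmem⟩ := harc r hr
        have hr0 : 0 < r := h1.trans hr.1
        have hlen := (hρ.2 _ hΓ (isRectifiableCurve_circArc hr0.le hθ1.le)).trans
          (rhoLength_circArc_le hr0 hθ1 (by linarith) (by linarith) ρ)
        have hmeas : Measurable fun τ : ℝ => ρ (r * Complex.exp (τ * Complex.I)) :=
          hρm.comp (by fun_prop)
        have hcs := sq_lintegral_le _ hmeas (Ioo (-(Real.pi / 2)) θ)
        rw [setLIntegral_congr Ioo_ae_eq_Icc.symm] at hlen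
        rw [Real.volume_Ioo] at hcs
        set I := ∫⁻ τ in Ioo (-(Real.pi / 2)) θ, ρ (r * Complex.exp (τ * Complex.I)) with hI
        set J := ∫⁻ τ in Ioo (-(Real.pi / 2)) θ, ρ (r * Complex.exp (τ * Complex.I)) ^ 2 with hJ
        have h3 : ENNReal.ofReal r * J ≤ ∫⁻ θ in Ioo (-Real.pi) Real.pi, ENNReal.ofReal r *
            (W ∩ {z | r₁ < ‖z‖ ∧ ‖z‖ < r₂}).indicator (fun z => ρ z ^ 2)
              (r * Complex.exp (θ * Complex.I)) := by
          rw [hJ, ← lintegral_const_mul' _ _ ENNReal.ofReal_ne_top]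
          refine (setLIntegral_mono' measurableSet_Ioo fun τ hτ => ?_).trans
            (lintegral_mono_set (Ioo_subset_Ioo (by linarith) (by linarith)))
          rw [indicator_of_mem]
          refine ⟨hmem τ hτ, ?_⟩
          rw [mem_ofPred_eq, norm_mul, Complex.norm_exp_ofReal_mul_I, mul_one, Complex.norm_real,
            Real.norm_of_nonneg hr0.le]
          exact hr
        refine le_trans ?_ h3
        -- Admissibility gives `1 ≤ r I`, and Cauchy–Schwarz gives `I² ≤ Θ J`. Dividing `1 ≤ r² Θ J`
        -- by `r Θ` leaves the polar integrand `r J` on the right.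
        have h4 : (1 : ENNReal) ≤ ENNReal.ofReal (r ^ 2 * Θ) * J := by
          calc (1 : ENNReal) ≤ (ENNReal.ofReal r * I) ^ 2 := one_le_pow₀ hlen
            _ = ENNReal.ofReal (r ^ 2) * I ^ 2 := by rw [mul_pow, ENNReal.ofReal_pow hr0.le]
            _ ≤ ENNReal.ofReal (r ^ 2) * (ENNReal.ofReal (θ - -(Real.pi / 2)) * J) := by gcongr
            _ ≤ ENNReal.ofReal (r ^ 2) * (ENNReal.ofReal Θ * J) := by
                gcongr; linarith
            _ = _ := by rw [ENNReal.ofReal_mul (by positivity), mul_assoc]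
        calc ENNReal.ofReal (1 / Θ / r) = ENNReal.ofReal (1 / Θ / r) * 1 := (mul_one _).symm
          _ ≤ ENNReal.ofReal (1 / Θ / r) * (ENNReal.ofReal (r ^ 2 * Θ) * J) := by gcongr
          _ = ENNReal.ofReal r * J := by
              rw [← mul_assoc, ← ENNReal.ofReal_mul (by positivity)]
              congr 2
              field_simp
    _ ≤ _ := lintegral_mono_set fun r hr => h1.trans hr.1

lemma curveFamily_circArc_mem {E F W : Set ℂ} {r θ : ℝ} (hθ : -(Real.pi / 2) < θ)
    (h0 : (r * Complex.exp (θ * Complex.I) : ℂ) ∈ E)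
    (h1 : (r * Complex.exp (((-(Real.pi / 2) : ℝ) : ℂ) * Complex.I) : ℂ) ∈ F)
    (hmem : ∀ τ ∈ Ioo (-(Real.pi / 2)) θ, (r * Complex.exp (τ * Complex.I) : ℂ) ∈ W) :
    circArc r θ (-(Real.pi / 2)) ∈ curveFamily E F W := by
  refine ⟨(continuous_circArc _ _ _).continuousOn, ?_, ?_, fun t ht => hmem _ ?_⟩
  · simpa [circArc] using h0
  · rw [circArc, mul_one, sub_sub_cancel]; exact h1
  · constructor <;> nlinarith [ht.1, ht.2]

lemma exp_neg_pi_div_two_mem_lowerHalfLine {r ε : ℝ} (h : ε < r) :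
    (r * Complex.exp (((-(Real.pi / 2) : ℝ) : ℂ) * Complex.I) : ℂ) ∈ lowerHalfLine ε := by
  constructor
  · rw [Complex.re_ofReal_mul, Complex.exp_ofReal_mul_I_re, Real.cos_neg, Real.cos_pi_div_two,
      mul_zero]
  · rw [Complex.im_ofReal_mul, Complex.exp_ofReal_mul_I_im, Real.sin_neg, Real.sin_pi_div_two]
    linarith

/-! ### Lower bound for the modulus -/

namespace ChimneySequences

variable {a b : ℕ → ℝ} {φ ψ : ℂ → ℂ}

lemma exists_arc_segment (h : ChimneySequences a b)
    (hφ : IsNormalizedConformalMap (chimneyDomain a b) φ ψ) {k : ℕ} {r ε : ℝ}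
    (h1 : b (k + 1) < r) (h2 : r < a k) (hε : ε < r) :
    ∃ θ, -(Real.pi / 2) < θ ∧ θ ≤ Real.pi / 2 ∧ θ + Real.pi / 2 ≤ Real.pi / 2 ∧
      circArc r θ (-(Real.pi / 2)) ∈ curveFamily (boundaryImage (chimneyDomain a b) ψ upperArc)
        (lowerHalfLine ε) (chimneyDomain a b) ∧
      ∀ τ ∈ Ioo (-(Real.pi / 2)) θ, (r * Complex.exp (τ * Complex.I) : ℂ) ∈ chimneyDomain a b := by
  have hpi := Real.pi_pos
  have hr : 0 < r := (h.b_pos _).trans h1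
  have hmem : ∀ τ ∈ Ioo (-(Real.pi / 2)) (0 : ℝ),
      (r * Complex.exp (τ * Complex.I) : ℂ) ∈ chimneyDomain a b := by
    intro τ hτ
    refine h.mem_iff.2 (Or.inl ⟨?_, ?_⟩)
    · rw [Complex.re_ofReal_mul, Complex.exp_ofReal_mul_I_re]
      exact mul_pos hr (Real.cos_pos_of_mem_Ioo ⟨hτ.1, by linarith [hτ.2]⟩)
    · rw [Complex.im_ofReal_mul, Complex.exp_ofReal_mul_I_im]
      exact mul_neg_of_pos_of_neg hr (Real.sin_neg_of_neg_of_neg_pi_lt hτ.2 (by linarith [hτ.1]))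
  refine ⟨0, by linarith, by linarith, by linarith, curveFamily_circArc_mem (by linarith) ?_
    (exp_neg_pi_div_two_mem_lowerHalfLine hε) hmem, hmem⟩
  simpa using h.segment_mem_boundaryImage hφ h1 h2

/-- The arc of radius `r` meets the left wall at the angle `arccos (a k / r) ≤ π/2`, so the opening
is at most `π`. Until then the cosine keeps it to the right of `a k`, and `r < b k` keeps it to the
left of the right wall. -/
lemma exists_arc_wall (h : ChimneySequences a b)
    (hφ : IsNormalizedConformalMap (chimneyDomain a b) φ ψ) {k : ℕ} {r ε : ℝ}
    (h1 : a k < r) (h2 : r < b k) (hε : ε < r) :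
    ∃ θ, -(Real.pi / 2) < θ ∧ θ ≤ Real.pi / 2 ∧ θ + Real.pi / 2 ≤ Real.pi ∧
      circArc r θ (-(Real.pi / 2)) ∈ curveFamily (boundaryImage (chimneyDomain a b) ψ upperArc)
        (lowerHalfLine ε) (chimneyDomain a b) ∧
      ∀ τ ∈ Ioo (-(Real.pi / 2)) θ, (r * Complex.exp (τ * Complex.I) : ℂ) ∈ chimneyDomain a b := by
  have hpi := Real.pi_pos
  have ha := h.a_pos k
  have hr : 0 < r := ha.trans h1
  have hq0 : 0 < a k / r := by positivity
  have hq1 : a k / r < 1 := (div_lt_one hr).2 h1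
  have hθ0 : 0 < Real.arccos (a k / r) := Real.arccos_pos.2 hq1
  have hθ1 : Real.arccos (a k / r) ≤ Real.pi / 2 := Real.arccos_le_pi_div_two.2 hq0.le
  have hcos : r * Real.cos (Real.arccos (a k / r)) = a k := by
    rw [Real.cos_arccos (by linarith) hq1.le, mul_div_cancel₀ _ hr.ne']
  have hmem : ∀ τ ∈ Ioo (-(Real.pi / 2)) (Real.arccos (a k / r)),
      (r * Complex.exp (τ * Complex.I) : ℂ) ∈ chimneyDomain a b := by
    intro τ hτ
    rcases lt_or_ge τ 0 with h0 | h0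
    · refine h.mem_iff.2 (Or.inl ⟨?_, ?_⟩)
      · rw [Complex.re_ofReal_mul, Complex.exp_ofReal_mul_I_re]
        exact mul_pos hr (Real.cos_pos_of_mem_Ioo ⟨hτ.1, by linarith [hτ.2]⟩)
      · rw [Complex.im_ofReal_mul, Complex.exp_ofReal_mul_I_im]
        exact mul_neg_of_pos_of_neg hr (Real.sin_neg_of_neg_of_neg_pi_lt h0 (by linarith [hτ.1]))
    · refine h.mem_iff.2 (Or.inr ⟨k, ?_, ?_⟩) <;>
        rw [Complex.re_ofReal_mul, Complex.exp_ofReal_mul_I_re]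
      · rw [← hcos]
        exact mul_lt_mul_of_pos_left
          (Real.cos_lt_cos_of_nonneg_of_le_pi h0 (by linarith) hτ.2) hr
      · refine lt_of_le_of_lt ?_ h2
        nlinarith [Real.cos_le_one τ]
  refine ⟨Real.arccos (a k / r), by linarith, hθ1, by linarith, curveFamily_circArc_mem
    (by linarith) ?_ (exp_neg_pi_div_two_mem_lowerHalfLine hε) hmem, hmem⟩
  have hE := h.wall_mem_boundaryImage hφ k (t := r * Real.sin (Real.arccos (a k / r)))
    (mul_pos hr (Real.sin_pos_of_pos_of_lt_pi hθ0 (by linarith)))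
  convert hE using 1
  apply Complex.ext
  · rw [Complex.re_ofReal_mul, Complex.exp_ofReal_mul_I_re, hcos]; simp
  · rw [Complex.im_ofReal_mul, Complex.exp_ofReal_mul_I_im, Complex.add_im, Complex.ofReal_im,
      Complex.im_ofReal_mul, Complex.I_im, mul_one, zero_add]

end ChimneySequences

/-- The logarithmic size of the scales from `b N` to `1`, weighted by `1` at the chimneys and by `2`
at the segments between them. -/
noncomputable def scaleSum (a b : ℕ → ℝ) (N : ℕ) : ℝ :=
  ∑ k ∈ Finset.range N, (Real.log (b k / a k) + 2 * Real.log (a k / b (k + 1)))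

/-- The weighted logarithmic size of the scales from `ε` to `1`, for `b (n + 1) ≤ ε ≤ b n`. -/
noncomputable def scaleSize (a b : ℕ → ℝ) (n : ℕ) (ε : ℝ) : ℝ :=
  scaleSum a b n + Real.log (b n / max (a n) ε) + 2 * Real.log (max (a n) ε / ε)

namespace ChimneySequences

variable {a b : ℕ → ℝ} {φ ψ : ℂ → ℂ}

lemma scaleSum_nonneg (h : ChimneySequences a b) (N : ℕ) : 0 ≤ scaleSum a b N :=
  Finset.sum_nonneg fun k _ => add_nonneg
    (Real.log_nonneg ((one_le_div (h.a_pos k)).2 (h.a_lt_b k).le))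
    (mul_nonneg zero_le_two (Real.log_nonneg
      ((one_le_div (h.b_pos _)).2 (h.b_succ_lt_a k).le)))

/-- Adds one annulus to the region already treated outside it; the two are disjoint, so the
integrals of `ρ²` add up. Iterating inward exhausts the scales. -/
lemma lintegral_outside_step {W : Set ℂ} {Γ : Set (ℝ → ℂ)} {ρ : ℂ → ENNReal}
    (hW : IsOpen W) (hρ : IsAdmissible ρ Γ) {Θ r₁ r₂ s : ℝ} (hΘ : 0 < Θ) (h1 : 0 < r₁)
    (h12 : r₁ ≤ r₂) (hs : 0 ≤ s)
    (harc : ∀ r ∈ Ioo r₁ r₂, ∃ θ, -(Real.pi / 2) < θ ∧ θ ≤ Real.pi / 2 ∧ θ + Real.pi / 2 ≤ Θ ∧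
      circArc r θ (-(Real.pi / 2)) ∈ Γ ∧
      ∀ τ ∈ Ioo (-(Real.pi / 2)) θ, (r * Complex.exp (τ * Complex.I) : ℂ) ∈ W)
    (hI : ENNReal.ofReal s ≤ ∫⁻ z in W ∩ {z | r₂ < ‖z‖}, ρ z ^ 2) :
    ENNReal.ofReal (s + 1 / Θ * Real.log (r₂ / r₁)) ≤ ∫⁻ z in W ∩ {z | r₁ < ‖z‖}, ρ z ^ 2 := by
  have h3 := le_lintegral_annulus hW hρ hΘ h1 h12 harc
  have hlog : 0 ≤ Real.log (r₂ / r₁) := Real.log_nonneg ((one_le_div h1).2 h12)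
  rw [ENNReal.ofReal_add hs (by positivity)]
  refine (add_le_add hI h3).trans ?_
  rw [← lintegral_union]
  · refine lintegral_mono_set ?_
    rintro z (⟨hz, hz'⟩ | ⟨hz, hz', -⟩)
    · exact ⟨hz, h12.trans_lt hz'⟩
    · exact ⟨hz, hz'⟩
  · exact (hW.inter ((isOpen_lt continuous_const continuous_norm).and
      (isOpen_lt continuous_norm continuous_const))).measurableSet
  · rw [Set.disjoint_left]
    rintro z ⟨-, hz⟩ ⟨-, -, hz'⟩
    exact lt_asymm hz hz'

lemma scaleSum_le_lintegral (h : ChimneySequences a b)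
    (hφ : IsNormalizedConformalMap (chimneyDomain a b) φ ψ) {ε : ℝ} {ρ : ℂ → ENNReal}
    (hρ : IsAdmissible ρ (curveFamily (boundaryImage (chimneyDomain a b) ψ upperArc)
      (lowerHalfLine ε) (chimneyDomain a b))) (N : ℕ) (hε : ε ≤ b N) :
    ENNReal.ofReal (1 / Real.pi * scaleSum a b N) ≤
      ∫⁻ z in chimneyDomain a b ∩ {z | b N < ‖z‖}, ρ z ^ 2 := by
  have hpi := Real.pi_pos
  induction N with
  | zero => simp [scaleSum]
  | succ N ih =>
    have hba := h.b_succ_lt_a N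
    have hab := h.a_lt_b N
    have h0 := ih (by linarith)
    have hS := h.scaleSum_nonneg N
    have h1 := lintegral_outside_step h.isOpen_domain hρ hpi (h.a_pos N) hab.le (by positivity)
      (fun r hr => h.exists_arc_wall hφ hr.1 hr.2 (by linarith [hr.1])) h0
    have hl : 0 ≤ Real.log (b N / a N) := Real.log_nonneg ((one_le_div (h.a_pos N)).2 hab.le)
    have h2 := lintegral_outside_step h.isOpen_domain hρ (half_pos hpi) (h.b_pos (N + 1)) hba.le
      (by positivity) (fun r hr => h.exists_arc_segment hφ hr.1 hr.2 (by linarith [hr.1])) h1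
    refine le_trans (le_of_eq ?_) h2
    rw [scaleSum, Finset.sum_range_succ, ← scaleSum]
    congr 1
    field_simp
    ring

/-- The lower bound for the modulus. -/
lemma scaleSize_le_modulus (h : ChimneySequences a b)
    (hφ : IsNormalizedConformalMap (chimneyDomain a b) φ ψ) {n : ℕ} {ε : ℝ}
    (h1 : b (n + 1) ≤ ε) (h2 : ε ≤ b n) :
    ENNReal.ofReal (1 / Real.pi * scaleSize a b n ε) ≤ modulus (chimneyDomain a b)
      (curveFamily (boundaryImage (chimneyDomain a b) ψ upperArc) (lowerHalfLine ε)
        (chimneyDomain a b)) := by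
  have hpi := Real.pi_pos
  have hε : 0 < ε := (h.b_pos _).trans_le h1
  refine le_iInf₂ fun ρ hρ => ?_
  have h0 := h.scaleSum_le_lintegral hφ hρ n h2
  have hS := h.scaleSum_nonneg n
  have hm : 0 < max (a n) ε := lt_max_of_lt_right hε
  have hmb : max (a n) ε ≤ b n := max_le (h.a_lt_b n).le h2
  have h3 := lintegral_outside_step h.isOpen_domain hρ hpi hm hmb (by positivity)
    (fun r hr => h.exists_arc_wall hφ ((le_max_left _ _).trans_lt hr.1) hr.2
      ((le_max_right _ _).trans_lt hr.1)) h0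
  have hl : 0 ≤ Real.log (b n / max (a n) ε) := Real.log_nonneg ((one_le_div hm).2 hmb)
  have h4 := lintegral_outside_step h.isOpen_domain hρ (half_pos hpi) hε (le_max_right (a n) ε)
    (by positivity) (fun r hr => h.exists_arc_segment hφ (h1.trans_lt hr.1)
      ((lt_max_iff.1 hr.2).resolve_right (not_lt.2 hr.1.le)) hr.1) h3
  refine (le_of_eq ?_).trans (h4.trans (lintegral_mono_set inter_subset_left))
  rw [scaleSize]
  congr 1
  field_simp

end ChimneySequences

/-! ### The almost extremal weight and its area -/

/-- Upper bound for the `L²` norm of `κ / |z|` on a set that lies in a sector of an annulus. -/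
lemma lintegral_sector_le {S : Set ℂ} (hS : MeasurableSet S) {r₁ r₂ α β κ : ℝ} (hr : 0 < r₁)
    (hαβ : α ≤ β) (hκ : 0 ≤ κ) (h : ∀ r : ℝ, 0 < r → ∀ θ : ℝ, θ ∈ Ioo (-Real.pi) Real.pi →
      (r * Complex.exp (θ * Complex.I) : ℂ) ∈ S → r ∈ Icc r₁ r₂ ∧ θ ∈ Icc α β) :
    ∫⁻ z in S, ENNReal.ofReal (κ / ‖z‖) ^ 2 ≤
      ENNReal.ofReal (κ ^ 2 * (β - α) * Real.log (r₂ / r₁)) := by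
  have hm : Measurable fun z : ℂ => ENNReal.ofReal (κ / ‖z‖) ^ 2 := by fun_prop
  rw [← lintegral_indicator hS, lintegral_eq_polar _ (hm.indicator hS)]
  have hle : ∀ r ∈ Ioi (0 : ℝ), ∫⁻ θ in Ioo (-Real.pi) Real.pi, ENNReal.ofReal r *
      S.indicator (fun z => ENNReal.ofReal (κ / ‖z‖) ^ 2) (r * Complex.exp (θ * Complex.I)) ≤
      (Icc r₁ r₂).indicator (fun r => ENNReal.ofReal (κ ^ 2 * (β - α) / r)) r := by
    intro r hr0
    rw [mem_Ioi] at hr0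
    by_cases hrI : r ∈ Icc r₁ r₂
    · rw [indicator_of_mem hrI]
      calc _ ≤ ∫⁻ θ in Ioo (-Real.pi) Real.pi, (Icc α β).indicator
            (fun _ => ENNReal.ofReal (κ ^ 2 / r)) θ := by
            refine setLIntegral_mono' measurableSet_Ioo fun θ hθ => ?_
            by_cases hz : (r * Complex.exp (θ * Complex.I) : ℂ) ∈ S
            · rw [indicator_of_mem hz, indicator_of_mem (h r hr0 θ hθ hz).2, norm_mul,
                Complex.norm_exp_ofReal_mul_I, mul_one, Complex.norm_real,
                Real.norm_of_nonneg hr0.le, ← ENNReal.ofReal_pow (by positivity),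
                ← ENNReal.ofReal_mul hr0.le]
              refine ENNReal.ofReal_le_ofReal (le_of_eq ?_)
              field_simp
            · rw [indicator_of_notMem hz, mul_zero]; exact zero_le
        _ ≤ ∫⁻ θ, (Icc α β).indicator (fun _ => ENNReal.ofReal (κ ^ 2 / r)) θ :=
            setLIntegral_le_lintegral _ _
        _ = ENNReal.ofReal (κ ^ 2 * (β - α) / r) := by
            rw [lintegral_indicator measurableSet_Icc, setLIntegral_const, Real.volume_Icc,
              ← ENNReal.ofReal_mul (by positivity)]
            congr 1; ring
    · rw [indicator_of_notMem hrI]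
      refine (le_of_eq ?_)
      rw [setLIntegral_congr_fun (g := fun _ => 0) measurableSet_Ioo, lintegral_zero]
      intro θ hθ
      have hz : (r * Complex.exp (θ * Complex.I) : ℂ) ∉ S := fun hz => hrI (h r hr0 θ hθ hz).1
      simp only [indicator_of_notMem hz, mul_zero]
  refine (setLIntegral_mono' measurableSet_Ioi hle).trans ((setLIntegral_le_lintegral _ _).trans ?_)
  rw [lintegral_indicator measurableSet_Icc]
  rcases le_or_gt r₁ r₂ with h12 | h12
  · rw [setLIntegral_congr Ioo_ae_eq_Icc.symm, lintegral_inv_Ioo hr h12 _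
      (mul_nonneg (sq_nonneg _) (sub_nonneg.2 hαβ))]
  · rw [Icc_eq_empty (not_le.2 h12), Measure.restrict_empty, lintegral_zero_measure]
    exact zero_le

lemma mem_Icc_of_re_nonneg {r θ : ℝ} (hr : 0 < r) (hθ : θ ∈ Ioo (-Real.pi) Real.pi)
    (h : 0 ≤ (r * Complex.exp (θ * Complex.I) : ℂ).re) :
    θ ∈ Icc (-(Real.pi / 2)) (Real.pi / 2) := by
  rw [Complex.re_ofReal_mul, Complex.exp_ofReal_mul_I_re] at h
  by_contra hc
  have : Real.cos θ < 0 := by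
    rw [mem_Icc, not_and_or, not_le, not_le] at hc
    rcases hc with hc | hc
    · rw [← Real.cos_neg]
      exact Real.cos_neg_of_pi_div_two_lt_of_lt (by linarith) (by linarith [hθ.1, Real.pi_pos])
    · exact Real.cos_neg_of_pi_div_two_lt_of_lt hc (by linarith [hθ.2, Real.pi_pos])
  nlinarith

lemma le_zero_of_im_nonpos {r θ : ℝ} (hr : 0 < r) (hθ : θ ∈ Ioo (-Real.pi) Real.pi)
    (h : (r * Complex.exp (θ * Complex.I) : ℂ).im ≤ 0) : θ ≤ 0 := by
  rw [Complex.im_ofReal_mul, Complex.exp_ofReal_mul_I_im] at h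
  by_contra! hc
  nlinarith [Real.sin_pos_of_pos_of_lt_pi hc hθ.2]

lemma norm_ofReal_mul_exp {r : ℝ} (hr : 0 < r) (θ : ℝ) :
    ‖(r * Complex.exp (θ * Complex.I) : ℂ)‖ = r := by
  rw [norm_mul, Complex.norm_exp_ofReal_mul_I, mul_one, Complex.norm_real,
    Real.norm_of_nonneg hr.le]

/-- The weight `1 / |z|` on an annulus around `|z| = x`. -/
noncomputable def collarWeight (x : ℝ) : ℂ → ENNReal :=
  {z | x / 27 ≤ ‖z‖ ∧ ‖z‖ ≤ 27 * x}.indicator fun z => ENNReal.ofReal (1 / ‖z‖)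

/-- The weight `(2 / π) / |z|` on a lower half-annulus. -/
noncomputable def segmentWeight (r₁ r₂ : ℝ) : ℂ → ENNReal :=
  {z | z.im ≤ 0 ∧ r₁ ≤ ‖z‖ ∧ ‖z‖ ≤ r₂}.indicator fun z => ENNReal.ofReal (2 / Real.pi / ‖z‖)

/-- The weight `(1 / π) / |z - p|` in a part of the half-plane to the right of `p`. -/
noncomputable def chimneyWeight (p r₁ r₂ : ℝ) : ℂ → ENNReal :=
  {z | p ≤ z.re ∧ 3 * p ≤ ‖z‖ ∧ r₁ ≤ ‖z‖ ∧ ‖z‖ ≤ r₂}.indicator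
    fun z => ENNReal.ofReal (1 / Real.pi / ‖z - p‖)

lemma measurableSet_collar (x : ℝ) : MeasurableSet {z : ℂ | x / 27 ≤ ‖z‖ ∧ ‖z‖ ≤ 27 * x} :=
  ((isClosed_le continuous_const continuous_norm).and
    (isClosed_le continuous_norm continuous_const)).measurableSet

lemma measurableSet_lowerAnnulus (r₁ r₂ : ℝ) :
    MeasurableSet {z : ℂ | z.im ≤ 0 ∧ r₁ ≤ ‖z‖ ∧ ‖z‖ ≤ r₂} :=
  ((isClosed_le Complex.continuous_im continuous_const).and
    ((isClosed_le continuous_const continuous_norm).and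
    (isClosed_le continuous_norm continuous_const))).measurableSet

lemma measurableSet_rightAnnulus (p r₁ r₂ : ℝ) :
    MeasurableSet {z : ℂ | p ≤ z.re ∧ 3 * p ≤ ‖z‖ ∧ r₁ ≤ ‖z‖ ∧ ‖z‖ ≤ r₂} :=
  ((isClosed_le continuous_const Complex.continuous_re).and
    ((isClosed_le continuous_const continuous_norm).and
    ((isClosed_le continuous_const continuous_norm).and
    (isClosed_le continuous_norm continuous_const)))).measurableSet

lemma measurable_collarWeight (x : ℝ) : Measurable (collarWeight x) :=
  Measurable.indicator (by fun_prop) (measurableSet_collar x)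

lemma measurable_segmentWeight (r₁ r₂ : ℝ) : Measurable (segmentWeight r₁ r₂) :=
  Measurable.indicator (by fun_prop) (measurableSet_lowerAnnulus r₁ r₂)

lemma measurable_chimneyWeight (p r₁ r₂ : ℝ) : Measurable (chimneyWeight p r₁ r₂) :=
  Measurable.indicator (by fun_prop) (measurableSet_rightAnnulus p r₁ r₂)

lemma setLIntegral_indicator_sq {W S : Set ℂ} (hS : MeasurableSet S) (f : ℂ → ENNReal) :
    ∫⁻ z in W, S.indicator f z ^ 2 = ∫⁻ z in S ∩ W, f z ^ 2 := by
  have : (fun z => S.indicator f z ^ 2) = S.indicator fun z => f z ^ 2 := by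
    ext z
    by_cases hz : z ∈ S <;> simp [hz]
  rw [this, setLIntegral_indicator hS]

lemma lintegral_collarWeight_sq_le {W : Set ℂ} (hW : MeasurableSet W)
    (hre : ∀ z ∈ W, 0 ≤ z.re) {x : ℝ} (hx : 0 < x) :
    ∫⁻ z in W, collarWeight x z ^ 2 ≤ ENNReal.ofReal (Real.pi * Real.log 729) := by
  have hpi := Real.pi_pos
  unfold collarWeight
  rw [setLIntegral_indicator_sq (measurableSet_collar x)]
  refine (lintegral_sector_le ((measurableSet_collar x).inter hW) (r₁ := x / 27) (r₂ := 27 * x)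
    (α := -(Real.pi / 2)) (β := Real.pi / 2) (by positivity) (by linarith) zero_le_one
    fun r hr θ hθ hz => ?_).trans (ENNReal.ofReal_le_ofReal (le_of_eq ?_))
  · refine ⟨?_, mem_Icc_of_re_nonneg hr hθ (hre _ hz.2)⟩
    have h1 := hz.1
    rw [mem_ofPred_eq, norm_ofReal_mul_exp hr] at h1
    exact h1
  · have : 27 * x / (x / 27) = 729 := by field_simp; norm_num
    rw [this]; ring

lemma lintegral_segmentWeight_sq_le {W : Set ℂ} (hW : MeasurableSet W)
    (hre : ∀ z ∈ W, 0 ≤ z.re) {r₁ r₂ : ℝ} (h1 : 0 < r₁) :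
    ∫⁻ z in W, segmentWeight r₁ r₂ z ^ 2 ≤
      ENNReal.ofReal (1 / Real.pi * (2 * Real.log (r₂ / r₁))) := by
  have hpi := Real.pi_pos
  unfold segmentWeight
  rw [setLIntegral_indicator_sq (measurableSet_lowerAnnulus r₁ r₂)]
  refine (lintegral_sector_le ((measurableSet_lowerAnnulus r₁ r₂).inter hW) (r₁ := r₁) (r₂ := r₂)
    (α := -(Real.pi / 2)) (β := 0) h1 (by linarith) (by positivity)
    fun r hr θ hθ hz => ?_).trans (ENNReal.ofReal_le_ofReal (le_of_eq ?_))
  · have h1 := hz.1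
    rw [mem_ofPred_eq, norm_ofReal_mul_exp hr] at h1
    exact ⟨h1.2, (mem_Icc_of_re_nonneg hr hθ (hre _ hz.2)).1, le_zero_of_im_nonpos hr hθ h1.1⟩
  · field_simp
    ring

/-- After translating the corner `p` to `0` the set lies in the right half-plane. The condition `|z|
≥ 3p` ensures that the distance from the corner is at least `2/3` of `|z|`, so moving the center
costs only `log (3/2)`. -/
lemma lintegral_chimneyWeight_sq_le (W : Set ℂ) {p r₁ r₂ : ℝ} (hp : 0 < p) (hr : 0 < r₂) :
    ∫⁻ z in W, chimneyWeight p r₁ r₂ z ^ 2 ≤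
      ENNReal.ofReal (1 / Real.pi * (Real.log (r₂ / max p r₁) + Real.log (3 / 2))) := by
  have hpi := Real.pi_pos
  set S := {z : ℂ | p ≤ z.re ∧ 3 * p ≤ ‖z‖ ∧ r₁ ≤ ‖z‖ ∧ ‖z‖ ≤ r₂} with hS
  have hSm : MeasurableSet S := measurableSet_rightAnnulus p r₁ r₂
  have hm : 0 < max p r₁ := lt_max_of_lt_left hp
  have e : ∫⁻ z, chimneyWeight p r₁ r₂ z ^ 2 =
      ∫⁻ z in (fun z : ℂ => z + p) ⁻¹' S, ENNReal.ofReal (1 / Real.pi / ‖z‖) ^ 2 := by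
    rw [← lintegral_add_right_eq_self _ (p : ℂ), ← lintegral_indicator
      (hSm.preimage (measurable_add_const _))]
    refine lintegral_congr fun z => ?_
    by_cases hz : z + p ∈ S
    · rw [indicator_of_mem (show z ∈ (fun z : ℂ => z + p) ⁻¹' S from hz)]
      unfold chimneyWeight
      rw [← hS, indicator_of_mem hz, add_sub_cancel_right]
    · rw [indicator_of_notMem (show z ∉ (fun z : ℂ => z + p) ⁻¹' S from hz)]
      unfold chimneyWeight
      rw [← hS, indicator_of_notMem hz]
      simp
  refine (setLIntegral_le_lintegral _ _).trans (e.le.trans ?_)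
  refine (lintegral_sector_le (hSm.preimage (measurable_add_const _)) (r₁ := 2 / 3 * max p r₁)
    (r₂ := r₂) (α := -(Real.pi / 2)) (β := Real.pi / 2) (by positivity) (by linarith)
    (by positivity) fun r hr θ hθ hz => ?_).trans (ENNReal.ofReal_le_ofReal (le_of_eq ?_))
  · rw [mem_preimage] at hz
    set z : ℂ := r * Complex.exp (θ * Complex.I) with hzdef
    have hzn : ‖z‖ = r := norm_ofReal_mul_exp hr θ
    obtain ⟨h1, h2, h3, h4⟩ := hz
    rw [Complex.add_re, Complex.ofReal_re] at h1
    have hre : 0 ≤ z.re := by linarith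
    have h5 : ‖z + p‖ ≤ r + p := by
      refine (norm_add_le _ _).trans_eq ?_
      rw [hzn, Complex.norm_real, Real.norm_of_nonneg hp.le]
    have h6 : ‖z‖ ≤ ‖z + p‖ := by
      rw [← sq_le_sq₀ (norm_nonneg _) (norm_nonneg _), ← Complex.normSq_eq_norm_sq,
        ← Complex.normSq_eq_norm_sq, Complex.normSq_apply, Complex.normSq_apply, Complex.add_re,
        Complex.add_im, Complex.ofReal_re, Complex.ofReal_im, add_zero]
      nlinarith
    refine ⟨⟨?_, by linarith⟩, mem_Icc_of_re_nonneg hr hθ hre⟩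
    rcases max_choice p r₁ with h7 | h7 <;> rw [h7] <;> linarith
  · have : r₂ / (2 / 3 * max p r₁) = r₂ / max p r₁ * (3 / 2) := by field_simp
    rw [this, Real.log_mul (by positivity) (by norm_num)]
    field_simp
    ring

/-- Why the weights are combined by a supremum: it dominates each of them, so it inherits their
length bounds, and its area is at most the sum of their areas, without cross terms. -/
lemma finset_sup_sq_le {ι : Type*} [DecidableEq ι] (s : Finset ι) (f : ι → ENNReal) :
    (s.sup f) ^ 2 ≤ ∑ i ∈ s, f i ^ 2 := by
  induction s using Finset.induction with
  | empty => simp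
  | insert i s hi ih =>
    rw [Finset.sup_insert, Finset.sum_insert hi]
    rcases le_total (f i) (s.sup f) with h | h
    · rw [sup_eq_right.2 h]; exact ih.trans le_add_self
    · rw [sup_eq_left.2 h]; exact le_self_add

lemma sup_sq_le (x y : ENNReal) : (x ⊔ y) ^ 2 ≤ x ^ 2 + y ^ 2 := by
  rcases le_total x y with h | h
  · rw [sup_eq_right.2 h]; exact le_add_self
  · rw [sup_eq_left.2 h]; exact le_self_add

/-- The weights of the `k`-th chimney and of the segment to the left of it. -/
noncomputable def levelWeight (a b : ℕ → ℝ) (ε : ℝ) (k : ℕ) (z : ℂ) : ENNReal :=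
  (collarWeight (a k) z ⊔ collarWeight (b k) z) ⊔
    (segmentWeight (max (b (k + 1)) ε) (a k) z ⊔ chimneyWeight (a k) ε (b k) z)

/-- An almost extremal weight. -/
noncomputable def chimneyMetric (a b : ℕ → ℝ) (n : ℕ) (ε : ℝ) (z : ℂ) : ENNReal :=
  collarWeight ε z ⊔ (Finset.range (n + 1)).sup fun k => levelWeight a b ε k z

lemma measurable_finset_sup {ι : Type*} [DecidableEq ι] (s : Finset ι) {f : ι → ℂ → ENNReal}
    (hf : ∀ i, Measurable (f i)) : Measurable fun z => s.sup fun i => f i z := by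
  induction s using Finset.induction with
  | empty => simp
  | insert i s hi ih =>
    simp only [Finset.sup_insert]
    exact (hf i).sup ih

lemma measurable_levelWeight (a b : ℕ → ℝ) (ε : ℝ) (k : ℕ) : Measurable (levelWeight a b ε k) :=
  ((measurable_collarWeight _).sup (measurable_collarWeight _)).sup
    ((measurable_segmentWeight _ _).sup (measurable_chimneyWeight _ _ _))

lemma measurable_chimneyMetric (a b : ℕ → ℝ) (n : ℕ) (ε : ℝ) :
    Measurable (chimneyMetric a b n ε) :=
  (measurable_collarWeight ε).sup (measurable_finset_sup _ (measurable_levelWeight a b ε))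

/-- The bound for the error per level. -/
noncomputable def levelError : ℝ := 3 * (Real.pi * Real.log 729) + 1 / Real.pi * Real.log (3 / 2)

lemma levelError_pos : 0 < levelError := by
  have hpi := Real.pi_pos
  have h1 : 0 < Real.log 729 := Real.log_pos (by norm_num)
  have h2 : 0 < Real.log (3 / 2) := Real.log_pos (by norm_num)
  unfold levelError
  positivity

namespace ChimneySequences

variable {a b : ℕ → ℝ}

/-- The contribution of one level to `scaleSize`. -/
lemma scaleSize_eq_sum (h : ChimneySequences a b) {n : ℕ} {ε : ℝ} (h1 : b (n + 1) ≤ ε)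
    (h2 : ε ≤ b n) : scaleSize a b n ε = ∑ k ∈ Finset.range (n + 1),
      (Real.log (b k / max (a k) ε) + 2 * Real.log (max (a k) ε / max (b (k + 1)) ε)) := by
  rw [Finset.sum_range_succ, scaleSize, scaleSum, max_eq_right h1, add_assoc]
  congr 1
  refine Finset.sum_congr rfl fun k hk => ?_
  have hk' : ε ≤ b (k + 1) := h2.trans (h.b_le_b (Nat.succ_le_of_lt (Finset.mem_range.1 hk)))
  rw [max_eq_left hk', max_eq_left (hk'.trans (h.b_succ_lt_a k).le)]

lemma lintegral_levelWeight_sq_le (h : ChimneySequences a b) {ε : ℝ} (hε : 0 < ε) {k : ℕ}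
    (hk : ε ≤ b k) : ∫⁻ z in chimneyDomain a b, levelWeight a b ε k z ^ 2 ≤
      ENNReal.ofReal (1 / Real.pi * (Real.log (b k / max (a k) ε) +
        2 * Real.log (max (a k) ε / max (b (k + 1)) ε)) +
        (2 * (Real.pi * Real.log 729) + 1 / Real.pi * Real.log (3 / 2))) := by
  have hpi := Real.pi_pos
  have hW := h.isOpen_domain.measurableSet
  have hre : ∀ z ∈ chimneyDomain a b, 0 ≤ z.re := fun z hz => (h.re_pos hz).le
  have hl1 : 0 < Real.log 729 := Real.log_pos (by norm_num)
  have hl2 : 0 < Real.log (3 / 2) := Real.log_pos (by norm_num)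
  have hm1 : 0 < max (a k) ε := lt_max_of_lt_right hε
  have hm2 : 0 < max (b (k + 1)) ε := lt_max_of_lt_right hε
  have hm3 : max (b (k + 1)) ε ≤ max (a k) ε := max_le_max (h.b_succ_lt_a k).le le_rfl
  have hl3 : 0 ≤ Real.log (b k / max (a k) ε) :=
    Real.log_nonneg ((one_le_div hm1).2 (max_le (h.a_lt_b k).le hk))
  have hl4 : 0 ≤ Real.log (max (a k) ε / max (b (k + 1)) ε) :=
    Real.log_nonneg ((one_le_div hm2).2 hm3)
  calc _ ≤ ∫⁻ z in chimneyDomain a b, ((collarWeight (a k) z ^ 2 + collarWeight (b k) z ^ 2) +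
        (segmentWeight (max (b (k + 1)) ε) (a k) z ^ 2 + chimneyWeight (a k) ε (b k) z ^ 2)) := by
        refine lintegral_mono fun z => (sup_sq_le _ _).trans ?_
        exact add_le_add (sup_sq_le _ _) (sup_sq_le _ _)
    _ = (∫⁻ z in chimneyDomain a b, collarWeight (a k) z ^ 2) +
        (∫⁻ z in chimneyDomain a b, collarWeight (b k) z ^ 2) +
        ((∫⁻ z in chimneyDomain a b, segmentWeight (max (b (k + 1)) ε) (a k) z ^ 2) +
        (∫⁻ z in chimneyDomain a b, chimneyWeight (a k) ε (b k) z ^ 2)) := by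
        have m1 := (measurable_collarWeight (a k)).pow_const 2
        have m2 := (measurable_segmentWeight (max (b (k + 1)) ε) (a k)).pow_const 2
        have m3 : Measurable fun z => collarWeight (a k) z ^ 2 + collarWeight (b k) z ^ 2 :=
          m1.add ((measurable_collarWeight (b k)).pow_const 2)
        rw [lintegral_add_left m3, lintegral_add_left m1, lintegral_add_left m2]
    _ ≤ ENNReal.ofReal (Real.pi * Real.log 729) + ENNReal.ofReal (Real.pi * Real.log 729) +
        (ENNReal.ofReal (1 / Real.pi * (2 * Real.log (max (a k) ε / max (b (k + 1)) ε))) +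
        ENNReal.ofReal (1 / Real.pi * (Real.log (b k / max (a k) ε) + Real.log (3 / 2)))) := by
        refine add_le_add (add_le_add (lintegral_collarWeight_sq_le hW hre (h.a_pos k))
          (lintegral_collarWeight_sq_le hW hre (h.b_pos k))) (add_le_add
          ((lintegral_segmentWeight_sq_le hW hre hm2).trans (ENNReal.ofReal_le_ofReal ?_))
          (lintegral_chimneyWeight_sq_le _ (h.a_pos k) (h.b_pos k)))
        have ha := h.a_pos k
        gcongr
        exact le_max_left _ _
    _ = _ := by
        rw [← ENNReal.ofReal_add (by positivity) (by positivity),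
          ← ENNReal.ofReal_add (by positivity) (by positivity),
          ← ENNReal.ofReal_add (by positivity) (by positivity)]
        congr 1
        ring

lemma lintegral_chimneyMetric_sq_le (h : ChimneySequences a b) {n : ℕ} {ε : ℝ}
    (h1 : b (n + 1) ≤ ε) (h2 : ε ≤ b n) :
    ∫⁻ z in chimneyDomain a b, chimneyMetric a b n ε z ^ 2 ≤
      ENNReal.ofReal (1 / Real.pi * scaleSize a b n ε + levelError * (n + 1)) := by
  have hpi := Real.pi_pos
  have hε : 0 < ε := (h.b_pos _).trans_le h1
  have hW := h.isOpen_domain.measurableSet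
  have hre : ∀ z ∈ chimneyDomain a b, 0 ≤ z.re := fun z hz => (h.re_pos hz).le
  have hl1 : 0 < Real.log 729 := Real.log_pos (by norm_num)
  have hl2 : 0 < Real.log (3 / 2) := Real.log_pos (by norm_num)
  have hk : ∀ k ∈ Finset.range (n + 1), ε ≤ b k := fun k hk =>
    h2.trans (h.b_le_b (Nat.lt_succ_iff.1 (Finset.mem_range.1 hk)))
  have hnn : ∀ k ∈ Finset.range (n + 1), 0 ≤ 1 / Real.pi * (Real.log (b k / max (a k) ε) +
        2 * Real.log (max (a k) ε / max (b (k + 1)) ε)) +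
        (2 * (Real.pi * Real.log 729) + 1 / Real.pi * Real.log (3 / 2)) := by
    intro k hk'
    have hm1 : 0 < max (a k) ε := lt_max_of_lt_right hε
    have hl3 : 0 ≤ Real.log (b k / max (a k) ε) :=
      Real.log_nonneg ((one_le_div hm1).2 (max_le (h.a_lt_b k).le (hk k hk')))
    have hl4 : 0 ≤ Real.log (max (a k) ε / max (b (k + 1)) ε) :=
      Real.log_nonneg ((one_le_div (lt_max_of_lt_right hε)).2
        (max_le_max (h.b_succ_lt_a k).le le_rfl))
    positivity
  calc _ ≤ ∫⁻ z in chimneyDomain a b, (collarWeight ε z ^ 2 +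
        ∑ k ∈ Finset.range (n + 1), levelWeight a b ε k z ^ 2) :=
        lintegral_mono fun z => (sup_sq_le _ _).trans (add_le_add le_rfl (finset_sup_sq_le _ _))
    _ = (∫⁻ z in chimneyDomain a b, collarWeight ε z ^ 2) +
        ∑ k ∈ Finset.range (n + 1), ∫⁻ z in chimneyDomain a b, levelWeight a b ε k z ^ 2 := by
        rw [lintegral_add_left ((measurable_collarWeight ε).pow_const 2),
          lintegral_finsetSum _ fun k _ => (measurable_levelWeight a b ε k).pow_const 2]
    _ ≤ ENNReal.ofReal (Real.pi * Real.log 729) + ∑ k ∈ Finset.range (n + 1), ENNReal.ofReal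
        (1 / Real.pi * (Real.log (b k / max (a k) ε) +
        2 * Real.log (max (a k) ε / max (b (k + 1)) ε)) +
        (2 * (Real.pi * Real.log 729) + 1 / Real.pi * Real.log (3 / 2))) :=
        add_le_add (lintegral_collarWeight_sq_le hW hre hε)
          (Finset.sum_le_sum fun k hk' => h.lintegral_levelWeight_sq_le hε (hk k hk'))
    _ ≤ _ := by
        rw [← ENNReal.ofReal_sum_of_nonneg hnn,
          ← ENNReal.ofReal_add (by positivity) (Finset.sum_nonneg hnn)]
        refine ENNReal.ofReal_le_ofReal ?_
        rw [Finset.sum_add_distrib, ← Finset.mul_sum, ← h.scaleSize_eq_sum h1 h2, Finset.sum_const,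
          Finset.card_range, nsmul_eq_mul, levelError]
        push_cast
        -- `levelError` allots a third collar to each of the `n + 1` levels, while only one collar
        -- at `ε` is present; this is the surplus.
        have : 0 ≤ (n : ℝ) * (Real.pi * Real.log 729) := by positivity
        nlinarith

end ChimneySequences

/-! ### Admissibility of the weight -/

/-- A closed set that contains the interior of an arc contains its endpoints. -/
lemma mem_of_forall_mem_Ioo {γ : ℝ → ℂ} {u v : ℝ} (huv : u < v) (hγ : ContinuousOn γ (Icc u v))
    {S : Set ℂ} (hS : IsClosed S) (h : ∀ t ∈ Ioo u v, γ t ∈ S) {t : ℝ} (ht : t ∈ Icc u v) :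
    γ t ∈ S := by
  have hc := hγ.preimage_isClosed_of_isClosed isClosed_Icc hS
  have : Icc u v ⊆ Icc u v ∩ γ ⁻¹' S := by
    rw [← closure_Ioo huv.ne]
    exact closure_minimal (fun t ht => ⟨by rw [closure_Ioo huv.ne]; exact Ioo_subset_Icc_self ht,
      h t ht⟩) (by rwa [closure_Ioo huv.ne])
  exact (this ht).2

/-- Take the last time with `f ≤ u`, and after it the first time with `f ≥ v`; in between `f` stays
in `[u, v]`. -/
lemma exists_subinterval_between {f : ℝ → ℝ} {s t u v : ℝ} (hst : s ≤ t)
    (hf : ContinuousOn f (Icc s t)) (hs : f s ≤ u) (ht : v ≤ f t) (huv : u ≤ v) :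
    ∃ t₁ t₂, s ≤ t₁ ∧ t₁ ≤ t₂ ∧ t₂ ≤ t ∧ f t₁ = u ∧ f t₂ = v ∧
      ∀ τ ∈ Icc t₁ t₂, u ≤ f τ ∧ f τ ≤ v := by
  have hK : IsCompact (Icc s t ∩ f ⁻¹' Iic u) :=
    isCompact_Icc.of_isClosed_subset (hf.preimage_isClosed_of_isClosed isClosed_Icc isClosed_Iic)
      inter_subset_left
  obtain ⟨t₁, ht₁, hmax⟩ := hK.exists_isGreatest ⟨s, left_mem_Icc.2 hst, hs⟩
  have hf1 : ContinuousOn f (Icc t₁ t) := hf.mono (Icc_subset_Icc_left ht₁.1.1)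
  have h1u : f t₁ = u := by
    obtain ⟨τ, hτ, hτu⟩ := intermediate_value_Icc ht₁.1.2 hf1 ⟨ht₁.2, huv.trans ht⟩
    have := hmax ⟨⟨ht₁.1.1.trans hτ.1, hτ.2⟩, hτu.le⟩
    rwa [le_antisymm this hτ.1] at hτu
  have hK2 : IsCompact (Icc t₁ t ∩ f ⁻¹' Ici v) :=
    isCompact_Icc.of_isClosed_subset (hf1.preimage_isClosed_of_isClosed isClosed_Icc isClosed_Ici)
      inter_subset_left
  obtain ⟨t₂, ht₂, hmin⟩ := hK2.exists_isLeast ⟨t, right_mem_Icc.2 ht₁.1.2, ht⟩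
  have h2v : f t₂ = v := by
    obtain ⟨τ, hτ, hτv⟩ := intermediate_value_Icc ht₂.1.1
      (hf1.mono (Icc_subset_Icc_right ht₂.1.2)) ⟨h1u.le.trans huv, ht₂.2⟩
    have := hmin ⟨⟨hτ.1, hτ.2.trans ht₂.1.2⟩, hτv.ge⟩
    rwa [le_antisymm hτ.2 this] at hτv
  refine ⟨t₁, t₂, ht₁.1.1, ht₂.1.1, ht₂.1.2, h1u, h2v, fun τ hτ => ⟨?_, ?_⟩⟩
  · by_contra! hc
    have := hmax ⟨⟨ht₁.1.1.trans hτ.1, hτ.2.trans ht₂.1.2⟩, hc.le⟩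
    rw [le_antisymm this hτ.1, h1u] at hc
    exact lt_irrefl _ hc
  · by_contra! hc
    have := hmin ⟨⟨hτ.1, hτ.2.trans ht₂.1.2⟩, hc.le⟩
    rw [le_antisymm hτ.2 this, h2v] at hc
    exact lt_irrefl _ hc

lemma one_le_log_three : 1 ≤ Real.log 3 := by
  rw [Real.le_log_iff_exp_le (by norm_num)]
  linarith [Real.exp_one_lt_d9]

section Curve

variable {γ : ℝ → ℂ} {ρ : ℂ → ENNReal}

lemma le_collarWeight {x : ℝ} {z : ℂ} (h1 : x / 27 ≤ ‖z‖) (h2 : ‖z‖ ≤ 27 * x) :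
    ENNReal.ofReal (1 / ‖z‖) ≤ collarWeight x z := by
  unfold collarWeight
  rw [indicator_of_mem (show z ∈ {z : ℂ | x / 27 ≤ ‖z‖ ∧ ‖z‖ ≤ 27 * x} from ⟨h1, h2⟩)]

/-- The imaginary part of the logarithm measures turning about `p`; its real part, used in
`one_le_rhoLength_of_norm`, measures radial crossing. -/
lemma one_le_rhoLength_of_arg (hγ : IsRectifiableCurve γ) {t₁ t₂ : ℝ} (h0 : 0 ≤ t₁)
    (h12 : t₁ ≤ t₂) (h1 : t₂ ≤ 1) {κ : ℝ} (hκ : 0 ≤ κ) {p : ℂ}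
    (hp : ∀ t ∈ Icc t₁ t₂, γ t - p ∈ Complex.slitPlane)
    (hρ : ∀ t ∈ Icc t₁ t₂, ENNReal.ofReal (κ / ‖γ t - p‖) ≤ ρ (γ t))
    (harg : 1 ≤ κ * |Complex.arg (γ t₂ - p) - Complex.arg (γ t₁ - p)|) :
    1 ≤ rhoLength ρ γ := by
  refine le_trans ?_ (hγ.le_rhoLength h0 h12 h1 hκ hp hρ)
  rw [← ENNReal.ofReal_one]
  refine ENNReal.ofReal_le_ofReal (harg.trans (mul_le_mul_of_nonneg_left ?_ hκ))
  rw [← Complex.log_im, ← Complex.log_im, ← Complex.sub_im]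
  exact Complex.abs_im_le_norm _

lemma one_le_rhoLength_of_norm (hγ : IsRectifiableCurve γ) {t₁ t₂ : ℝ} (h0 : 0 ≤ t₁)
    (h12 : t₁ ≤ t₂) (h1 : t₂ ≤ 1) (hp : ∀ t ∈ Icc (0 : ℝ) 1, γ t ∈ Complex.slitPlane)
    (hρ : ∀ t ∈ Icc t₁ t₂, ENNReal.ofReal (1 / ‖γ t‖) ≤ ρ (γ t))
    (hlog : 1 ≤ |Real.log ‖γ t₂‖ - Real.log ‖γ t₁‖|) : 1 ≤ rhoLength ρ γ := by
  refine le_trans ?_ (hγ.le_rhoLength h0 h12 h1 zero_le_one (p := 0)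
    (fun t ht => by rw [sub_zero]; exact hp t ⟨h0.trans ht.1, ht.2.trans h1⟩)
    (by simpa only [sub_zero] using hρ))
  rw [← ENNReal.ofReal_one]
  refine ENNReal.ofReal_le_ofReal (hlog.trans ?_)
  rw [one_mul, sub_zero, sub_zero, ← Complex.log_re, ← Complex.log_re, ← Complex.sub_re]
  exact Complex.abs_re_le_norm _

/-- A curve that crosses a collar is long. -/
lemma one_le_rhoLength_of_crossing (hγ : IsRectifiableCurve γ)
    (hp : ∀ t ∈ Icc (0 : ℝ) 1, γ t ∈ Complex.slitPlane) {x u : ℝ}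
    (hρ : ∀ z, collarWeight x z ≤ ρ z) (hu : 0 < u) (hxu : x / 27 ≤ u) (hux : 3 * u ≤ 27 * x)
    {s t : ℝ} (hs : s ∈ Icc (0 : ℝ) 1) (ht : t ∈ Icc (0 : ℝ) 1) (hsu : ‖γ s‖ ≤ u)
    (htu : 3 * u ≤ ‖γ t‖) : 1 ≤ rhoLength ρ γ := by
  have hw : ∀ z : ℂ, u ≤ ‖z‖ → ‖z‖ ≤ 3 * u → ENNReal.ofReal (1 / ‖z‖) ≤ ρ z := fun z h1 h2 =>
    (le_collarWeight (hxu.trans h1) (h2.trans hux)).trans (hρ z)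
  have hl : Real.log (3 * u) = Real.log 3 + Real.log u := Real.log_mul (by norm_num) hu.ne'
  rcases le_total s t with hst | hst
  · obtain ⟨t₁, t₂, h1, h12, h2, e1, e2, hb⟩ := exists_subinterval_between (f := fun t => ‖γ t‖) hst
      (hγ.1.norm.mono (Icc_subset_Icc hs.1 ht.2)) hsu htu (by linarith)
    refine one_le_rhoLength_of_norm hγ (hs.1.trans h1) h12 (h2.trans ht.2) hp
      (fun τ hτ => hw _ (hb τ hτ).1 (hb τ hτ).2) ?_
    rw [e1, e2, hl, add_sub_cancel_right]
    exact one_le_log_three.trans (le_abs_self _)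
  · obtain ⟨t₁, t₂, h1, h12, h2, e1, e2, hb⟩ := exists_subinterval_between
      (f := fun t => -‖γ t‖) hst (hγ.1.norm.neg.mono (Icc_subset_Icc ht.1 hs.2))
      (neg_le_neg htu) (neg_le_neg hsu) (by linarith)
    refine one_le_rhoLength_of_norm hγ (ht.1.trans h1) h12 (h2.trans hs.2) hp
      (fun τ hτ => hw _ (neg_le_neg_iff.1 (hb τ hτ).2) (neg_le_neg_iff.1 (hb τ hτ).1)) ?_
    simp only [neg_inj] at e1 e2
    rw [e1, e2, hl, abs_sub_comm, add_sub_cancel_right]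
    exact one_le_log_three.trans (le_abs_self _)

/-- An arc in the lower half-plane that connects the positive real axis to the negative imaginary
one. -/
lemma one_le_rhoLength_of_quarter (hγ : IsRectifiableCurve γ)
    (hp : ∀ t ∈ Icc (0 : ℝ) 1, γ t ∈ Complex.slitPlane) {t₀ x : ℝ} (ht₀ : t₀ ∈ Icc (0 : ℝ) 1)
    (hx : 0 < x) (h0 : γ t₀ = x) (h1r : (γ 1).re = 0) (h1i : (γ 1).im < 0) {κ : ℝ}
    (hκ : 2 / Real.pi ≤ κ) (hρ : ∀ t ∈ Icc t₀ 1, ENNReal.ofReal (κ / ‖γ t‖) ≤ ρ (γ t)) :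
    1 ≤ rhoLength ρ γ := by
  have hpi := Real.pi_pos
  refine one_le_rhoLength_of_arg hγ ht₀.1 ht₀.2 le_rfl (le_trans (by positivity) hκ) (p := 0)
    (fun t ht => by rw [sub_zero]; exact hp t ⟨ht₀.1.trans ht.1, ht.2⟩)
    (by simpa only [sub_zero] using hρ) ?_
  rw [sub_zero, sub_zero, h0, Complex.arg_ofReal_of_nonneg hx.le,
    Complex.arg_eq_neg_pi_div_two_iff.2 ⟨h1r, h1i⟩, sub_zero, abs_neg, abs_of_pos (by positivity)]
  calc (1 : ℝ) = 2 / Real.pi * (Real.pi / 2) := by field_simp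
    _ ≤ _ := by gcongr

/-- After `t₀` the curve either changes its modulus by a factor `3`, which costs `log 3 ≥ 1`, or
stays within `[x/3, 3x]` and makes a quarter turn, which costs `π/2 ≥ 1`. As `x` is within a factor
`9` of the collar radius, a collar of ratio `27 = 9 · 3` on either side suffices. -/
lemma one_le_rhoLength_near_collar (hγ : IsRectifiableCurve γ)
    (hp : ∀ t ∈ Icc (0 : ℝ) 1, γ t ∈ Complex.slitPlane) {t₀ x : ℝ} (ht₀ : t₀ ∈ Icc (0 : ℝ) 1)
    (hx : 0 < x) (h0 : γ t₀ = x) (h1r : (γ 1).re = 0) (h1i : (γ 1).im < 0) {c : ℝ}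
    (hρ : ∀ z, collarWeight c z ≤ ρ z) (hcx : c / 9 ≤ x) (hxc : x ≤ 9 * c) :
    1 ≤ rhoLength ρ γ := by
  have hpi := Real.pi_gt_three
  have hn : ‖γ t₀‖ = x := by rw [h0, Complex.norm_real, Real.norm_of_nonneg hx.le]
  by_cases hA : ∃ t ∈ Icc t₀ 1, ‖γ t‖ ≤ x / 3
  · obtain ⟨t, ht, ht'⟩ := hA
    exact one_le_rhoLength_of_crossing hγ hp hρ (u := x / 3) (by linarith) (by linarith)
      (by linarith) ⟨ht₀.1.trans ht.1, ht.2⟩ ht₀ ht' (by linarith)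
  by_cases hB : ∃ t ∈ Icc t₀ 1, 3 * x ≤ ‖γ t‖
  · obtain ⟨t, ht, ht'⟩ := hB
    exact one_le_rhoLength_of_crossing hγ hp hρ (u := x) (by linarith) (by linarith)
      (by linarith) ht₀ ⟨ht₀.1.trans ht.1, ht.2⟩ hn.le ht'
  push Not at hA hB
  refine one_le_rhoLength_of_quarter hγ hp ht₀ hx h0 h1r h1i (κ := 1)
    ((div_le_one (by linarith)).2 (by linarith)) fun t ht => ?_
  exact (le_collarWeight (by linarith [hA t ht]) (by linarith [hB t ht])).trans (hρ _)

/-- The last point of a curve in the closed upper half-plane. -/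
lemma exists_last_real (hγ : ContinuousOn γ (Icc 0 1)) (h0 : 0 ≤ (γ 0).im) (h1 : (γ 1).im < 0) :
    ∃ t₀ ∈ Ico (0 : ℝ) 1, (γ t₀).im = 0 ∧ ∀ t ∈ Icc t₀ 1, (γ t).im ≤ 0 := by
  have hf : ContinuousOn (fun t => (γ t).im) (Icc 0 1) := Complex.continuous_im.comp_continuousOn hγ
  have hK : IsCompact (Icc 0 1 ∩ (fun t => (γ t).im) ⁻¹' Ici 0) :=
    isCompact_Icc.of_isClosed_subset (hf.preimage_isClosed_of_isClosed isClosed_Icc isClosed_Ici)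
      inter_subset_left
  obtain ⟨t₀, ht₀, hmax⟩ := hK.exists_isGreatest ⟨0, left_mem_Icc.2 zero_le_one, h0⟩
  have hz : (γ t₀).im = 0 := by
    obtain ⟨τ, hτ, hτ0⟩ := intermediate_value_Icc' ht₀.1.2
      (hf.mono (Icc_subset_Icc_left ht₀.1.1)) ⟨h1.le, ht₀.2⟩
    have := hmax ⟨⟨ht₀.1.1.trans hτ.1, hτ.2⟩, hτ0.ge⟩
    rwa [le_antisymm this hτ.1] at hτ0
  refine ⟨t₀, ⟨ht₀.1.1, lt_of_le_of_ne ht₀.1.2 ?_⟩, hz, fun t ht => ?_⟩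
  · rintro rfl
    exact h1.ne hz
  · by_contra! hc
    have := hmax ⟨⟨ht₀.1.1.trans ht.1, ht.2⟩, hc.le⟩
    rw [le_antisymm this ht.1, hz] at hc
    exact lt_irrefl _ hc

end Curve

namespace ChimneySequences

variable {a b : ℕ → ℝ} {γ : ℝ → ℂ}

/-- A curve that meets the base of a chimney and avoids its corners and small scales goes from the
left wall around the left corner. -/
lemma exists_subarc_around_corner (h : ChimneySequences a b) {k : ℕ}
    (hγ : ContinuousOn γ (Icc 0 1)) (hW : ∀ t ∈ Ioo (0 : ℝ) 1, γ t ∈ chimneyDomain a b)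
    (h0 : γ 0 ∉ chimneyDomain a b) (h0i : 0 ≤ (γ 0).im) (h1r : (γ 1).re = 0) (h1i : (γ 1).im < 0)
    (hn : ∀ t ∈ Icc (0 : ℝ) 1, 3 * a k < ‖γ t‖ ∧ ‖γ t‖ < b k) {t₀ : ℝ} (ht₀ : t₀ ∈ Ico (0 : ℝ) 1)
    (hi : (γ t₀).im = 0) (hr : a k < (γ t₀).re) :
    ∃ t₁ ∈ Icc (0 : ℝ) 1, (γ 0).re = a k ∧ 0 < (γ 0).im ∧ (γ t₁).re = a k ∧ (γ t₁).im < 0 ∧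
      ∀ t ∈ Ioo 0 t₁, a k < (γ t).re := by
  have ha := h.a_pos k
  have hnr : ∀ t ∈ Icc (0 : ℝ) 1, (γ t).re < b k := fun t ht =>
    (Complex.re_le_norm _).trans_lt (hn t ht).2
  have hreal : ∀ t ∈ Icc (0 : ℝ) 1, (γ t).im = 0 → 3 * a k < |(γ t).re| := fun t ht h0 => by
    have h1 := (hn t ht).1
    rwa [show γ t = ((γ t).re : ℂ) from Complex.ext rfl h0, Complex.norm_real,
      Real.norm_eq_abs] at h1
  have hre0 : ∀ t ∈ Icc (0 : ℝ) 1, 0 ≤ (γ t).re := fun t ht =>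
    mem_of_forall_mem_Ioo zero_lt_one hγ (isClosed_le continuous_const Complex.continuous_re)
      (S := {z : ℂ | 0 ≤ z.re}) (fun t ht => (h.re_pos (hW t ht)).le) ht
  have ht₀0 : 0 < t₀ := by
    refine lt_of_le_of_ne ht₀.1 ?_
    rintro rfl
    exact h0 (h.mem_iff.2 (Or.inr ⟨k, hr, hnr _ ⟨le_rfl, zero_le_one⟩⟩))
  -- The rest of the curve could only be in `im > 0`, `re < a k`: the wall is not in the domain, and
  -- on the real axis the curve has `re > 3 a k`. These two open sets are disjoint, and the point at
  -- `t₀` decides for the first.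
  have hV : ∀ t ∈ Ioo (0 : ℝ) 1, (γ t).im < 0 ∨ a k < (γ t).re := by
    have hsub := IsPreconnected.subset_left_of_subset_union (s := γ '' Ioo 0 1)
      (u := {z : ℂ | z.im < 0 ∨ a k < z.re}) (v := {z : ℂ | 0 < z.im ∧ z.re < a k})
      ((isOpen_lt Complex.continuous_im continuous_const).union
        (isOpen_lt continuous_const Complex.continuous_re))
      ((isOpen_lt continuous_const Complex.continuous_im).and
        (isOpen_lt Complex.continuous_re continuous_const))
      (Set.disjoint_left.2 fun z h1 h2 => by
        rcases h1 with h1 | h1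
        · exact lt_asymm h1 h2.1
        · exact lt_asymm h1 h2.2)
      (by
        rintro _ ⟨t, ht, rfl⟩
        have ht' := Ioo_subset_Icc_self ht
        by_cases hc : (γ t).im < 0 ∨ a k < (γ t).re
        · exact Or.inl hc
        · right
          push Not at hc
          rcases h.mem_iff.1 (hW t ht) with h5 | h5
          · linarith [h5.2]
          · have h6 : (γ t).re ≠ a k := fun h6 => h.notMem_base_a k (h6 ▸ h5)
            refine ⟨lt_of_le_of_ne hc.1 fun h7 => ?_, lt_of_le_of_ne hc.2 h6⟩
            have h8 := hreal t ht' h7.symm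
            rw [abs_of_nonneg (hre0 t ht')] at h8
            linarith)
      ⟨γ t₀, ⟨t₀, ⟨ht₀0, ht₀.2⟩, rfl⟩, Or.inr hr⟩
      (isPreconnected_Ioo.image _ (hγ.mono Ioo_subset_Icc_self))
    exact fun t ht => hsub ⟨t, ht, rfl⟩
  have m0 : (0 : ℝ) ∈ Icc (0 : ℝ) 1 := left_mem_Icc.2 zero_le_one
  have m1 : (1 : ℝ) ∈ Icc (0 : ℝ) 1 := right_mem_Icc.2 zero_le_one
  have h0pos : 0 < (γ 0).im := by
    refine lt_of_le_of_ne h0i fun hc => h0 (h.mem_iff.2 (Or.inr ⟨k, ?_, hnr 0 m0⟩))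
    have h8 := hreal 0 m0 hc.symm
    rw [abs_of_nonneg (hre0 0 m0)] at h8
    linarith
  have h0a : (γ 0).re = a k := by
    have h5 : (γ 0).im ≤ 0 ∨ a k ≤ (γ 0).re := mem_of_forall_mem_Ioo zero_lt_one hγ
      (S := {z : ℂ | z.im ≤ 0} ∪ {z | a k ≤ z.re})
      ((isClosed_le Complex.continuous_im continuous_const).union
        (isClosed_le continuous_const Complex.continuous_re))
      (fun t ht => (hV t ht).imp le_of_lt le_of_lt) m0
    refine le_antisymm (not_lt.1 fun h6 => ?_) (h5.resolve_left (not_le.2 h0pos))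
    exact h0 (h.mem_iff.2 (Or.inr ⟨k, h6, hnr 0 m0⟩))
  -- `t₁` is the first time in the closed quadrant below and to the left of the corner; until then
  -- the curve is strictly to the right of the wall.
  have hK : IsCompact (Icc 0 1 ∩ γ ⁻¹' {z : ℂ | z.re ≤ a k ∧ z.im ≤ 0}) :=
    isCompact_Icc.of_isClosed_subset (hγ.preimage_isClosed_of_isClosed isClosed_Icc
      ((isClosed_le Complex.continuous_re continuous_const).and
        (isClosed_le Complex.continuous_im continuous_const))) inter_subset_left
  obtain ⟨t₁, ⟨ht₁, hq⟩, hmin⟩ := hK.exists_isLeast ⟨1, m1, by rw [h1r]; exact ha.le, h1i.le⟩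
  have ht₁0 : 0 < t₁ := by
    refine lt_of_le_of_ne ht₁.1 ?_
    rintro rfl
    exact absurd hq.2 (not_le.2 h0pos)
  have hin : ∀ t ∈ Ioo 0 t₁, a k < (γ t).re := by
    intro t ht
    by_contra! hc
    have ht' : t ∈ Ioo (0 : ℝ) 1 := ⟨ht.1, ht.2.trans_le ht₁.2⟩
    have := hmin ⟨Ioo_subset_Icc_self ht', hc, ((hV t ht').resolve_right (not_lt.2 hc)).le⟩
    exact absurd this (not_le.2 ht.2)
  have h1a : (γ t₁).re = a k := le_antisymm hq.1 (mem_of_forall_mem_Ioo ht₁0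
    (hγ.mono (Icc_subset_Icc_right ht₁.2)) (S := {z : ℂ | a k ≤ z.re})
    (isClosed_le continuous_const Complex.continuous_re) (fun t ht => (hin t ht).le)
    (right_mem_Icc.2 ht₁0.le))
  refine ⟨t₁, ht₁, h0a, h0pos, h1a, lt_of_le_of_ne hq.2 fun h7 => ?_, hin⟩
  have h8 := hreal t₁ ht₁ h7
  rw [h1a, abs_of_pos ha] at h8
  linarith

lemma collarWeight_le_chimneyMetric (n : ℕ) (ε : ℝ) (z : ℂ) :
    collarWeight ε z ≤ chimneyMetric a b n ε z := le_sup_left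

lemma levelWeight_le_chimneyMetric {n k : ℕ} (hk : k ≤ n) (ε : ℝ) (z : ℂ) :
    levelWeight a b ε k z ≤ chimneyMetric a b n ε z :=
  le_trans (Finset.le_sup (f := fun k => levelWeight a b ε k z)
    (Finset.mem_range.2 (Nat.lt_succ_of_le hk))) le_sup_right

lemma collarWeight_a_le {n k : ℕ} (hk : k ≤ n) (ε : ℝ) (z : ℂ) :
    collarWeight (a k) z ≤ chimneyMetric a b n ε z :=
  (le_sup_left.trans le_sup_left).trans (levelWeight_le_chimneyMetric hk ε z)

lemma collarWeight_b_le {n k : ℕ} (hk : k ≤ n) (ε : ℝ) (z : ℂ) :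
    collarWeight (b k) z ≤ chimneyMetric a b n ε z :=
  (le_sup_right.trans le_sup_left).trans (levelWeight_le_chimneyMetric hk ε z)

lemma le_chimneyMetric_of_lowerAnnulus {n k : ℕ} (hk : k ≤ n) {ε : ℝ} {z : ℂ} (h1 : z.im ≤ 0)
    (h2 : max (b (k + 1)) ε ≤ ‖z‖) (h3 : ‖z‖ ≤ a k) :
    ENNReal.ofReal (2 / Real.pi / ‖z‖) ≤ chimneyMetric a b n ε z := by
  refine le_trans ?_ ((le_sup_left.trans le_sup_right).trans (levelWeight_le_chimneyMetric hk ε z))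
  unfold segmentWeight
  rw [indicator_of_mem (show z ∈ {z : ℂ | z.im ≤ 0 ∧ max (b (k + 1)) ε ≤ ‖z‖ ∧ ‖z‖ ≤ a k} from
    ⟨h1, h2, h3⟩)]

lemma le_chimneyMetric_of_rightAnnulus {n k : ℕ} (hk : k ≤ n) {ε : ℝ} {z : ℂ} (h1 : a k ≤ z.re)
    (h2 : 3 * a k ≤ ‖z‖) (h3 : ε ≤ ‖z‖) (h4 : ‖z‖ ≤ b k) :
    ENNReal.ofReal (1 / Real.pi / ‖z - a k‖) ≤ chimneyMetric a b n ε z := by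
  refine le_trans ?_ ((le_sup_right.trans le_sup_right).trans (levelWeight_le_chimneyMetric hk ε z))
  unfold chimneyWeight
  rw [indicator_of_mem (show z ∈ {z : ℂ | a k ≤ z.re ∧ 3 * a k ≤ ‖z‖ ∧ ε ≤ ‖z‖ ∧ ‖z‖ ≤ b k} from
    ⟨h1, h2, h3, h4⟩)]

/-- Along the subarc the argument about the corner `a k` goes from `π/2` to `-π/2`, and the weight
is `(1/π)/|z - a k|`. -/
lemma one_le_rhoLength_around_corner (h : ChimneySequences a b) {n k : ℕ} (hk : k ≤ n) {ε : ℝ}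
    (hγ : IsRectifiableCurve γ) (hW : ∀ t ∈ Ioo (0 : ℝ) 1, γ t ∈ chimneyDomain a b)
    (h0 : γ 0 ∉ chimneyDomain a b) (h0i : 0 ≤ (γ 0).im) (h1r : (γ 1).re = 0) (h1i : (γ 1).im < 0)
    (hn : ∀ t ∈ Icc (0 : ℝ) 1, 3 * a k < ‖γ t‖ ∧ ‖γ t‖ < b k)
    (hnε : ∀ t ∈ Icc (0 : ℝ) 1, ε ≤ ‖γ t‖) {t₀ : ℝ} (ht₀ : t₀ ∈ Ico (0 : ℝ) 1)
    (hi : (γ t₀).im = 0) (hr : a k < (γ t₀).re) :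
    1 ≤ rhoLength (chimneyMetric a b n ε) γ := by
  have hpi := Real.pi_pos
  obtain ⟨t₁, ht₁, h0a, h0p, h1a, h1n, hin⟩ :=
    h.exists_subarc_around_corner hγ.1 hW h0 h0i h1r h1i hn ht₀ hi hr
  have hre : ∀ t ∈ Icc 0 t₁, a k ≤ (γ t).re ∧ γ t - a k ∈ Complex.slitPlane := by
    intro t ht
    rw [Complex.mem_slitPlane_iff, Complex.sub_re, Complex.sub_im, Complex.ofReal_re,
      Complex.ofReal_im, sub_zero, sub_pos]
    rcases ht.1.eq_or_lt with e | e
    · subst e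
      exact ⟨h0a.ge, Or.inr h0p.ne'⟩
    rcases ht.2.eq_or_lt with e' | e'
    · subst e'
      exact ⟨h1a.ge, Or.inr h1n.ne⟩
    exact ⟨(hin t ⟨e, e'⟩).le, Or.inl (hin t ⟨e, e'⟩)⟩
  refine one_le_rhoLength_of_arg hγ le_rfl ht₁.1 ht₁.2 (κ := 1 / Real.pi) (by positivity)
    (p := (a k : ℂ)) (fun t ht => (hre t ht).2) (fun t ht => ?_) ?_
  · have ht' : t ∈ Icc (0 : ℝ) 1 := ⟨ht.1, ht.2.trans ht₁.2⟩
    exact le_chimneyMetric_of_rightAnnulus hk (hre t ht).1 (hn t ht').1.le (hnε t ht')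
      (hn t ht').2.le
  · have e0 : Complex.arg (γ 0 - a k) = Real.pi / 2 :=
      Complex.arg_eq_pi_div_two_iff.2 (by simp [h0a, h0p])
    have e1 : Complex.arg (γ t₁ - a k) = -(Real.pi / 2) :=
      Complex.arg_eq_neg_pi_div_two_iff.2 (by simp [h1a, h1n])
    rw [e0, e1, show -(Real.pi / 2) - Real.pi / 2 = -Real.pi by ring, abs_neg, abs_of_pos hpi]
    exact (by field_simp : (1 : ℝ) = 1 / Real.pi * Real.pi).le

lemma exists_level (h : ChimneySequences a b) {n : ℕ} {x : ℝ} (h1 : b (n + 1) ≤ x)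
    (h2 : x < 1) : ∃ k ≤ n, b (k + 1) ≤ x ∧ x < b k := by
  classical
  have hex : ∃ k, b (k + 1) ≤ x := ⟨n, h1⟩
  refine ⟨Nat.find hex, Nat.find_min' hex h1, Nat.find_spec hex, ?_⟩
  rcases hk : Nat.find hex with _ | k
  · rwa [h.b_zero]
  · exact not_le.1 (Nat.find_min hex (m := k) (by omega))

/-- Let `x` be the last real point of the curve. If `x` is within a factor `9` of a collar radius,
that collar suffices. If not, but the curve leaves the annulus of its scale, it crosses a collar.
Otherwise it stays at one scale: for `x` on a segment, the final part in the lower half-plane makes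
a quarter turn about `0`; for `x` in the base of a chimney, the curve goes around the left corner.
-/
lemma one_le_rhoLength_chimneyMetric (h : ChimneySequences a b) {n : ℕ} {ε : ℝ}
    (hbε : b (n + 1) ≤ ε) (hγ : IsRectifiableCurve γ)
    (hW : ∀ t ∈ Ioo (0 : ℝ) 1, γ t ∈ chimneyDomain a b)
    (h0 : γ 0 ∉ chimneyDomain a b) (h0i : 0 ≤ (γ 0).im)
    (h0r : (γ 0).im = 0 → 0 < (γ 0).re ∧ (γ 0).re < 1) (h1 : γ 1 ∈ lowerHalfLine ε) :
    1 ≤ rhoLength (chimneyMetric a b n ε) γ := by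
  have hε : 0 < ε := (h.b_pos _).trans_le hbε
  have h1r : (γ 1).re = 0 := h1.1
  have h1i : (γ 1).im < 0 := by linarith [h1.2]
  have hre0 : ∀ t ∈ Icc (0 : ℝ) 1, 0 ≤ (γ t).re := fun t ht =>
    mem_of_forall_mem_Ioo zero_lt_one hγ.1 (isClosed_le continuous_const Complex.continuous_re)
      (S := {z : ℂ | 0 ≤ z.re}) (fun t ht => (h.re_pos (hW t ht)).le) ht
  have hp : ∀ t ∈ Icc (0 : ℝ) 1, γ t ∈ Complex.slitPlane := by
    intro t ht
    rw [Complex.mem_slitPlane_iff]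
    rcases ht.1.eq_or_lt with e | e
    · subst e
      by_cases h2 : (γ 0).im = 0
      · exact Or.inl (h0r h2).1
      · exact Or.inr h2
    rcases ht.2.eq_or_lt with e' | e'
    · subst e'
      exact Or.inr h1i.ne
    exact Or.inl (h.re_pos (hW t ⟨e, e'⟩))
  obtain ⟨t₀, ht₀, hi0, hlow⟩ := exists_last_real hγ.1 h0i h1i
  have ht₀' : t₀ ∈ Icc (0 : ℝ) 1 := Ico_subset_Icc_self ht₀
  set x := (γ t₀).re with hxdef
  have hγx : γ t₀ = x := Complex.ext rfl hi0
  have hx : 0 < x ∧ x < 1 := by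
    rcases ht₀.1.eq_or_lt with e | e
    · rw [hxdef]
      subst e
      exact h0r hi0
    · have hw := hW t₀ ⟨e, ht₀.2⟩
      exact ⟨h.re_pos hw, h.re_lt_one hw hi0.ge⟩
  have hnx : ‖γ t₀‖ = x := by rw [hγx, Complex.norm_real, Real.norm_of_nonneg hx.1.le]
  have m1 : (1 : ℝ) ∈ Icc (0 : ℝ) 1 := right_mem_Icc.2 zero_le_one
  have hn1 : ε ≤ ‖γ 1‖ := by
    refine le_trans ?_ (Complex.abs_im_le_norm _)
    rw [abs_of_neg h1i]
    linarith [h1.2]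
  have near : ∀ c : ℝ, (∀ z, collarWeight c z ≤ chimneyMetric a b n ε z) → c / 9 ≤ x →
      x ≤ 9 * c → 1 ≤ rhoLength (chimneyMetric a b n ε) γ := fun c hc h2 h3 =>
    one_le_rhoLength_near_collar hγ hp ht₀' hx.1 hγx h1r h1i hc h2 h3
  have small : ∀ c : ℝ, 0 < c → (∀ z, collarWeight c z ≤ chimneyMetric a b n ε z) → 9 * c < x →
      ∀ t ∈ Icc (0 : ℝ) 1, ‖γ t‖ ≤ 3 * c → 1 ≤ rhoLength (chimneyMetric a b n ε) γ :=
    fun c hc0 hc h2 t ht h3 => one_le_rhoLength_of_crossing hγ hp hc (u := 3 * c) (by linarith)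
      (by linarith) (by linarith) ht ht₀' h3 (by linarith)
  have large : ∀ c : ℝ, 0 < c → (∀ z, collarWeight c z ≤ chimneyMetric a b n ε z) → x < c / 9 →
      ∀ t ∈ Icc (0 : ℝ) 1, c ≤ ‖γ t‖ → 1 ≤ rhoLength (chimneyMetric a b n ε) γ :=
    fun c hc0 hc h2 t ht h3 => one_le_rhoLength_of_crossing hγ hp hc (u := c / 3) (by linarith)
      (by linarith) (by linarith) ht₀' ht (by linarith) (by linarith)
  have cε := collarWeight_le_chimneyMetric (a := a) (b := b) n ε
  rcases lt_or_ge x (ε / 9) with h2 | h2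
  · exact large ε hε cε h2 1 m1 hn1
  rcases le_or_gt x (9 * ε) with h3 | h3
  · exact near ε cε h2 h3
  obtain ⟨k, hk, hk1, hk2⟩ := h.exists_level (n := n) (x := x) (by linarith) hx.2
  have ha0 := h.a_pos k
  have hb0 := h.b_pos k
  have ca := collarWeight_a_le (a := a) (b := b) hk ε
  have cb := collarWeight_b_le (a := a) (b := b) hk ε
  by_cases hxa : a k / 9 ≤ x ∧ x ≤ 9 * a k
  · exact near _ ca hxa.1 hxa.2
  rcases le_or_gt x (a k) with h4 | h4
  · have h5 : x < a k / 9 := by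
      by_contra! hc
      exact hxa ⟨hc, by linarith⟩
    -- If `b (k + 1) > ε` then `k ≠ n`, so level `k + 1` is among those that carry a collar at `b (k
    -- + 1)`.
    have hc : ∀ z, collarWeight (max (b (k + 1)) ε) z ≤ chimneyMetric a b n ε z := by
      rcases le_or_gt (b (k + 1)) ε with h6 | h6
      · rwa [max_eq_right h6]
      · rw [max_eq_left h6.le]
        refine collarWeight_b_le (Nat.succ_le_of_lt (lt_of_le_of_ne hk ?_)) ε
        rintro rfl
        exact absurd hbε (not_le.2 h6)
    have hm : 0 < max (b (k + 1)) ε := lt_max_of_lt_right hε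
    rcases le_or_gt x (9 * max (b (k + 1)) ε) with h6 | h6
    · refine near _ hc ?_ h6
      rcases max_choice (b (k + 1)) ε with h7 | h7 <;> rw [h7] <;> linarith
    by_cases hA : ∃ t ∈ Icc (0 : ℝ) 1, ‖γ t‖ ≤ 3 * max (b (k + 1)) ε
    · obtain ⟨t, ht, ht'⟩ := hA
      exact small _ hm hc h6 t ht ht'
    by_cases hB : ∃ t ∈ Icc (0 : ℝ) 1, a k ≤ ‖γ t‖
    · obtain ⟨t, ht, ht'⟩ := hB
      exact large _ ha0 ca h5 t ht ht'
    push Not at hA hB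
    refine one_le_rhoLength_of_quarter hγ hp ht₀' hx.1 hγx h1r h1i le_rfl fun t ht => ?_
    have ht' : t ∈ Icc (0 : ℝ) 1 := ⟨ht₀.1.trans ht.1, ht.2⟩
    exact le_chimneyMetric_of_lowerAnnulus hk (hlow t ht) (by linarith [hA t ht']) (hB t ht').le
  · have h5 : 9 * a k < x := by
      by_contra! hc
      exact hxa ⟨by linarith, hc⟩
    rcases le_or_gt (b k / 9) x with h6 | h6
    · exact near _ cb h6 (by linarith)
    by_cases hA : ∃ t ∈ Icc (0 : ℝ) 1, ‖γ t‖ ≤ 3 * a k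
    · obtain ⟨t, ht, ht'⟩ := hA
      exact small _ ha0 ca h5 t ht ht'
    by_cases hB : ∃ t ∈ Icc (0 : ℝ) 1, b k ≤ ‖γ t‖
    · obtain ⟨t, ht, ht'⟩ := hB
      exact large _ hb0 cb h6 t ht ht'
    by_cases hC : ∃ t ∈ Icc (0 : ℝ) 1, ‖γ t‖ ≤ 3 * ε
    · obtain ⟨t, ht, ht'⟩ := hC
      exact small _ hε cε h3 t ht ht'
    push Not at hA hB hC
    exact h.one_le_rhoLength_around_corner hk hγ hW h0 h0i h1r h1i
      (fun t ht => ⟨hA t ht, hB t ht⟩) (fun t ht => by linarith [hC t ht]) ht₀ hi0 h4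

/-- The upper bound for the modulus. -/
lemma modulus_le_scaleSize (h : ChimneySequences a b) {φ ψ : ℂ → ℂ}
    (hφ : IsNormalizedConformalMap (chimneyDomain a b) φ ψ) {n : ℕ} {ε : ℝ}
    (h1 : b (n + 1) ≤ ε) (h2 : ε ≤ b n) :
    modulus (chimneyDomain a b) (curveFamily (boundaryImage (chimneyDomain a b) ψ upperArc)
      (lowerHalfLine ε) (chimneyDomain a b)) ≤
      ENNReal.ofReal (1 / Real.pi * scaleSize a b n ε + levelError * (n + 1)) := by
  refine (iInf₂_le (chimneyMetric a b n ε) ⟨measurable_chimneyMetric a b n ε, ?_⟩).trans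
    (h.lintegral_chimneyMetric_sq_le h1 h2)
  rintro γ ⟨-, hγ0, hγ1, hW⟩ hγ
  obtain ⟨q1, -, q3, q4⟩ := h.position_of_mem_boundaryImage hφ hγ0
  exact h.one_le_rhoLength_chimneyMetric h1 hγ hW q1 q3 q4 hγ1

end ChimneySequences

/-! ### The normalized modulus and its limits -/

lemma coe_ereal_ofReal_of_nonneg {x : ℝ} (hx : 0 ≤ x) : (ENNReal.ofReal x : EReal) = x := by
  rw [EReal.coe_ennreal_ofReal, max_eq_left hx]

namespace ChimneySequences

variable {a b : ℕ → ℝ} {φ ψ : ℂ → ℂ}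

lemma logRatio_zero (h : ChimneySequences a b) : logRatio a b 0 = 0 := by
  simp [logRatio, h.b_zero]

lemma logRatio_succ (h : ChimneySequences a b) (n : ℕ) :
    logRatio a b (n + 1) = logRatio a b n + Real.log (a n / b (n + 1)) := by
  have hA : 0 < ∏ k ∈ Finset.range n, a k := Finset.prod_pos fun k _ => h.a_pos k
  have hB : 0 < ∏ k ∈ Finset.range (n + 1), b k := Finset.prod_pos fun k _ => h.b_pos k
  have ha := h.a_pos n
  have hb := h.b_pos (n + 1)
  rw [logRatio, logRatio, ← Real.log_mul (by positivity) (by positivity),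
    Finset.prod_range_succ a, Finset.prod_range_succ b (n + 1)]
  congr 1
  field_simp

lemma logRatio_nonneg (h : ChimneySequences a b) (n : ℕ) : 0 ≤ logRatio a b n := by
  induction n with
  | zero => exact h.logRatio_zero.ge
  | succ n ih =>
    rw [h.logRatio_succ]
    exact add_nonneg ih (Real.log_nonneg ((one_le_div (h.b_pos _)).2 (h.b_succ_lt_a n).le))

/-- `logRatio` is the part of the logarithmic scale `[b n, 1]` taken up by segments, so it cannot
exceed the whole. This inequality drives the monotonicity of the ratio between `b (n + 1)` and `a
n`. -/
lemma logRatio_le (h : ChimneySequences a b) (n : ℕ) : logRatio a b n ≤ Real.log (1 / b n) := by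
  induction n with
  | zero => simp [h.logRatio_zero, h.b_zero]
  | succ n ih =>
    rw [h.logRatio_succ]
    have ha := h.a_pos n
    have hb := h.b_pos n
    have hb' := h.b_pos (n + 1)
    have := Real.log_lt_log ha (h.a_lt_b n)
    rw [one_div, Real.log_inv] at ih ⊢
    rw [Real.log_div ha.ne' hb'.ne']
    linarith

/-- Counting every scale once telescopes to `log (1 / b n)`; the second count of the segments is
`logRatio`. -/
lemma scaleSum_eq (h : ChimneySequences a b) (n : ℕ) :
    scaleSum a b n = Real.log (1 / b n) + logRatio a b n := by
  induction n with
  | zero => simp [scaleSum, h.logRatio_zero, h.b_zero]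
  | succ n ih =>
    have ha := (h.a_pos n).ne'
    have hb := (h.b_pos n).ne'
    have hb' := (h.b_pos (n + 1)).ne'
    rw [scaleSum, Finset.sum_range_succ, ← scaleSum, ih, h.logRatio_succ, one_div, one_div,
      Real.log_inv, Real.log_inv, Real.log_div ha hb', Real.log_div hb ha]
    ring

lemma scaleSize_eq (h : ChimneySequences a b) (n : ℕ) {ε : ℝ} (hε : 0 < ε) :
    scaleSize a b n ε =
      Real.log (1 / ε) + (logRatio a b n + Real.log (max (a n) ε / ε)) := by
  have hm : max (a n) ε ≠ 0 := (lt_max_of_lt_right hε).ne'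
  have hb := (h.b_pos n).ne'
  rw [scaleSize, h.scaleSum_eq, one_div, one_div, Real.log_inv, Real.log_inv, Real.log_div hb hm,
    Real.log_div hm hε.ne']
  ring

/-- The approximation of the normalized modulus. -/
lemma normalizedModulus_bounds (h : ChimneySequences a b)
    (hφ : IsNormalizedConformalMap (chimneyDomain a b) φ ψ) {n : ℕ} {ε : ℝ}
    (h1 : b (n + 1) ≤ ε) (h2 : ε ≤ b n) (h3 : ε < 1) :
    ((1 + (logRatio a b n + Real.log (max (a n) ε / ε)) / Real.log (1 / ε) : ℝ) : EReal) ≤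
      normalizedModulus a b ψ ε ∧
    (normalizedModulus a b ψ ε : EReal) ≤
      ((1 + (logRatio a b n + Real.log (max (a n) ε / ε)) / Real.log (1 / ε) +
        Real.pi * levelError * (n + 1) / Real.log (1 / ε) : ℝ) : EReal) := by
  have hpi := Real.pi_pos
  have hε : 0 < ε := (h.b_pos _).trans_le h1
  have hL : 0 < Real.log (1 / ε) := Real.log_pos ((one_lt_div hε).2 h3)
  have hR : 0 ≤ logRatio a b n + Real.log (max (a n) ε / ε) :=
    add_nonneg (h.logRatio_nonneg n)
      (Real.log_nonneg ((one_le_div hε).2 (le_max_right _ _)))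
  have hE := levelError_pos
  have hden : 0 < 1 / Real.pi * Real.log (1 / ε) := by positivity
  constructor
  · rw [← coe_ereal_ofReal_of_nonneg (by positivity), EReal.coe_ennreal_le_coe_ennreal_iff,
      normalizedModulus]
    refine le_trans (le_of_eq ?_) (ENNReal.div_le_div_right (h.scaleSize_le_modulus hφ h1 h2) _)
    rw [← ENNReal.ofReal_div_of_pos hden, h.scaleSize_eq n hε]
    congr 1
    field_simp
  · rw [← coe_ereal_ofReal_of_nonneg (by positivity), EReal.coe_ennreal_le_coe_ennreal_iff,
      normalizedModulus]
    refine (ENNReal.div_le_div_right (h.modulus_le_scaleSize hφ h1 h2) _).trans (le_of_eq ?_)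
    rw [← ENNReal.ofReal_div_of_pos hden, h.scaleSize_eq n hε]
    congr 1
    field_simp

/-- The ratio in `normalizedModulus_bounds` is at least that at `a n`. -/
lemma lowerSeq_le (h : ChimneySequences a b) {n : ℕ} {ε : ℝ} (hε : 0 < ε) (h3 : ε < 1) :
    lowerSeq a b n ≤
      1 + (logRatio a b n + Real.log (max (a n) ε / ε)) / Real.log (1 / ε) := by
  have ha := h.a_pos n
  have hL : 0 < Real.log (1 / ε) := Real.log_pos ((one_lt_div hε).2 h3)
  have hα : 0 < Real.log (1 / a n) := Real.log_pos ((one_lt_div ha).2 (h.a_lt_one n))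
  have hq := h.logRatio_nonneg n
  have hqα : logRatio a b n ≤ Real.log (1 / a n) :=
    (h.logRatio_le n).trans (Real.log_le_log (by have := h.b_pos n; positivity)
      (one_div_le_one_div_of_le ha (h.a_lt_b n).le))
  rw [lowerSeq, add_le_add_iff_left, div_le_div_iff₀ hα hL]
  rcases le_total (a n) ε with h4 | h4
  · rw [max_eq_right h4, div_self hε.ne', Real.log_one, add_zero]
    exact mul_le_mul_of_nonneg_left (Real.log_le_log (by positivity)
      (one_div_le_one_div_of_le ha h4)) hq
  · have h5 : Real.log (1 / a n) ≤ Real.log (1 / ε) := Real.log_le_log (by positivity)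
      (one_div_le_one_div_of_le hε h4)
    have e : Real.log (a n / ε) = Real.log (1 / ε) - Real.log (1 / a n) := by
      rw [Real.log_div ha.ne' hε.ne', one_div, one_div, Real.log_inv, Real.log_inv]
      ring
    rw [max_eq_left h4, e]
    -- With `L = log (1/ε)`, `α = log (1 / a n)` and `q = logRatio a b n`, the claim is `(L - α)(α -
    -- q) ≥ 0`.
    nlinarith

/-- The ratio in `normalizedModulus_bounds` is at most that at `b n` or `b (n + 1)`. -/
lemma le_max_upperSeq (h : ChimneySequences a b) {n : ℕ} {ε : ℝ} (hn : b n < 1)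
    (h1 : b (n + 1) ≤ ε) (h2 : ε ≤ b n) :
    1 + (logRatio a b n + Real.log (max (a n) ε / ε)) / Real.log (1 / ε) ≤
      max (upperSeq a b n) (upperSeq a b (n + 1)) := by
  have hε : 0 < ε := (h.b_pos _).trans_le h1
  have ha := h.a_pos n
  have hb := h.b_pos n
  have hb' := h.b_pos (n + 1)
  have hL : 0 < Real.log (1 / ε) := Real.log_pos ((one_lt_div hε).2 (h2.trans_lt hn))
  have hβ : 0 < Real.log (1 / b n) := Real.log_pos ((one_lt_div hb).2 hn)
  have hβ' : 0 < Real.log (1 / b (n + 1)) :=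
    Real.log_pos ((one_lt_div hb').2 (h1.trans_lt (h2.trans_lt hn)))
  have hq := h.logRatio_nonneg n
  have hqα : logRatio a b n ≤ Real.log (1 / a n) :=
    (h.logRatio_le n).trans (Real.log_le_log (by positivity)
      (one_div_le_one_div_of_le ha (h.a_lt_b n).le))
  rcases le_total (a n) ε with h4 | h4
  · refine le_max_of_le_left ?_
    rw [max_eq_right h4, div_self hε.ne', Real.log_one, add_zero, upperSeq]
    have := Real.log_le_log (by positivity) (one_div_le_one_div_of_le hε h2)
    gcongr
  · refine le_max_of_le_right ?_
    have h5 : Real.log (1 / ε) ≤ Real.log (1 / b (n + 1)) := Real.log_le_log (by positivity)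
      (one_div_le_one_div_of_le hb' h1)
    have e : Real.log (a n / ε) = Real.log (1 / ε) - Real.log (1 / a n) := by
      rw [Real.log_div ha.ne' hε.ne', one_div, one_div, Real.log_inv, Real.log_inv]
      ring
    have e' : Real.log (a n / b (n + 1)) = Real.log (1 / b (n + 1)) - Real.log (1 / a n) := by
      rw [Real.log_div ha.ne' hb'.ne', one_div, one_div, Real.log_inv, Real.log_inv]
      ring
    rw [max_eq_left h4, upperSeq, h.logRatio_succ, e, e', add_le_add_iff_left,
      div_le_div_iff₀ hL hβ']
    -- With `β' = log (1 / b (n + 1))` and the analogous `L`, `α`, `q`, the claim is `(α - q)(β' -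
    -- L) ≥ 0`.
    nlinarith

/-- The relative error in `normalizedModulus_bounds`. -/
lemma tendsto_error (h : ChimneySequences a b)
    (hroot : Tendsto (fun n : ℕ => max (a n ^ (1 / (n : ℝ))) (b n ^ (1 / (n : ℝ)))) atTop (𝓝 0)) :
    Tendsto (fun n : ℕ => Real.pi * levelError * (n + 1) / Real.log (1 / b n)) atTop (𝓝 0) := by
  have hpi := Real.pi_pos
  have hE := levelError_pos
  have hu : Tendsto (fun n : ℕ => b n ^ (1 / (n : ℝ))) atTop (𝓝[>] 0) := by
    refine tendsto_nhdsWithin_iff.2 ⟨tendsto_of_tendsto_of_tendsto_of_le_of_le tendsto_const_nhds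
      hroot (fun n => Real.rpow_nonneg (h.b_pos n).le _) fun n => le_max_right _ _, ?_⟩
    exact Eventually.of_forall fun n => Real.rpow_pos_of_pos (h.b_pos n) _
  -- Minus the logarithm of the `n`-th root is `log (1 / b n) / n`, so its inverse `n / log (1 / b
  -- n)` tends to `0`; `n + 1 ≤ 2 n` gives the rest.
  have hv := (tendsto_neg_atBot_atTop.comp (Real.tendsto_log_nhdsGT_zero.comp hu)).inv_tendsto_atTop
  have hv2 := hv.const_mul (2 * (Real.pi * levelError))
  rw [mul_zero] at hv2
  refine tendsto_of_tendsto_of_tendsto_of_le_of_le' tendsto_const_nhds hv2 ?_ ?_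
  · exact Eventually.of_forall fun n => div_nonneg (by positivity)
      (Real.log_nonneg ((one_le_div (h.b_pos n)).2 (h.b_le_one n)))
  · filter_upwards [eventually_ge_atTop 1] with n hn
    have hn' : (1 : ℝ) ≤ n := by exact_mod_cast hn
    have hL : 0 < Real.log (1 / b n) :=
      Real.log_pos ((one_lt_div (h.b_pos n)).2 ((h.b_lt_b hn).trans_eq h.b_zero))
    have e : (-Real.log (b n ^ (1 / (n : ℝ))))⁻¹ = n / Real.log (1 / b n) := by
      rw [Real.log_rpow (h.b_pos n), one_div (b n), Real.log_inv]
      field_simp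
    change _ ≤ 2 * (Real.pi * levelError) * (-Real.log (b n ^ (1 / (n : ℝ))))⁻¹
    rw [e, mul_div_assoc', div_le_div_iff_of_pos_right hL]
    have : 0 < Real.pi * levelError := by positivity
    nlinarith

lemma exists_level_ge (h : ChimneySequences a b) (N : ℕ) {ε : ℝ} (hε : 0 < ε) (hN : ε < b N) :
    ∃ n ≥ N, b (n + 1) ≤ ε ∧ ε ≤ b n := by
  obtain ⟨j, hj⟩ := (((tendsto_add_atTop_iff_nat 1).2 h.tendsto_b).eventually
    (eventually_le_nhds hε)).exists
  obtain ⟨k, -, hk1, hk2⟩ := h.exists_level hj (hN.trans_le (h.b_le_one N))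
  refine ⟨k, ?_, hk1, hk2.le⟩
  by_contra! hc
  exact absurd (hk1.trans_lt hN) (not_lt.2 (h.b_le_b (Nat.succ_le_of_lt hc)))

end ChimneySequences

lemma limsup_coe_tendsto_zero {δ : ℕ → ℝ} (hδ : Tendsto δ atTop (𝓝 0)) :
    limsup (fun n => (δ n : EReal)) atTop = 0 :=
  ((continuous_coe_real_ereal.tendsto 0).comp hδ).limsup_eq

lemma liminf_add_error_le {u : ℕ → EReal} {δ : ℕ → ℝ} (hδ : Tendsto δ atTop (𝓝 0)) :
    liminf (fun n => u n + (δ n : EReal)) atTop ≤ liminf u atTop := by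
  have := EReal.liminf_add_le (f := atTop) (u := fun n => (δ n : EReal)) (v := u)
    (by simp [limsup_coe_tendsto_zero hδ]) (by simp [limsup_coe_tendsto_zero hδ])
  rw [limsup_coe_tendsto_zero hδ, zero_add] at this
  rw [add_comm] at this
  exact this

lemma limsup_add_error_le {u : ℕ → EReal} {δ : ℕ → ℝ} (hδ : Tendsto δ atTop (𝓝 0)) :
    limsup (fun n => u n + (δ n : EReal)) atTop ≤ limsup u atTop := by
  have := EReal.limsup_add_le (f := atTop) (u := fun n => (δ n : EReal)) (v := u)
    (by simp [limsup_coe_tendsto_zero hδ]) (by simp [limsup_coe_tendsto_zero hδ])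
  rw [limsup_coe_tendsto_zero hδ, zero_add] at this
  rw [add_comm] at this
  exact this

lemma continuous_one_add_ereal : Continuous fun x : EReal => 1 + x :=
  continuous_iff_continuousAt.2 fun x =>
    (EReal.continuousAt_add (p := (1, x)) (Or.inl (EReal.coe_ne_top 1)) (Or.inl (EReal.coe_ne_bot 1))).comp
      (continuousAt_const.prodMk continuousAt_id)

lemma monotone_one_add_ereal : Monotone fun x : EReal => 1 + x := fun _ _ h =>
  add_le_add_right h 1

lemma liminf_one_add (u : ℕ → ℝ) : liminf (fun n => ((1 + u n : ℝ) : EReal)) atTop =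
    1 + liminf (fun n => (u n : EReal)) atTop := by
  rw [monotone_one_add_ereal.map_liminf_of_continuousAt _ continuous_one_add_ereal.continuousAt]
  simp [Function.comp_def]

lemma limsup_one_add (u : ℕ → ℝ) : limsup (fun n => ((1 + u n : ℝ) : EReal)) atTop =
    1 + limsup (fun n => (u n : EReal)) atTop := by
  rw [monotone_one_add_ereal.map_limsup_of_continuousAt _ continuous_one_add_ereal.continuousAt]
  simp [Function.comp_def]

namespace ChimneySequences

variable {a b : ℕ → ℝ} {φ ψ : ℂ → ℂ}

/-- Sampling at `ε = a n` bounds the lower limit from above, up to the vanishing error. Conversely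
the modulus at any `ε` of level `n` is at least `lowerSeq a b n`, without error. -/
lemma liminf_normalizedModulus (h : ChimneySequences a b)
    (hroot : Tendsto (fun n : ℕ => max (a n ^ (1 / (n : ℝ))) (b n ^ (1 / (n : ℝ)))) atTop (𝓝 0))
    (hφ : IsNormalizedConformalMap (chimneyDomain a b) φ ψ) :
    liminf (fun ε : ℝ => (normalizedModulus a b ψ ε : EReal)) (𝓝[>] 0) =
      liminf (fun n => (lowerSeq a b n : EReal)) atTop := by
  have hpi := Real.pi_pos
  have hE := levelError_pos
  refine le_antisymm ?_ ((le_liminf_iff).2 fun y hy => ?_)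
  · have ht : Tendsto a atTop (𝓝[>] 0) :=
      tendsto_nhdsWithin_iff.2 ⟨h.tendsto_a, Eventually.of_forall h.a_pos⟩
    calc _ ≤ liminf (fun ε : ℝ => (normalizedModulus a b ψ ε : EReal)) (map a atTop) :=
          liminf_le_liminf_of_le ht
      _ = liminf (fun n => (normalizedModulus a b ψ (a n) : EReal)) atTop := rfl
      _ ≤ liminf (fun n => (lowerSeq a b n : EReal) +
            ((Real.pi * levelError * (n + 1) / Real.log (1 / b n) : ℝ) : EReal)) atTop := by
          refine liminf_le_liminf ?_
          filter_upwards [eventually_ge_atTop 1] with n hn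
          have hb := h.b_pos n
          refine (h.normalizedModulus_bounds hφ (h.b_succ_lt_a n).le (h.a_lt_b n).le
            (h.a_lt_one n)).2.trans ?_
          rw [← EReal.coe_add, EReal.coe_le_coe_iff, max_self, div_self (h.a_pos n).ne',
            Real.log_one, add_zero, lowerSeq]
          have hL : 0 < Real.log (1 / b n) :=
            Real.log_pos ((one_lt_div hb).2 ((h.b_lt_b hn).trans_eq h.b_zero))
          have := Real.log_le_log (by positivity)
            (one_div_le_one_div_of_le (h.a_pos n) (h.a_lt_b n).le)
          gcongr
      _ ≤ _ := liminf_add_error_le (h.tendsto_error hroot)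
  · obtain ⟨N, hN⟩ := eventually_atTop.1 (eventually_lt_of_lt_liminf hy)
    filter_upwards [Ioo_mem_nhdsGT (h.b_pos N)] with ε hε
    obtain ⟨n, hn, h1, h2⟩ := h.exists_level_ge N hε.1 hε.2
    have h3 := hε.2.trans_le (h.b_le_one N)
    exact ((hN n hn).trans_le (EReal.coe_le_coe_iff.2 (h.lowerSeq_le hε.1 h3))).trans_le
      (h.normalizedModulus_bounds hφ h1 h2 h3).1

/-- Sampling at `ε = b n` bounds the upper limit from below. Conversely a scale of level `n` is
controlled by the larger of two consecutive terms, and the upper limit of this maximum is that of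
the sequence. -/
lemma limsup_normalizedModulus (h : ChimneySequences a b)
    (hroot : Tendsto (fun n : ℕ => max (a n ^ (1 / (n : ℝ))) (b n ^ (1 / (n : ℝ)))) atTop (𝓝 0))
    (hφ : IsNormalizedConformalMap (chimneyDomain a b) φ ψ) :
    limsup (fun ε : ℝ => (normalizedModulus a b ψ ε : EReal)) (𝓝[>] 0) =
      limsup (fun n => (upperSeq a b n : EReal)) atTop := by
  have hpi := Real.pi_pos
  have hE := levelError_pos
  refine le_antisymm ?_ ?_
  · set δ : ℕ → ℝ := fun n => Real.pi * levelError * (n + 1) / Real.log (1 / b n) with hδ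
    have hδ0 : Tendsto δ atTop (𝓝 0) := h.tendsto_error hroot
    have hmax : limsup (fun n => max (upperSeq a b n : EReal) (upperSeq a b (n + 1) : EReal)
        + (δ n : EReal)) atTop ≤ limsup (fun n => (upperSeq a b n : EReal)) atTop := by
      refine (limsup_add_error_le hδ0).trans ?_
      rw [limsup_max, max_le_iff]
      exact ⟨le_rfl, (limsup_nat_add (fun n => (upperSeq a b n : EReal)) 1).le⟩
    refine le_trans ((limsup_le_iff).2 fun y hy => ?_) hmax
    obtain ⟨N, hN⟩ := eventually_atTop.1 (eventually_lt_of_limsup_lt hy)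
    -- The index `N + 1` forces the level to be at least `1`, so that `b n < 1` and its logarithm
    -- can serve as a denominator.
    filter_upwards [Ioo_mem_nhdsGT (h.b_pos (N + 1))] with ε hε
    obtain ⟨n, hn, h1, h2⟩ := h.exists_level_ge (N + 1) hε.1 hε.2
    have hb := h.b_pos n
    have hn1 : b n < 1 := (h.b_lt_b (by omega : 0 < n)).trans_eq h.b_zero
    refine ((h.normalizedModulus_bounds hφ h1 h2 (h2.trans_lt hn1)).2.trans ?_).trans_lt
      (hN n (by omega))
    rw [← EReal.coe_strictMono.monotone.map_max, ← EReal.coe_add, EReal.coe_le_coe_iff]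
    refine add_le_add (h.le_max_upperSeq hn1 h1 h2) ?_
    have hL : 0 < Real.log (1 / b n) := Real.log_pos ((one_lt_div hb).2 hn1)
    have := Real.log_le_log (by positivity) (one_div_le_one_div_of_le hε.1 h2)
    simp only [hδ]
    gcongr
  · have ht : Tendsto b atTop (𝓝[>] 0) :=
      tendsto_nhdsWithin_iff.2 ⟨h.tendsto_b, Eventually.of_forall h.b_pos⟩
    calc _ ≤ limsup (fun n => (normalizedModulus a b ψ (b n) : EReal)) atTop := by
          refine limsup_le_limsup ?_
          filter_upwards [eventually_ge_atTop 1] with n hn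
          have hn1 : b n < 1 := (h.b_lt_b hn).trans_eq h.b_zero
          refine le_trans (le_of_eq ?_) (h.normalizedModulus_bounds hφ
            ((h.b_succ_lt_a n).trans (h.a_lt_b n)).le le_rfl hn1).1
          rw [max_eq_right (h.a_lt_b n).le, div_self (h.b_pos n).ne', Real.log_one, add_zero,
            upperSeq]
      _ = limsup (fun ε : ℝ => (normalizedModulus a b ψ ε : EReal)) (map b atTop) := rfl
      _ ≤ _ := limsup_le_limsup_of_le ht

end ChimneySequences

theorem lemma5p1 (a b : ℕ → ℝ) (hab : ChimneySequences a b)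
    (hratio : ∃ c : ℝ, 0 < c ∧ c < 1 ∧ ∀ n, max (b (n + 1) / a n) (a n / b n) < c)
    (hroot : Tendsto (fun n : ℕ => max (a n ^ (1 / (n : ℝ))) (b n ^ (1 / (n : ℝ)))) atTop (𝓝 0))
    (φ ψ : ℂ → ℂ) (hφ : IsNormalizedConformalMap (chimneyDomain a b) φ ψ) :
    (liminf (fun ε : ℝ => (normalizedModulus a b ψ ε : EReal)) (𝓝[>] 0)
        = liminf (fun n => (lowerSeq a b n : EReal)) atTop ∧
      liminf (fun n => (lowerSeq a b n : EReal)) atTop = lowerExponent a b) ∧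
    (limsup (fun ε : ℝ => (normalizedModulus a b ψ ε : EReal)) (𝓝[>] 0)
        = limsup (fun n => (upperSeq a b n : EReal)) atTop ∧
      limsup (fun n => (upperSeq a b n : EReal)) atTop = upperExponent a b) :=
  ⟨⟨hab.liminf_normalizedModulus hroot hφ, liminf_one_add _⟩,
    ⟨hab.limsup_normalizedModulus hroot hφ, limsup_one_add _⟩⟩
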